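/- Fix an infinite supply of element variables $x, y, z, \ldots$ and of set variables $X, Y, Z, \ldots$. For a finite alphabet $\Sigma$, a $\circ$-word over $\Sigma$ is an isomorphism class of countable (possibly finite or empty) linear orders whose elements, called positions, are labelled by letters of $\Sigma$; write $\Sigma^\circ$ for the set of all $\circ$-words over $\Sigma$. The ordered model of a $\circ$-word has its positions as universe, and is equipped with the binary relation $x \le y$ (the order) and, for each $a \in \Sigma$, the unary relation $a(x)$ (position $x$ has label $a$). Formulas of monadic second-order logic (MSO) over this vocabulary are built from the atomic formulas $x \le y$, $x = y$, $a(x)$ and $x \in X$ using $\neg$, $\land$, $\lor$, and the quantifiers $\exists x$, $\forall x$ (over positions) and $\exists X$, $\forall X$ (over sets of positions). A sentence is a formula without free variables, and the language defined by a sentence $\varphi$ is the set of $\circ$-words in $\Sigma^\circ$ whose ordered model satisfies $\varphi$. **Theorem.** The following problem is decidable: given a finite alphabet $\Sigma = \{0, \ldots, n-1\}$ (that is, the number $n$) and an MSO sentence $\varphi$ over $\Sigma$, which defines a language $L \subseteq \Sigma^\circ$, decide whether $L$ is nonempty. -/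

import Mathlib

/-!
Monadic second-order logic over countable words: syntax with an explicit Gödel numbering,
`∘`-words as isomorphism classes of countable labelled linear orders, and satisfaction in the
ordered model of a word.
-/

/-! ### Syntax -/

/-- Formulas of monadic second-order logic over the vocabulary of ordered models of words.
Element variables and set variables are two disjoint families, each indexed by `ℕ`;
letters of the alphabet are numbered by `ℕ` as well. -/
inductive MSOFormula : Type
  /-- the atomic formula `x ≤ y` -/
  | le (x y : ℕ) : MSOFormula
  /-- the atomic formula `x = y` -/
  | eq (x y : ℕ) : MSOFormula
  /-- the atomic formula `a(x)`: position `x` has label `a` -/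
  | lab (a x : ℕ) : MSOFormula
  /-- the atomic formula `x ∈ X` -/
  | mem (x X : ℕ) : MSOFormula
  /-- negation -/
  | neg (φ : MSOFormula) : MSOFormula
  /-- conjunction -/
  | conj (φ ψ : MSOFormula) : MSOFormula
  /-- disjunction -/
  | disj (φ ψ : MSOFormula) : MSOFormula
  /-- `∃ x, φ` for an element variable `x` -/
  | exElem (x : ℕ) (φ : MSOFormula) : MSOFormula
  /-- `∀ x, φ` for an element variable `x` -/
  | allElem (x : ℕ) (φ : MSOFormula) : MSOFormula
  /-- `∃ X, φ` for a set variable `X` -/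
  | exSet (X : ℕ) (φ : MSOFormula) : MSOFormula
  /-- `∀ X, φ` for a set variable `X` -/
  | allSet (X : ℕ) (φ : MSOFormula) : MSOFormula

namespace MSOFormula

/-- The free element variables of a formula. -/
def freeElem : MSOFormula → Finset ℕ
  | le x y => {x, y}
  | eq x y => {x, y}
  | lab _ x => {x}
  | mem x _ => {x}
  | neg φ => φ.freeElem
  | conj φ ψ => φ.freeElem ∪ ψ.freeElem
  | disj φ ψ => φ.freeElem ∪ ψ.freeElem
  | exElem x φ => φ.freeElem.erase x
  | allElem x φ => φ.freeElem.erase x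
  | exSet _ φ => φ.freeElem
  | allSet _ φ => φ.freeElem

/-- The free set variables of a formula. -/
def freeSet : MSOFormula → Finset ℕ
  | le _ _ => ∅
  | eq _ _ => ∅
  | lab _ _ => ∅
  | mem _ X => {X}
  | neg φ => φ.freeSet
  | conj φ ψ => φ.freeSet ∪ ψ.freeSet
  | disj φ ψ => φ.freeSet ∪ ψ.freeSet
  | exElem _ φ => φ.freeSet
  | allElem _ φ => φ.freeSet
  | exSet X φ => φ.freeSet.erase X
  | allSet X φ => φ.freeSet.erase X

/-- The letters `a` such that the predicate `a(x)` is used in the formula. -/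
def letters : MSOFormula → Finset ℕ
  | le _ _ => ∅
  | eq _ _ => ∅
  | lab a _ => {a}
  | mem _ _ => ∅
  | neg φ => φ.letters
  | conj φ ψ => φ.letters ∪ ψ.letters
  | disj φ ψ => φ.letters ∪ ψ.letters
  | exElem _ φ => φ.letters
  | allElem _ φ => φ.letters
  | exSet _ φ => φ.letters
  | allSet _ φ => φ.letters

/-- A formula is a sentence over the `n`-letter alphabet `{0, …, n - 1}` if it has no free
variables and uses no label predicates other than those of the alphabet. -/
def IsSentenceOver (n : ℕ) (φ : MSOFormula) : Prop :=
  φ.freeElem = ∅ ∧ φ.freeSet = ∅ ∧ ∀ a ∈ φ.letters, a < n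

/-! ### Gödel numbering -/

/-- The Gödel number of a formula: the residue modulo `11` is the outermost constructor, and the
quotient is the number of its arguments. -/
def toNat : MSOFormula → ℕ
  | le x y => 11 * Nat.pair x y
  | eq x y => 11 * Nat.pair x y + 1
  | lab a x => 11 * Nat.pair a x + 2
  | mem x X => 11 * Nat.pair x X + 3
  | neg φ => 11 * φ.toNat + 4
  | conj φ ψ => 11 * Nat.pair φ.toNat ψ.toNat + 5
  | disj φ ψ => 11 * Nat.pair φ.toNat ψ.toNat + 6
  | exElem x φ => 11 * Nat.pair x φ.toNat + 7
  | allElem x φ => 11 * Nat.pair x φ.toNat + 8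
  | exSet X φ => 11 * Nat.pair X φ.toNat + 9
  | allSet X φ => 11 * Nat.pair X φ.toNat + 10

/-- The formula with a given Gödel number. -/
def ofNat (k : ℕ) : MSOFormula :=
  if h : k % 11 < 4 then
    match k % 11 with
    | 0 => le (k / 11).unpair.1 (k / 11).unpair.2
    | 1 => eq (k / 11).unpair.1 (k / 11).unpair.2
    | 2 => lab (k / 11).unpair.1 (k / 11).unpair.2
    | _ => mem (k / 11).unpair.1 (k / 11).unpair.2
  else
    have h0 : k / 11 < k := by omega
    have h1 : (k / 11).unpair.1 < k := (Nat.unpair_left_le _).trans_lt h0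
    have h2 : (k / 11).unpair.2 < k := (Nat.unpair_right_le _).trans_lt h0
    match k % 11 with
    | 4 => neg (ofNat (k / 11))
    | 5 => conj (ofNat (k / 11).unpair.1) (ofNat (k / 11).unpair.2)
    | 6 => disj (ofNat (k / 11).unpair.1) (ofNat (k / 11).unpair.2)
    | 7 => exElem (k / 11).unpair.1 (ofNat (k / 11).unpair.2)
    | 8 => allElem (k / 11).unpair.1 (ofNat (k / 11).unpair.2)
    | 9 => exSet (k / 11).unpair.1 (ofNat (k / 11).unpair.2)
    | _ => allSet (k / 11).unpair.1 (ofNat (k / 11).unpair.2)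

theorem ofNat_toNat (φ : MSOFormula) : ofNat φ.toNat = φ := by
  induction φ <;> rw [toNat, ofNat] <;>
    simp [Nat.add_mod, Nat.mul_add_div, *]

theorem toNat_ofNat (k : ℕ) : (ofNat k).toNat = k := by
  induction k using Nat.strong_induction_on with
  | _ k ih =>
    have hk : 11 * (k / 11) + k % 11 = k := Nat.div_add_mod k 11
    rw [ofNat]
    by_cases h : k % 11 < 4
    · rw [dif_pos h]
      generalize k % 11 = r at *
      interval_cases r <;> simp [toNat] <;> omega
    · rw [dif_neg h]
      have h0 : k / 11 < k := by omega
      have i0 := ih _ h0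
      have i1 := ih _ ((Nat.unpair_left_le _).trans_lt h0)
      have i2 := ih _ ((Nat.unpair_right_le _).trans_lt h0)
      have hr : k % 11 < 11 := Nat.mod_lt _ (by norm_num)
      dsimp only
      generalize k % 11 = r at *
      interval_cases r <;> first | omega | (simp [toNat, i0, i1, i2]; omega)

/-- Formulas are inputs of algorithms through their Gödel numbers. -/
instance instDenumerable : Denumerable MSOFormula :=
  Denumerable.mk' ⟨toNat, ofNat, ofNat_toNat, toNat_ofNat⟩

end MSOFormula

/-! ### Countable words -/

/-- A countable linear order whose positions are labelled by letters from `A`.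
The set of positions may be empty. -/
structure CountableLabelledOrder (A : Type) where
  /-- the positions -/
  Pos : Type
  /-- the order on positions -/
  [linearOrder : LinearOrder Pos]
  /-- there are countably many positions (finitely many is allowed) -/
  [countable : Countable Pos]
  /-- the label of each position -/
  label : Pos → A

namespace CountableLabelledOrder

attribute [instance] linearOrder countable

/-- Two labelled orders are isomorphic if some bijection between their positions preserves the
order and the labels. -/
def Iso {A : Type} (u w : CountableLabelledOrder A) : Prop :=
  ∃ e : u.Pos ≃o w.Pos, ∀ p, w.label (e p) = u.label p

instance setoid (A : Type) : Setoid (CountableLabelledOrder A) where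
  r := Iso
  iseqv :=
    { refl := fun u => ⟨OrderIso.refl u.Pos, fun _ => rfl⟩
      symm := by
        rintro u w ⟨e, he⟩
        exact ⟨e.symm, fun p => by rw [← he, OrderIso.apply_symm_apply]⟩
      trans := by
        rintro u v w ⟨e, he⟩ ⟨f, hf⟩
        exact ⟨e.trans f, fun p => by rw [OrderIso.trans_apply, hf, he]⟩ }

/-- Satisfaction of a formula in the ordered model of a word over `{0, …, n - 1}`, where `v`
interprets the element variables and `V` the set variables.
Values of `v` are optional so that sentences can be evaluated in the empty model as well;
an atomic formula about an element variable without a value is false. -/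
def Sat {n : ℕ} (w : CountableLabelledOrder (Fin n)) :
    (ℕ → Option w.Pos) → (ℕ → Set w.Pos) → MSOFormula → Prop
  | v, _, .le x y => ∃ p q, v x = some p ∧ v y = some q ∧ p ≤ q
  | v, _, .eq x y => ∃ p q, v x = some p ∧ v y = some q ∧ p = q
  | v, _, .lab a x => ∃ p, v x = some p ∧ (w.label p : ℕ) = a
  | v, V, .mem x X => ∃ p, v x = some p ∧ p ∈ V X
  | v, V, .neg φ => ¬ w.Sat v V φ
  | v, V, .conj φ ψ => w.Sat v V φ ∧ w.Sat v V ψ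
  | v, V, .disj φ ψ => w.Sat v V φ ∨ w.Sat v V ψ
  | v, V, .exElem x φ => ∃ p : w.Pos, w.Sat (Function.update v x (some p)) V φ
  | v, V, .allElem x φ => ∀ p : w.Pos, w.Sat (Function.update v x (some p)) V φ
  | v, V, .exSet X φ => ∃ P : Set w.Pos, w.Sat v (Function.update V X P) φ
  | v, V, .allSet X φ => ∀ P : Set w.Pos, w.Sat v (Function.update V X P) φ

/-- Truth of a sentence in the ordered model of a word: no variable has a value at the start. -/
def Models {n : ℕ} (w : CountableLabelledOrder (Fin n)) (φ : MSOFormula) : Prop :=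
  w.Sat (fun _ => none) (fun _ => ∅) φ

theorem sat_map {n : ℕ} {u w : CountableLabelledOrder (Fin n)} (e : u.Pos ≃o w.Pos)
    (he : ∀ p, w.label (e p) = u.label p) (φ : MSOFormula) :
    ∀ (v : ℕ → Option u.Pos) (V : ℕ → Set u.Pos),
      w.Sat (fun x => (v x).map e) (fun X => e '' V X) φ ↔ u.Sat v V φ := by
  have hv : ∀ (v : ℕ → Option u.Pos) (x : ℕ) (p : u.Pos),
      Function.update (fun y => (v y).map e) x (some (e p)) =
        fun y => (Function.update v x (some p) y).map e := by
    intro v x p; funext y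
    by_cases h : y = x <;> simp [Function.update, h]
  have hV : ∀ (V : ℕ → Set u.Pos) (X : ℕ) (P : Set u.Pos),
      Function.update (fun Y => e '' V Y) X (e '' P) =
        fun Y => e '' (Function.update V X P Y) := by
    intro V X P; funext Y
    by_cases h : Y = X
    · subst h; simp
    · simp [Function.update, h]
  have hs : Function.Surjective (fun P : Set u.Pos => e '' P) :=
    Set.image_surjective.mpr e.surjective
  induction φ with
  | le x y => intro v V; simp [Sat]
  | eq x y => intro v V; simp [Sat]
  | lab a x => intro v V; simp [Sat, he]
  | mem x X => intro v V; simp [Sat]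
  | neg φ ih => intro v V; simp [Sat, ih]
  | conj φ ψ ih₁ ih₂ => intro v V; simp only [Sat, ih₁, ih₂]
  | disj φ ψ ih₁ ih₂ => intro v V; simp only [Sat, ih₁, ih₂]
  | exElem x φ ih => intro v V; simp only [Sat, e.surjective.exists, hv, ih]
  | allElem x φ ih => intro v V; simp only [Sat, e.surjective.forall, hv, ih]
  | exSet X φ ih => intro v V; simp only [Sat, hs.exists, hV, ih]
  | allSet X φ ih => intro v V; simp only [Sat, hs.forall, hV, ih]

theorem models_congr {n : ℕ} {u w : CountableLabelledOrder (Fin n)} (h : u ≈ w)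
    (φ : MSOFormula) : u.Models φ ↔ w.Models φ := by
  obtain ⟨e, he⟩ := h
  have := sat_map e he φ (fun _ => none) (fun _ => ∅)
  simpa [Models] using this.symm

end CountableLabelledOrder

/-- The type `A°` of `∘`-words over the alphabet `A`: isomorphism classes of countable
`A`-labelled linear orders. -/
def CircWord (A : Type) : Type 1 :=
  Quotient (CountableLabelledOrder.setoid A)

/-- The ordered model of the `∘`-word satisfies the formula. -/
def CircWord.Models {n : ℕ} (w : CircWord (Fin n)) (φ : MSOFormula) : Prop :=
  Quotient.liftOn w (fun u => u.Models φ)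
    (fun _ _ h => propext (CountableLabelledOrder.models_congr h φ))

/-- The language of `∘`-words over `{0, …, n - 1}` defined by a sentence. -/
def MSOFormula.language (n : ℕ) (φ : MSOFormula) : Set (CircWord (Fin n)) :=
  {w | w.Models φ}

/-! The proof evaluates words in finite algebras. An algebra has a product, an ω-power, an ω*-power
and a shuffle operation on finitely many numbers; `IsEval` says that an assignment of values to sets
of positions respects these operations. No axioms such as associativity are imposed, since every use
goes through an evaluation.

Two facts make such algebras effective. By `IsEval.cl_univ`, the value of a nonempty countable word
lies in the subalgebra generated by the values of its letters. This is a condensation argument: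
identify positions between which all intervals have generated values. A class is cut into bounded
pieces along cofinal sequences and handled by Ramsey factorization and the ω-powers. If several
classes remained, they would be densely ordered, and an interval of classes showing the fewest
values would be a shuffle, hence would collapse to one class. Conversely, by `Cl.realized`, every
generated element is the value of some word. The set of values of all nonempty words over given
letters is therefore a finite closure.

Formulas become recognizers by induction (`recOf_recognizes`), with free variables as additional
tracks of the labels. Negation complements the accepted values, conjunction takes products, and
quantification passes to the algebra of sets of elements (`powAlg_isEval`). The difficult operation
there is the shuffle, because positions carrying the same set may choose different elements of it.
Its value is again a closure: in the product with `shufAlg`, an algebra recognizing shuffles of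
given colours, one asks which pairs `(a, 1)` are generated. Skolem's theorem on the uniqueness of
shuffles (`Shuffled.exists_iso`) moves the word realizing such a pair onto the shuffle under
consideration.

A sentence then has a model iff its recognizer accepts the empty word or some generated value
(`exists_models_iff`). All data are finite tables, closures are found by inspecting all subsets, and
the recognizer is built by recursion on the Gödel number, so the whole procedure is primitive
recursive. -/

/-! ### Bit masks -/

/-- The number whose binary digits below `n` are given by `p`. -/
def bitMask : ℕ → (ℕ → Bool) → ℕ
  | 0, _ => 0
  | n + 1, p => bitMask n p + if p n then 2 ^ n else 0

theorem bitMask_lt (n : ℕ) (p : ℕ → Bool) : bitMask n p < 2 ^ n := by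
  induction n with
  | zero => simp [bitMask]
  | succ n ih => rw [bitMask, pow_succ]; split_ifs <;> omega

theorem testBit_bitMask (n : ℕ) (p : ℕ → Bool) (i : ℕ) :
    (bitMask n p).testBit i = (decide (i < n) && p i) := by
  induction n with
  | zero => simp [bitMask]
  | succ n ih =>
    have hlt := bitMask_lt n p
    rw [bitMask]
    by_cases hp : p n
    · rw [if_pos hp, Nat.add_comm]
      rcases lt_trichotomy i n with h | rfl | h
      · rw [Nat.testBit_two_pow_add_gt h, ih]; simp [h, Nat.lt_succ_of_lt h]
      · rw [Nat.testBit_two_pow_add_eq, ih]; simp [hp]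
      · have : ¬ i < n + 1 := by omega
        rw [Nat.testBit_lt_two_pow]
        · simp [this]
        · calc 2 ^ n + bitMask n p < 2 ^ n + 2 ^ n := by omega
            _ = 2 ^ (n + 1) := by ring
            _ ≤ 2 ^ i := Nat.pow_le_pow_right (by norm_num) h
    · rw [if_neg hp, Nat.add_zero, ih]
      rcases lt_trichotomy i n with h | rfl | h
      · simp [h, Nat.lt_succ_of_lt h]
      · simp [hp]
      · simp [show ¬ i < n by omega, show ¬ i < n + 1 by omega]

open Classical in
/-- The number whose binary digits below `n` are given by the predicate `p`. -/
noncomputable def mask (n : ℕ) (p : ℕ → Prop) : ℕ := bitMask n fun i => decide (p i)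

theorem mask_lt (n : ℕ) (p : ℕ → Prop) : mask n p < 2 ^ n := bitMask_lt _ _

theorem testBit_mask {n : ℕ} {p : ℕ → Prop} {i : ℕ} :
    (mask n p).testBit i = true ↔ i < n ∧ p i := by
  simp [mask, testBit_bitMask]

theorem lt_of_testBit {m n i : ℕ} (hm : m < 2 ^ n) (h : m.testBit i = true) : i < n := by
  by_contra hi
  rw [Nat.testBit_lt_two_pow (hm.trans_le (Nat.pow_le_pow_right (by norm_num) (by omega)))] at h
  cases h

theorem mask_eq_of_testBit {n m : ℕ} {p : ℕ → Prop} (hm : m < 2 ^ n)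
    (h : ∀ i < n, p i ↔ m.testBit i = true) : mask n p = m := by
  apply Nat.eq_of_testBit_eq
  intro i
  rw [Bool.eq_iff_iff, testBit_mask]
  constructor
  · rintro ⟨hi, hp⟩; exact (h i hi).1 hp
  · intro hi
    have := lt_of_testBit hm hi
    exact ⟨this, (h i this).2 hi⟩

theorem mask_congr {n : ℕ} {p q : ℕ → Prop} (h : ∀ i < n, p i ↔ q i) : mask n p = mask n q :=
  mask_eq_of_testBit (mask_lt _ _) fun i hi => by rw [testBit_mask, h i hi]; simp [hi]

theorem bitMask_eq_mask {n : ℕ} {f : ℕ → Bool} {p : ℕ → Prop} (h : ∀ i < n, f i = true ↔ p i) :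
    bitMask n f = mask n p := by
  symm
  refine mask_eq_of_testBit (bitMask_lt _ _) fun i hi => ?_
  rw [testBit_bitMask, ← h i hi]; simp [hi]

theorem mask_ne_zero {n : ℕ} {p : ℕ → Prop} (h : ∃ i < n, p i) : mask n p ≠ 0 := by
  obtain ⟨i, hi, hp⟩ := h
  intro h0
  have : (mask n p).testBit i = true := testBit_mask.2 ⟨hi, hp⟩
  rw [h0] at this; simp at this

/-! ### Finite algebras for countable words -/

/-- The data of a finite algebra for countable words: elements are the numbers below `n`, with a
binary product, the `ω`-power, the `ω*`-power and the shuffle of a set of elements, given by the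
bit mask of the set. -/
structure CircAlg where
  n : ℕ
  mul : ℕ → ℕ → ℕ
  om : ℕ → ℕ
  os : ℕ → ℕ
  sh : ℕ → ℕ

/-- All elements of `s` are strictly below all elements of `t`. -/
def SetLT {P : Type} [LinearOrder P] (s t : Set P) : Prop := ∀ x ∈ s, ∀ y ∈ t, x < y

/-- `ev` assigns to each set of positions the value of the corresponding subword, compatibly with
the operations of the algebra. -/
structure IsEval (A : CircAlg) {P : Type} [LinearOrder P] (ev : Set P → ℕ) : Prop where
  lt : ∀ s, ev s < A.n
  -- The laws concern nonempty sets only: the value of the empty set is unconstrained and no unit is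
  -- needed.
  mul : ∀ s t : Set P, s.Nonempty → t.Nonempty → SetLT s t → ev (s ∪ t) = A.mul (ev s) (ev t)
  om : ∀ (a : ℕ) (s : ℕ → Set P), (∀ i, (s i).Nonempty) → (∀ i j, i < j → SetLT (s i) (s j)) →
    (∀ i, ev (s i) = a) → ev (⋃ i, s i) = A.om a
  os : ∀ (a : ℕ) (s : ℕ → Set P), (∀ i, (s i).Nonempty) → (∀ i j, i < j → SetLT (s j) (s i)) →
    (∀ i, ev (s i) = a) → ev (⋃ i, s i) = A.os a
  sh : ∀ (I : Type) [LinearOrder I] [Countable I] [DenselyOrdered I] [NoMinOrder I]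
    [NoMaxOrder I] [Nonempty I] (s : I → Set P), (∀ i, (s i).Nonempty) →
    (∀ i j, i < j → SetLT (s i) (s j)) →
    (∀ i j k, i < j → ∃ l, i < l ∧ l < j ∧ ev (s l) = ev (s k)) →
    ev (⋃ i, s i) = A.sh (mask A.n fun a => ∃ i, ev (s i) = a)

/-- The opposite algebra, for reversed words. -/
def CircAlg.op (A : CircAlg) : CircAlg where
  n := A.n
  mul x y := A.mul y x
  om := A.os
  os := A.om
  sh := A.sh

/-- Reversal exchanges ω and ω*, so each statement about ω*-sequences follows from its ω-version on
the dual order. -/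
theorem IsEval.op {A : CircAlg} {P : Type} [LinearOrder P] {ev : Set P → ℕ} (h : IsEval A ev) :
    IsEval A.op (P := Pᵒᵈ) fun s => ev (OrderDual.toDual ⁻¹' s) where
  lt s := h.lt _
  mul s t hs ht hst := by
    rw [Set.preimage_union, Set.union_comm]
    exact h.mul _ _ ht hs fun x hx y hy => hst y hy x hx
  om a s hs hlt ha := by
    rw [Set.preimage_iUnion]
    exact h.os a _ hs (fun i j hij x hx y hy => hlt i j hij y hy x hx) ha
  os a s hs hlt ha := by
    rw [Set.preimage_iUnion]
    exact h.om a _ hs (fun i j hij x hx y hy => hlt i j hij y hy x hx) ha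
  sh I _ _ _ _ _ _ s hs hlt hd := by
    rw [Set.preimage_iUnion]
    have : Countable Iᵒᵈ := ‹Countable I›
    refine h.sh Iᵒᵈ (fun i => OrderDual.toDual ⁻¹' (s (OrderDual.ofDual i))) hs
      (fun i j hij x hx y hy => hlt _ _ hij y hy x hx) (fun i j k hij => ?_)
    obtain ⟨l, h1, h2, h3⟩ := hd _ _ (OrderDual.ofDual k) hij
    exact ⟨OrderDual.toDual l, h2, h1, h3⟩

/-- The subsemigroup generated by a set of elements. -/
inductive SGen (A : CircAlg) (G : ℕ → Prop) : ℕ → Prop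
  -- The operations are total on `ℕ`; the bounds in the constructors keep generation inside the
  -- finite algebra.
  | gen (x : ℕ) : x < A.n → G x → SGen A G x
  | mul (x y : ℕ) : SGen A G x → SGen A G y → A.mul x y < A.n → SGen A G (A.mul x y)

/-- The subalgebra generated by a set of elements. -/
inductive Cl (A : CircAlg) (G : ℕ → Prop) : ℕ → Prop
  | gen (x : ℕ) : x < A.n → G x → Cl A G x
  | mul (x y : ℕ) : Cl A G x → Cl A G y → A.mul x y < A.n → Cl A G (A.mul x y)
  | om (x : ℕ) : Cl A G x → A.om x < A.n → Cl A G (A.om x)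
  | os (x : ℕ) : Cl A G x → A.os x < A.n → Cl A G (A.os x)
  | sh (m : ℕ) : m ≠ 0 → m < 2 ^ A.n → (∀ i, m.testBit i = true → Cl A G i) → A.sh m < A.n →
      Cl A G (A.sh m)

/-! ### Consecutive blocks of an ω-sequence and Ramsey factorization. -/

/-- The union of the members of a sequence of sets with index in `[a, b)`. -/
def block {P : Type} (s : ℕ → Set P) (a b : ℕ) : Set P := ⋃ i, ⋃ (_ : a ≤ i ∧ i < b), s i

section Block

variable {P : Type} {s : ℕ → Set P}

theorem mem_block {a b : ℕ} {x : P} : x ∈ block s a b ↔ ∃ i, (a ≤ i ∧ i < b) ∧ x ∈ s i := by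
  simp [block]

theorem block_nonempty (hs : ∀ i, (s i).Nonempty) {a b : ℕ} (hab : a < b) :
    (block s a b).Nonempty := by
  obtain ⟨x, hx⟩ := hs a
  exact ⟨x, mem_block.2 ⟨a, ⟨le_rfl, hab⟩, hx⟩⟩

theorem block_lt [LinearOrder P] (hlt : ∀ i j, i < j → SetLT (s i) (s j)) (a b c d : ℕ)
    (hbc : b ≤ c) : SetLT (block s a b) (block s c d) := by
  intro x hx y hy
  obtain ⟨i, hi, hx⟩ := mem_block.1 hx
  obtain ⟨j, hj, hy⟩ := mem_block.1 hy
  exact hlt i j (by omega) x hx y hy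

theorem block_union {a b c : ℕ} (hab : a ≤ b) (hbc : b ≤ c) :
    block s a b ∪ block s b c = block s a c := by
  ext x
  simp only [Set.mem_union, mem_block]
  constructor
  · rintro (⟨i, hi, hx⟩ | ⟨i, hi, hx⟩)
    · exact ⟨i, by omega, hx⟩
    · exact ⟨i, by omega, hx⟩
  · rintro ⟨i, hi, hx⟩
    by_cases hib : i < b
    · exact Or.inl ⟨i, by omega, hx⟩
    · exact Or.inr ⟨i, by omega, hx⟩

theorem block_one (a : ℕ) : block s a (a + 1) = s a := by
  ext x
  rw [mem_block]
  constructor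
  · rintro ⟨i, hi, hx⟩
    obtain rfl : i = a := by omega
    exact hx
  · intro hx; exact ⟨a, by omega, hx⟩

theorem iUnion_eq_blocks {q : ℕ → ℕ} (hq : StrictMono q) :
    (⋃ i, s i) = block s 0 (q 0) ∪ ⋃ k, block s (q k) (q (k + 1)) := by
  classical
  ext x
  simp only [Set.mem_iUnion, Set.mem_union, mem_block]
  constructor
  · rintro ⟨i, hx⟩
    by_cases hi : i < q 0
    · exact Or.inl ⟨i, by omega, hx⟩
    · have hex : ∃ k, i < q k := ⟨i + 1, (Nat.lt_succ_self i).trans_le (hq.id_le _)⟩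
      have hk0 : Nat.find hex ≠ 0 := by
        intro h0
        have := Nat.find_spec hex
        rw [h0] at this
        exact hi this
      obtain ⟨k, hk⟩ := Nat.exists_eq_succ_of_ne_zero hk0
      refine Or.inr ⟨k, i, ⟨?_, ?_⟩, hx⟩
      · exact not_lt.1 (Nat.find_min hex (by omega : k < Nat.find hex))
      · have := Nat.find_spec hex
        rwa [hk] at this
  · rintro (⟨i, -, hx⟩ | ⟨k, i, -, hx⟩)
    · exact ⟨i, hx⟩
    · exact ⟨i, hx⟩

/-- Evaluation of an `ω`-sequence cut into blocks, all but the first having the same value. -/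
theorem IsEval.blocks [LinearOrder P] {A : CircAlg} {ev : Set P → ℕ} (h : IsEval A ev)
    (hs : ∀ i, (s i).Nonempty) (hlt : ∀ i j, i < j → SetLT (s i) (s j)) {q : ℕ → ℕ}
    (hq : StrictMono q) (hq0 : 0 < q 0) {e : ℕ} (he : ∀ k, ev (block s (q k) (q (k + 1))) = e) :
    A.om e < A.n ∧ ev (⋃ i, s i) = A.mul (ev (block s 0 (q 0))) (A.om e) := by
  have hq1 : ∀ k, q k < q (k + 1) := fun k => hq (Nat.lt_succ_self k)
  have tail : ev (⋃ k, block s (q k) (q (k + 1))) = A.om e :=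
    h.om e _ (fun k => block_nonempty hs (hq1 k))
      (fun i j hij => block_lt hlt _ _ _ _ (hq.monotone hij)) he
  refine ⟨tail ▸ h.lt _, ?_⟩
  rw [iUnion_eq_blocks hq, h.mul _ _ (block_nonempty hs hq0), tail]
  · obtain ⟨x, hx⟩ := block_nonempty hs (hq1 0)
    exact ⟨x, Set.mem_iUnion.2 ⟨0, hx⟩⟩
  · intro x hx y hy
    obtain ⟨k, hy⟩ := Set.mem_iUnion.1 hy
    exact block_lt hlt _ _ _ _ (hq.monotone (Nat.zero_le k)) x hx y hy

end Block

/-- A partition of an `ω`-sequence into infinitely many blocks, all but the first having the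
same value. -/
theorem IsEval.exists_factor {A : CircAlg} {P : Type} [LinearOrder P] {ev : Set P → ℕ}
    (h : IsEval A ev) (s : ℕ → Set P) (hs : ∀ i, (s i).Nonempty)
    (hlt : ∀ i j, i < j → SetLT (s i) (s j)) :
    ∃ x y, SGen A (fun a => ∃ i, ev (s i) = a) x ∧ SGen A (fun a => ∃ i, ev (s i) = a) y ∧
      A.om y < A.n ∧ ev (⋃ i, s i) = A.mul x (A.om y) := by
  have gen : ∀ a d, SGen A (fun a => ∃ i, ev (s i) = a) (ev (block s a (a + d + 1))) := by
    intro a d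
    induction d with
    | zero => rw [Nat.add_zero, block_one]; exact SGen.gen _ (h.lt _) ⟨a, rfl⟩
    | succ d ih =>
      have hm := h.mul _ _ (block_nonempty hs (a := a) (b := a + d + 1) (by omega))
        (block_nonempty hs (a := a + d + 1) (b := a + (d + 1) + 1) (by omega)) (block_lt hlt _ _ _ _ le_rfl)
      rw [block_union (by omega) (by omega)] at hm
      have hb : block s (a + d + 1) (a + (d + 1) + 1) = s (a + d + 1) := block_one _
      rw [hb] at hm
      have hl := h.lt (block s a (a + (d + 1) + 1))
      rw [hm] at hl ⊢
      exact SGen.mul _ _ ih (SGen.gen _ (h.lt _) ⟨_, rfl⟩) hl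
  have gen' : ∀ a b, a < b → SGen A (fun a => ∃ i, ev (s i) = a) (ev (block s a b)) := by
    intro a b hab
    obtain ⟨d, rfl⟩ : ∃ d, b = a + d + 1 := ⟨b - a - 1, by omega⟩
    exact gen a d
  -- Ramsey's theorem through a nonprincipal ultrafilter: `c a` is the value of `block s a b` for
  -- almost all `b`, and `e` is the value of `c a` for almost all `a`. Only consecutive blocks need
  -- the value `e`, so neither idempotence nor associativity enters.
  let U : Ultrafilter ℕ := Filter.hyperfilter ℕ
  have hU : ∀ a, ∀ᶠ i in (U : Filter ℕ), a < i := by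
    intro a
    have : (U : Filter ℕ) ≤ Filter.atTop := by
      rw [← Nat.cofinite_eq_atTop]; exact Filter.hyperfilter_le_cofinite
    exact this (Filter.eventually_gt_atTop a)
  have pig : ∀ f : ℕ → ℕ, (∀ i, f i < A.n) → ∃ c, ∀ᶠ i in (U : Filter ℕ), f i = c := by
    intro f hf
    have h1 : ∀ᶠ i in (U : Filter ℕ), ∃ c ∈ Finset.range A.n, f i = c :=
      Filter.Eventually.of_forall fun i => ⟨f i, Finset.mem_range.2 (hf i), rfl⟩
    have h2 := (Ultrafilter.eventually_exists_mem_iff (Finset.finite_toSet (Finset.range A.n))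
      (f := U) (P := fun c i => f i = c)).1 (by simpa using h1)
    obtain ⟨c, -, hc⟩ := h2
    exact ⟨c, hc⟩
  choose c hc using fun a => pig (fun b => ev (block s a b)) fun b => h.lt _
  obtain ⟨e, he⟩ := pig c fun a => by
    obtain ⟨i, hi⟩ := (hc a).exists
    rw [← hi]; exact h.lt _
  -- From a cut `a` with `c a = e`, almost every `b` is a legitimate next cut. The witness `0` in
  -- the other case is never used.
  have next : ∀ a, ∃ b, c a = e → a < b ∧ ev (block s a b) = e ∧ c b = e := by
    intro a
    by_cases ha : c a = e
    · obtain ⟨b, h1, h2, h3⟩ := ((hU a).and ((hc a).and he)).exists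
      exact ⟨b, fun _ => ⟨h1, h2.trans ha, h3⟩⟩
    · exact ⟨0, fun h => (ha h).elim⟩
  choose nx hnx using next
  obtain ⟨b0, hb0, hcb0⟩ := ((hU 0).and he).exists
  let q : ℕ → ℕ := fun k => nx^[k] b0
  have hq : ∀ k, c (q k) = e := by
    intro k
    induction k with
    | zero => exact hcb0
    | succ k ih => change c (nx^[k + 1] b0) = e; rw [Function.iterate_succ_apply']; exact (hnx _ ih).2.2
  have hqs : ∀ k, q (k + 1) = nx (q k) := fun k => Function.iterate_succ_apply' nx k b0
  have hq1 : ∀ k, q k < q (k + 1) := fun k => by rw [hqs]; exact (hnx _ (hq k)).1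
  have hqm : StrictMono q := strictMono_nat_of_lt_succ hq1
  have hqe : ∀ k, ev (block s (q k) (q (k + 1))) = e := fun k => by rw [hqs]; exact (hnx _ (hq k)).2.1
  refine ⟨ev (block s 0 b0), e, gen' _ _ hb0, ?_, h.blocks hs hlt hqm hb0 hqe⟩
  rw [← hqe 0]; exact gen' _ _ (hq1 0)

theorem SGen.closed {A : CircAlg} {G K : ℕ → Prop} (hG : ∀ x < A.n, G x → K x)
    (hmul : ∀ x y, K x → K y → A.mul x y < A.n → K (A.mul x y)) {x : ℕ} (h : SGen A G x) : K x := by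
  induction h with
  | gen x hlt hx => exact hG x hlt hx
  | mul x y _ _ hlt ihx ihy => exact hmul x y ihx ihy hlt

theorem SGen.op {A : CircAlg} {G : ℕ → Prop} {x : ℕ} (h : SGen A G x) : SGen A.op G x := by
  induction h with
  | gen x hlt hx => exact SGen.gen (A := A.op) x hlt hx
  | mul x y _ _ hlt ihx ihy => exact SGen.mul (A := A.op) y x ihy ihx hlt

theorem SGen.op_iff {A : CircAlg} {G : ℕ → Prop} {x : ℕ} : SGen A.op G x ↔ SGen A G x :=
  ⟨fun h => h.op, fun h => h.op⟩

/-! ### Values of countable words are generated by values of letters -/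

/-- A countable set without greatest element has a
strictly increasing cofinal sequence starting at a given element. -/
theorem exists_cofinal_seq {P : Type} [LinearOrder P] [Countable P] {J : Set P} {p : P}
    (hp : p ∈ J) (hJ : ∀ x ∈ J, ∃ y ∈ J, x < y) :
    ∃ x : ℕ → P, x 0 = p ∧ StrictMono x ∧ (∀ n, x n ∈ J) ∧ ∀ y ∈ J, ∃ n, y ≤ x n := by
  have : Nonempty J := ⟨⟨p, hp⟩⟩
  obtain ⟨e, he⟩ := exists_surjective_nat J
  have step : ∀ a b : J, ∃ c : J, a < c ∧ b < c := by
    intro a b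
    obtain ⟨y, hy, hlt⟩ := hJ (max a b : J) (max a b : J).2
    exact ⟨⟨y, hy⟩, lt_of_le_of_lt (le_max_left a b) hlt, lt_of_le_of_lt (le_max_right a b) hlt⟩
  choose f hf using step
  -- Each new term exceeds both its predecessor and the next element of an enumeration of `J`,
  -- whence cofinality.
  let x : ℕ → J := fun n => Nat.rec ⟨p, hp⟩ (fun k a => f a (e k)) n
  have hx : ∀ n, x (n + 1) = f (x n) (e n) := fun n => rfl
  have hm : StrictMono x := strictMono_nat_of_lt_succ fun n => by rw [hx]; exact (hf _ _).1
  refine ⟨fun n => (x n).1, rfl, fun a b h => hm h, fun n => (x n).2, fun y hy => ?_⟩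
  obtain ⟨n, hn⟩ := he ⟨y, hy⟩
  refine ⟨n + 1, ?_⟩
  have : e n < x (n + 1) := by rw [hx]; exact (hf _ _).2
  rw [hn] at this
  exact le_of_lt this

section Decomposition

variable {A : CircAlg} {P : Type} [LinearOrder P] {ev : Set P → ℕ} {K : ℕ → Prop}

/-- Covers the cases in which a part is empty, about which the product law is silent. -/
theorem IsEval.split (h : IsEval A ev)
    (hmul : ∀ x y, K x → K y → A.mul x y < A.n → K (A.mul x y)) {J J₁ J₂ : Set P}
    (hJ : J = J₁ ∪ J₂) (hlt : SetLT J₁ J₂) (h₁ : J₁.Nonempty → K (ev J₁))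
    (h₂ : J₂.Nonempty → K (ev J₂)) (hne : J.Nonempty) : K (ev J) := by
  subst hJ
  rcases J₁.eq_empty_or_nonempty with rfl | n₁
  · rw [Set.empty_union] at hne ⊢; exact h₂ hne
  rcases J₂.eq_empty_or_nonempty with rfl | n₂
  · rw [Set.union_empty] at hne ⊢; exact h₁ hne
  have hl := h.lt (J₁ ∪ J₂)
  rw [h.mul _ _ n₁ n₂ hlt] at hl ⊢
  exact hmul _ _ (h₁ n₁) (h₂ n₂) hl

/-- If `J` has a greatest element `q`, the part above `p` lies in `[p, q]`. Otherwise a cofinal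
sequence cuts it into half-open intervals, and `exists_factor` expresses the value of their union by
products and one ω-power of values in `K`. -/
theorem IsEval.above [Countable P] (h : IsEval A ev)
    (hmul : ∀ x y, K x → K y → A.mul x y < A.n → K (A.mul x y))
    (hom : ∀ x, K x → A.om x < A.n → K (A.om x)) {J : Set P} (hJ : J.OrdConnected)
    (hR : ∀ x ∈ J, ∀ y ∈ J, ∀ J' : Set P, J'.OrdConnected → J'.Nonempty → J' ⊆ Set.Icc x y →
      K (ev J')) {p : P} (hp : p ∈ J) (hne : (J ∩ Set.Ioi p).Nonempty) :
    K (ev (J ∩ Set.Ioi p)) := by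
  by_cases hmax : ∃ q ∈ J, ∀ x ∈ J, x ≤ q
  · obtain ⟨q, hq, hmax⟩ := hmax
    exact hR p hp q hq _ (hJ.inter Set.ordConnected_Ioi) hne fun x hx => ⟨hx.2.le, hmax x hx.1⟩
  · push Not at hmax
    obtain ⟨x, hx0, hxm, hxJ, hxc⟩ := exists_cofinal_seq hp hmax
    let s : ℕ → Set P := fun i => Set.Ioc (x i) (x (i + 1))
    have hu : J ∩ Set.Ioi p = ⋃ i, s i := by
      ext y
      simp only [Set.mem_inter_iff, Set.mem_Ioi, Set.mem_iUnion, s, Set.mem_Ioc]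
      constructor
      · rintro ⟨hyJ, hpy⟩
        have hex := hxc y hyJ
        have h0 : Nat.find hex ≠ 0 := by
          intro h0
          have := Nat.find_spec hex
          rw [h0, hx0] at this
          exact absurd hpy (not_lt.2 this)
        obtain ⟨k, hk⟩ := Nat.exists_eq_succ_of_ne_zero h0
        refine ⟨k, not_le.1 (Nat.find_min hex (by omega : k < Nat.find hex)), ?_⟩
        have := Nat.find_spec hex
        rwa [hk] at this
      · rintro ⟨i, h1, h2⟩
        have hpi : p ≤ x i := by rw [← hx0]; exact hxm.monotone (Nat.zero_le i)
        exact ⟨hJ.out hp (hxJ (i + 1)) ⟨hpi.trans h1.le, h2⟩, hpi.trans_lt h1⟩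
    have hsne : ∀ i, (s i).Nonempty := fun i => ⟨x (i + 1), hxm (Nat.lt_succ_self i), le_rfl⟩
    have hslt : ∀ i j, i < j → SetLT (s i) (s j) := fun i j hij a ha b hb =>
      (ha.2.trans (hxm.monotone hij)).trans_lt hb.1
    have hsK : ∀ i, K (ev (s i)) := fun i =>
      hR _ (hxJ i) _ (hxJ (i + 1)) _ Set.ordConnected_Ioc (hsne i) Set.Ioc_subset_Icc_self
    obtain ⟨a, b, ha, hb, hlo, hab⟩ := h.exists_factor s hsne hslt
    have ha' : K a := ha.closed (by rintro _ - ⟨i, rfl⟩; exact hsK i) hmul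
    have hb' : K b := hb.closed (by rintro _ - ⟨i, rfl⟩; exact hsK i) hmul
    have hl := h.lt (⋃ i, s i)
    rw [hu]
    rw [hab] at hl ⊢
    exact hmul _ _ ha' (hom _ hb' hlo) hl

theorem IsEval.below [Countable P] (h : IsEval A ev)
    (hmul : ∀ x y, K x → K y → A.mul x y < A.n → K (A.mul x y))
    (hos : ∀ x, K x → A.os x < A.n → K (A.os x)) {J : Set P} (hJ : J.OrdConnected)
    (hR : ∀ x ∈ J, ∀ y ∈ J, ∀ J' : Set P, J'.OrdConnected → J'.Nonempty → J' ⊆ Set.Icc x y →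
      K (ev J')) {p : P} (hp : p ∈ J) (hne : (J ∩ Set.Iio p).Nonempty) :
    K (ev (J ∩ Set.Iio p)) := by
  have : Countable Pᵒᵈ := ‹Countable P›
  refine h.op.above (K := K) (J := OrderDual.ofDual ⁻¹' J) (p := OrderDual.toDual p)
    (fun x y hx hy hl => hmul y x hy hx hl) hos hJ.dual (fun x hx y hy J' hc hn hs => ?_) hp hne
  exact hR y hy x hx _ hc.dual hn fun z hz => ⟨(hs hz).2, (hs hz).1⟩

/-- A convex set all of whose bounded pieces are under control is itself under control: split it
into a point, what lies below and what lies above. -/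
theorem IsEval.convex [Countable P] (h : IsEval A ev)
    (hmul : ∀ x y, K x → K y → A.mul x y < A.n → K (A.mul x y))
    (hom : ∀ x, K x → A.om x < A.n → K (A.om x)) (hos : ∀ x, K x → A.os x < A.n → K (A.os x))
    {J : Set P} (hJ : J.OrdConnected)
    (hR : ∀ x ∈ J, ∀ y ∈ J, ∀ J' : Set P, J'.OrdConnected → J'.Nonempty → J' ⊆ Set.Icc x y →
      K (ev J')) (hne : J.Nonempty) : K (ev J) := by
  obtain ⟨p, hp⟩ := hne
  refine h.split hmul (J₁ := J ∩ Set.Iio p) (J₂ := J ∩ Set.Ici p) ?_ ?_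
    (h.below hmul hos hJ hR hp) (fun _ => ?_) ⟨p, hp⟩
  · rw [← Set.inter_union_distrib_left, Set.Iio_union_Ici, Set.inter_univ]
  · exact fun x hx y hy => lt_of_lt_of_le hx.2 hy.2
  refine h.split hmul (J₁ := {p}) (J₂ := J ∩ Set.Ioi p) ?_ ?_ (fun _ => ?_)
    (h.above hmul hom hJ hR hp) ⟨p, hp, le_rfl⟩
  · ext x
    simp only [Set.mem_inter_iff, Set.mem_Ici, Set.mem_union, Set.mem_singleton_iff, Set.mem_Ioi]
    constructor
    · rintro ⟨hx, hpx⟩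
      rcases hpx.eq_or_lt with rfl | hlt
      · exact Or.inl rfl
      · exact Or.inr ⟨hx, hlt⟩
    · rintro (rfl | ⟨hx, hlt⟩)
      · exact ⟨hp, le_rfl⟩
      · exact ⟨hx, hlt.le⟩
  · rintro x rfl y hy; exact hy.2
  · exact hR p hp p hp _ Set.ordConnected_singleton (Set.singleton_nonempty p) (by simp)

/-- The condensation step: if the classes of a convex equivalence relation all have values in `K`,
there are two distinct classes all of whose intermediate intervals have values in `K`. -/
theorem IsEval.condense [Countable P] (h : IsEval A ev)
    (hmul : ∀ x y, K x → K y → A.mul x y < A.n → K (A.mul x y))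
    (hsh : ∀ m, m ≠ 0 → m < 2 ^ A.n → (∀ i, m.testBit i = true → K i) → A.sh m < A.n →
      K (A.sh m)) (r : P → P) (hr : ∀ x, r (r x) = r x)
    (hmono : ∀ x y, r x < r y → x < y)
    (hcls : ∀ J : Set P, J.OrdConnected → J.Nonempty → (∀ x ∈ J, ∀ y ∈ J, r x = r y) → K (ev J))
    (hne : ∃ x y, r x < r y) :
    ∃ x y, r x < r y ∧ ∀ J : Set P, J.OrdConnected → J.Nonempty → J ⊆ Set.Icc x y → K (ev J) := by
  have hle : ∀ x y, x ≤ y → r x ≤ r y := fun x y hxy =>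
    not_lt.1 fun hlt => absurd (hmono _ _ hlt) (not_lt.2 hxy)
  let cls : P → Set P := fun k => {x | r x = r k}
  have hclsK : ∀ k, K (ev (cls k)) := fun k =>
    hcls _ ⟨fun x hx y hy z hz => le_antisymm ((hle _ _ hz.2).trans_eq hy)
      ((hx.symm.le : r k ≤ r x).trans (hle _ _ hz.1))⟩ ⟨k, rfl⟩ fun x hx y hy => hx.trans hy.symm
  by_contra hcon
  push Not at hcon
  have hcon' : ∀ x y, r x < r y → ¬ ∀ J : Set P, J.OrdConnected → J.Nonempty →
      J ⊆ Set.Icc x y → K (ev J) := by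
    intro x y hxy hall
    obtain ⟨J, h1, h2, h3, h4⟩ := hcon x y hxy
    exact h4 (hall J h1 h2 h3)
  -- Two classes with no class in between would satisfy the conclusion, as an interval from one to
  -- the other meets only these two and splits into its traces on them. So the classes are densely
  -- ordered.
  have dense : ∀ x y, r x < r y → ∃ z, r x < r z ∧ r z < r y := by
    intro x y hxy
    by_contra hno
    push Not at hno
    refine hcon' x y hxy fun J hc hn hs => ?_
    have key : ∀ z ∈ J, r z = r x ∨ r z = r y := by
      intro z hz
      have h1 := hle _ _ (hs hz).1
      have h2 := hle _ _ (hs hz).2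
      rcases h1.eq_or_lt with h1 | h1
      · exact Or.inl h1.symm
      · exact Or.inr (le_antisymm h2 (hno z h1))
    refine h.split hmul (J₁ := J ∩ {z | r z = r x}) (J₂ := J ∩ {z | r z = r y}) ?_ ?_ ?_ ?_ hn
    · ext z
      simp only [Set.mem_inter_iff, Set.mem_union, Set.mem_ofPred_eq]
      constructor
      · intro hz; rcases key z hz with h | h
        · exact Or.inl ⟨hz, h⟩
        · exact Or.inr ⟨hz, h⟩
      · rintro (h | h) <;> exact h.1
    · rintro a ⟨-, ha⟩ b ⟨-, hb⟩
      exact hmono _ _ (by rw [show r a = r x from ha, show r b = r y from hb]; exact hxy)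
    · intro hn
      refine hcls _ (hc.inter ⟨fun a ha b hb c hc => ?_⟩) hn fun a ha b hb => ha.2.trans hb.2.symm
      exact le_antisymm ((hle _ _ hc.2).trans_eq hb) ((ha.symm.le : r x ≤ r a).trans (hle _ _ hc.1))
    · intro hn
      refine hcls _ (hc.inter ⟨fun a ha b hb c hc => ?_⟩) hn fun a ha b hb => ha.2.trans hb.2.symm
      exact le_antisymm ((hle _ _ hc.2).trans_eq hb) ((ha.symm.le : r y ≤ r a).trans (hle _ _ hc.1))
  -- The values of the classes strictly between two given ones. There are finitely many values, so
  -- some pair `(k, l)` has the fewest; by minimality every smaller interval of classes shows the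
  -- same values, which therefore all occur densely.
  let F : P × P → Set ℕ := fun p => {c | ∃ m, r p.1 < r m ∧ r m < r p.2 ∧ ev (cls m) = c}
  have hF : ∀ p, (F p).Finite := fun p =>
    (Set.finite_Iio A.n).subset (by rintro _ ⟨m, -, -, rfl⟩; exact h.lt _)
  obtain ⟨x₀, y₀, hxy₀⟩ := hne
  obtain ⟨⟨k, l⟩, hkl, hmin⟩ := WellFounded.has_min
    (InvImage.wf (fun p => (F p).ncard) (Nat.lt_wfRel.wf)) {p : P × P | r p.1 < r p.2}
    ⟨(x₀, y₀), hxy₀⟩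
  have hkl : r k < r l := hkl
  have hFeq : ∀ a b, r k ≤ r a → r a < r b → r b ≤ r l → F (a, b) = F (k, l) := by
    intro a b h1 h2 h3
    refine Set.eq_of_subset_of_ncard_le ?_ (not_lt.1 (hmin (a, b) h2)) (hF _)
    rintro _ ⟨m, hm1, hm2, rfl⟩
    exact ⟨m, h1.trans_lt hm1, hm2.trans_le h3, rfl⟩
  refine hcon' k l hkl fun J hc hn hs => ?_
  have hJk : ∀ z ∈ J, r k ≤ r z := fun z hz => hle _ _ (hs hz).1
  have hJl : ∀ z ∈ J, r z ≤ r l := fun z hz => hle _ _ (hs hz).2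
  have hconv : ∀ x ∈ J, ∀ y ∈ J, ∀ z, r x < r z → r z < r y → z ∈ J := fun x hx y hy z h1 h2 =>
    hc.out hx hy ⟨(hmono _ _ h1).le, (hmono _ _ h2).le⟩
  -- `J₁` and `J₃` are the traces of `J` on its first and last class, if these exist; such traces
  -- may be incomplete classes. The classes in `J₂` lie wholly inside `J` and form a shuffle.
  let J₁ : Set P := {x ∈ J | ∀ y ∈ J, r x ≤ r y}
  let J₀ : Set P := {x ∈ J | ∃ y ∈ J, r y < r x}
  let J₃ : Set P := {x ∈ J₀ | ∀ y ∈ J, r y ≤ r x}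
  let J₂ : Set P := {x ∈ J₀ | ∃ y ∈ J, r x < r y}
  have hflat : ∀ S : Set P, (∀ x ∈ S, ∀ y ∈ S, r x = r y) → S ⊆ J →
      (∀ x ∈ J, ∀ y ∈ S, r x = r y → x ∈ S) → S.Nonempty → K (ev S) := by
    intro S h1 h2 h3 h4
    refine hcls S ⟨fun a ha b hb c hc' => ?_⟩ h4 h1
    refine h3 c (hc.out (h2 ha) (h2 hb) hc') a ha (le_antisymm ?_ (hle _ _ hc'.1))
    rw [h1 a ha b hb]; exact hle _ _ hc'.2
  refine h.split hmul (J₁ := J₁) (J₂ := J₀) ?_ ?_ (hflat J₁ ?_ (fun x hx => hx.1) ?_) ?_ hn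
  · ext x
    simp only [Set.mem_union, J₁, J₀, Set.mem_ofPred_eq]
    constructor
    · intro hx
      by_cases hh : ∀ y ∈ J, r x ≤ r y
      · exact Or.inl ⟨hx, hh⟩
      · push Not at hh; exact Or.inr ⟨hx, hh⟩
    · rintro (h | h) <;> exact h.1
  · rintro a ⟨ha, ha'⟩ b ⟨hb, y, hy, hb'⟩
    exact hmono _ _ ((ha' y hy).trans_lt hb')
  · intro x hx y hy; exact le_antisymm (hx.2 y hy.1) (hy.2 x hx.1)
  · rintro x hx y hy hxy; exact ⟨hx, fun z hz => hxy.trans_le (hy.2 z hz)⟩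
  refine h.split hmul (J₁ := J₂) (J₂ := J₃) ?_ ?_ ?_
    (hflat J₃ ?_ (fun x hx => hx.1.1) ?_)
  · ext x
    simp only [Set.mem_union, J₂, J₃, Set.mem_ofPred_eq]
    constructor
    · intro hx
      by_cases hh : ∀ y ∈ J, r y ≤ r x
      · exact Or.inr ⟨hx, hh⟩
      · push Not at hh; exact Or.inl ⟨hx, hh⟩
    · rintro (h | h) <;> exact h.1
  · rintro a ⟨ha, y, hy, ha'⟩ b ⟨hb, hb'⟩
    exact hmono _ _ (ha'.trans_le (hb' y hy))
  · intro hn₂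
    let I : Type := {m : P // r m = m ∧ m ∈ J₂}
    have hsub : ∀ m z, m ∈ J₂ → r z = r m → z ∈ J₂ := by
      rintro m z ⟨⟨hm, y, hy, hym⟩, w, hw, hmw⟩ hz
      rw [← hz] at hym hmw
      exact ⟨⟨hconv y hy w hw z hym hmw, y, hy, hym⟩, w, hw, hmw⟩
    have hin : ∀ x ∈ J, ∀ y ∈ J, ∀ z, r x < r z → r z < r y → r z ∈ J₂ := by
      intro x hx y hy z h1 h2
      refine hsub z _ ⟨⟨hconv x hx y hy z h1 h2, x, hx, h1⟩, y, hy, h2⟩ (hr z)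
    have : DenselyOrdered I := by
      refine ⟨?_⟩
      rintro ⟨a, ha, haJ⟩ ⟨b, hb, hbJ⟩ (hab : a < b)
      have hab' : r a < r b := by rw [ha, hb]; exact hab
      obtain ⟨z, h1, h2⟩ := dense a b hab'
      refine ⟨⟨r z, hr z, hin a haJ.1.1 b hbJ.1.1 z h1 h2⟩, ?_, ?_⟩
      · change a < r z; rwa [ha] at h1
      · change r z < b; rwa [hb] at h2
    have : NoMinOrder I := by
      refine ⟨?_⟩
      rintro ⟨a, ha, haJ⟩
      obtain ⟨y, hy, hya⟩ := haJ.1.2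
      obtain ⟨z, h1, h2⟩ := dense y a hya
      refine ⟨⟨r z, hr z, hin y hy a haJ.1.1 z h1 h2⟩, ?_⟩
      change r z < a; rwa [ha] at h2
    have : NoMaxOrder I := by
      refine ⟨?_⟩
      rintro ⟨a, ha, haJ⟩
      obtain ⟨y, hy, hya⟩ := haJ.2
      obtain ⟨z, h1, h2⟩ := dense a y hya
      refine ⟨⟨r z, hr z, hin a haJ.1.1 y hy z h1 h2⟩, ?_⟩
      change a < r z; rwa [ha] at h1
    have : Nonempty I := by
      obtain ⟨x, hx⟩ := hn₂
      exact ⟨⟨r x, hr x, hsub x _ hx (hr x)⟩⟩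
    have : Countable I := by change Countable {m : P // r m = m ∧ m ∈ J₂}; infer_instance
    have hu : J₂ = ⋃ i : I, cls i.1 := by
      ext x
      simp only [Set.mem_iUnion]
      constructor
      · intro hx; exact ⟨⟨r x, hr x, hsub x _ hx (hr x)⟩, (hr x).symm⟩
      · rintro ⟨i, hi⟩; exact hsub _ _ i.2.2 hi
    have hval := h.sh I (fun i => cls i.1) (fun i => ⟨i.1, rfl⟩) ?_ ?_
    · have hl := h.lt (⋃ i : I, cls i.1)
      rw [hu]
      rw [hval] at hl ⊢
      refine hsh _ ?_ (mask_lt _ _) ?_ hl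
      · obtain ⟨i⟩ := ‹Nonempty I›
        exact mask_ne_zero ⟨_, h.lt _, i, rfl⟩
      · intro c hc
        obtain ⟨-, i, rfl⟩ := testBit_mask.1 hc
        exact hclsK _
    · rintro ⟨a, ha, -⟩ ⟨b, hb, -⟩ (hab : a < b)
      intro x hx y hy
      refine hmono _ _ ?_
      rw [show r x = r a from hx, show r y = r b from hy, ha, hb]
      exact hab
    · rintro ⟨a, ha, haJ⟩ ⟨b, hb, hbJ⟩ ⟨c, hc', hcJ⟩ (hab : a < b)
      have hab' : r a < r b := by rw [ha, hb]; exact hab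
      have hFab := hFeq a b (hJk _ haJ.1.1) hab' (hJl _ hbJ.1.1)
      have hmem : ev (cls c) ∈ F (k, l) := by
        obtain ⟨y, hy, hyc⟩ := hcJ.1.2
        obtain ⟨w, hw, hcw⟩ := hcJ.2
        exact ⟨c, (hJk y hy).trans_lt hyc, hcw.trans_le (hJl w hw), rfl⟩
      rw [← hFab] at hmem
      obtain ⟨z, h1, h2, h3⟩ := hmem
      refine ⟨⟨r z, hr z, hin a haJ.1.1 b hbJ.1.1 z h1 h2⟩, ?_, ?_, ?_⟩
      · change a < r z; rw [← ha]; exact h1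
      · change r z < b; rw [← hb]; exact h2
      · change ev (cls (r z)) = ev (cls c)
        rw [← h3]; simp only [cls, hr]
  · intro x hx y hy; exact le_antisymm (hy.2 x hx.1.1) (hx.2 y hy.1.1)
  · rintro x hx y ⟨⟨hy, w, hw, hyw⟩, hy'⟩ hxy
    exact ⟨⟨hx, w, hw, hxy.symm ▸ hyw⟩, fun z hz => (hy' z hz).trans_eq hxy.symm⟩

/-- The value of a nonempty countable word lies in the subalgebra generated by the values of its
letters. -/
theorem IsEval.cl_univ [Countable P] [Nonempty P] (h : IsEval A ev) {G : ℕ → Prop}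
    (hG : ∀ p, G (ev {p})) : Cl A G (ev Set.univ) := by
  -- The condensation: two points are equivalent when every interval between them has a generated
  -- value. The claim is that there is only one class.
  let R : P → P → Prop := fun x y => ∀ J : Set P, J.OrdConnected → J.Nonempty →
    J ⊆ Set.uIcc x y → Cl A G (ev J)
  have hmul : ∀ x y, Cl A G x → Cl A G y → A.mul x y < A.n → Cl A G (A.mul x y) := Cl.mul
  have refl : ∀ x, R x x := by
    intro x J hc hn hs
    rw [Set.uIcc_self] at hs
    rw [hn.subset_singleton_iff.1 hs]
    exact Cl.gen _ (h.lt _) (hG x)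
  have symm : ∀ x y, R x y → R y x := by
    intro x y hR J hc hn hs
    exact hR J hc hn (by rwa [Set.uIcc_comm])
  have sub : ∀ x y z w, R x y → z ∈ Set.uIcc x y → w ∈ Set.uIcc x y → R z w := by
    intro x y z w hR hz hw J hc hn hs
    exact hR J hc hn (hs.trans (Set.uIcc_subset_uIcc hz hw))
  have trans : ∀ x y z, R x y → R y z → R x z := by
    intro x y z hxy hyz J hc hn hs
    have hs' : J ⊆ Set.uIcc x y ∪ Set.uIcc y z := hs.trans Set.uIcc_subset_uIcc_union_uIcc
    rcases le_total x z with hxz | hxz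
    · refine h.split hmul (J₁ := J ∩ Set.Iic y) (J₂ := J ∩ Set.Ioi y) ?_ ?_ ?_ ?_ hn
      · rw [← Set.inter_union_distrib_left, Set.Iic_union_Ioi, Set.inter_univ]
      · exact fun a ha b hb => lt_of_le_of_lt ha.2 hb.2
      · refine fun hn => hxy _ (hc.inter Set.ordConnected_Iic) hn fun a ha => ?_
        have h1 := hs ha.1
        rw [Set.uIcc_of_le hxz] at h1
        exact Set.mem_uIcc.2 (Or.inl ⟨h1.1, ha.2⟩)
      · refine fun hn => hyz _ (hc.inter Set.ordConnected_Ioi) hn fun a ha => ?_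
        have h1 := hs ha.1
        rw [Set.uIcc_of_le hxz] at h1
        exact Set.mem_uIcc.2 (Or.inl ⟨le_of_lt ha.2, h1.2⟩)
    · refine h.split hmul (J₁ := J ∩ Set.Iic y) (J₂ := J ∩ Set.Ioi y) ?_ ?_ ?_ ?_ hn
      · rw [← Set.inter_union_distrib_left, Set.Iic_union_Ioi, Set.inter_univ]
      · exact fun a ha b hb => lt_of_le_of_lt ha.2 hb.2
      · refine fun hn => hyz _ (hc.inter Set.ordConnected_Iic) hn fun a ha => ?_
        have h1 := hs ha.1
        rw [Set.uIcc_of_ge hxz] at h1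
        exact Set.mem_uIcc.2 (Or.inr ⟨h1.1, ha.2⟩)
      · refine fun hn => hxy _ (hc.inter Set.ordConnected_Ioi) hn fun a ha => ?_
        have h1 := hs ha.1
        rw [Set.uIcc_of_ge hxz] at h1
        exact Set.mem_uIcc.2 (Or.inr ⟨le_of_lt ha.2, h1.2⟩)
  have conv : ∀ J : Set P, J.OrdConnected → J.Nonempty → (∀ x ∈ J, ∀ y ∈ J, R x y) →
      Cl A G (ev J) := fun J hc hn hR =>
    h.convex hmul Cl.om Cl.os hc
      (fun x hx y hy J' hc' hn' hs' => hR x hx y hy J' hc' hn' (hs'.trans Set.Icc_subset_uIcc)) hn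
  let S : Setoid P := ⟨R, refl, fun {x y} => symm x y, fun {x y z} => trans x y z⟩
  -- Canonical representatives; comparing them compares the classes.
  let r : P → P := fun x => (Quotient.mk S x).out
  have hrR : ∀ x, R (r x) x := fun x => Quotient.mk_out (s := S) x
  have hreq : ∀ x y, R x y → r x = r y := fun x y hR => by
    change (Quotient.mk S x).out = (Quotient.mk S y).out
    rw [Quotient.sound (s := S) hR]
  have hReq : ∀ x y, r x = r y → R x y := fun x y hxy =>
    trans _ _ _ (symm _ _ (hrR x)) (hxy ▸ hrR y)
  have hrr : ∀ x, r (r x) = r x := fun x => hreq _ _ (hrR x)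
  by_cases hall : ∀ x y, R x y
  · exact conv _ Set.ordConnected_univ Set.univ_nonempty fun x _ y _ => hall x y
  exfalso
  push Not at hall
  obtain ⟨x₀, y₀, hxy₀⟩ := hall
  have hmono : ∀ x y, r x < r y → x < y := by
    intro x y hlt
    by_contra hyx
    have hyx := not_lt.1 hyx
    have hne : ¬ R x y := fun hR => hlt.ne (hreq x y hR)
    rcases le_total y (r x) with h1 | h1
    · have h2 : R (r x) y :=
        sub _ _ _ _ (hrR y) (Set.mem_uIcc.2 (Or.inr ⟨h1, hlt.le⟩)) Set.right_mem_uIcc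
      exact hne (trans _ _ _ (symm _ _ (hrR x)) h2)
    · exact hne (sub _ _ _ _ (hrR x) Set.right_mem_uIcc (Set.mem_uIcc.2 (Or.inl ⟨h1, hyx⟩)))
  have hcls : ∀ J : Set P, J.OrdConnected → J.Nonempty → (∀ x ∈ J, ∀ y ∈ J, r x = r y) →
      Cl A G (ev J) := fun J hc hn hJ => conv J hc hn fun x hx y hy => hReq _ _ (hJ x hx y hy)
  have hne : ∃ x y, r x < r y := by
    rcases lt_trichotomy (r x₀) (r y₀) with h1 | h1 | h1
    · exact ⟨_, _, h1⟩
    · exact (hxy₀ (hReq _ _ h1)).elim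
    · exact ⟨_, _, h1⟩
  -- The points supplied by condensation lie in different classes, yet all intervals between them
  -- have generated values, which makes them equivalent.
  obtain ⟨x, y, hxy, hJ⟩ := h.condense hmul Cl.sh r hrr hmono hcls hne
  refine hxy.ne (hreq x y fun J hc hn hs => hJ J hc hn ?_)
  rwa [Set.uIcc_of_le (hmono x y hxy).le] at hs

end Decomposition

/-! ### Shuffles -/

/-- Every colour that occurs occurs densely. -/
def Shuffled {I : Type} [LinearOrder I] (c : I → ℕ) : Prop :=
  ∀ i j k, i < j → ∃ l, i < l ∧ l < j ∧ c l = c k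

namespace Shuffled

/-- Finite partial isomorphisms that preserve colours. -/
def ColourIso {α β : Type} [LinearOrder α] [LinearOrder β] (c : α → ℕ) (d : β → ℕ) : Type :=
  { f : Order.PartialIso α β // ∀ p ∈ f.val, c p.1 = d p.2 }

instance {α β : Type} [LinearOrder α] [LinearOrder β] (c : α → ℕ) (d : β → ℕ) :
    Preorder (ColourIso c d) :=
  inferInstanceAs (Preorder { f : Order.PartialIso α β // ∀ p ∈ f.val, c p.1 = d p.2 })

instance {α β : Type} [LinearOrder α] [LinearOrder β] (c : α → ℕ) (d : β → ℕ) :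
    Inhabited (ColourIso c d) :=
  ⟨⟨default, fun _ h => (Finset.notMem_empty _ h).elim⟩⟩

section

variable {α β : Type} [LinearOrder α] [LinearOrder β] {c : α → ℕ} {d : β → ℕ}

/-- Density yields an open interval separating the two finite sets, and the colour of `k` occurs
inside it. -/
theorem exists_between_finsets [DenselyOrdered β] [NoMinOrder β] [NoMaxOrder β] [Nonempty β]
    (hd : Shuffled d) (k : β) (lo hi : Finset β) (h : ∀ x ∈ lo, ∀ y ∈ hi, x < y) :
    ∃ m : β, (∀ x ∈ lo, x < m) ∧ (∀ y ∈ hi, m < y) ∧ d m = d k := by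
  obtain ⟨a, ha, ha'⟩ := Order.exists_between_finsets lo hi h
  obtain ⟨b, hb, hb'⟩ := Order.exists_between_finsets (insert a lo) hi (by
    intro x hx y hy
    rcases Finset.mem_insert.1 hx with rfl | hx
    · exact ha' y hy
    · exact h x hx y hy)
  obtain ⟨m, h1, h2, h3⟩ := hd a b k (hb a (Finset.mem_insert_self _ _))
  exact ⟨m, fun x hx => (ha x hx).trans h1, fun y hy => h2.trans (hb' y hy), h3⟩

/-- The extension step of the back-and-forth argument: a point already matched keeps its partner, a
new one receives a point of the right colour in the corresponding gap. -/
theorem exists_across [DenselyOrdered β] [NoMinOrder β] [NoMaxOrder β] [Nonempty β]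
    (hd : Shuffled d) (hcd : ∀ a, ∃ b, d b = c a) (f : ColourIso c d) (a : α) :
    ∃ b : β, (∀ p ∈ f.val.val, cmp (Prod.fst p) a = cmp (Prod.snd p) b) ∧ c a = d b := by
  by_cases h : ∃ b, (a, b) ∈ f.val.val
  · obtain ⟨b, hb⟩ := h
    exact ⟨b, fun p hp => f.val.prop _ hp _ hb, f.prop _ hb⟩
  have : ∀ x ∈ {p ∈ f.val.val | p.fst < a}.image Prod.snd,
      ∀ y ∈ {p ∈ f.val.val | a < p.fst}.image Prod.snd, x < y := by
    intro x hx y hy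
    rw [Finset.mem_image] at hx hy
    rcases hx with ⟨p, hp1, rfl⟩
    rcases hy with ⟨q, hq1, rfl⟩
    rw [Finset.mem_filter] at hp1 hq1
    rw [← lt_iff_lt_of_cmp_eq_cmp (f.val.prop _ hp1.1 _ hq1.1)]
    exact lt_trans hp1.right hq1.right
  obtain ⟨k, hk⟩ := hcd a
  obtain ⟨b, hb, hb', hbd⟩ := hd.exists_between_finsets k _ _ this
  refine ⟨b, ?_, by rw [hbd, hk]⟩
  rintro ⟨p1, p2⟩ hp
  have : p1 ≠ a := fun he => h ⟨p2, he ▸ hp⟩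
  rcases lt_or_gt_of_ne this with hl | hr
  · have : p1 < a ∧ p2 < b :=
      ⟨hl, hb _ (Finset.mem_image.mpr ⟨(p1, p2), Finset.mem_filter.mpr ⟨hp, hl⟩, rfl⟩)⟩
    rw [← cmp_eq_lt_iff, ← cmp_eq_lt_iff] at this
    exact this.1.trans this.2.symm
  · have : a < p1 ∧ b < p2 :=
      ⟨hr, hb' _ (Finset.mem_image.mpr ⟨(p1, p2), Finset.mem_filter.mpr ⟨hp, hr⟩, rfl⟩)⟩
    rw [← cmp_eq_gt_iff, ← cmp_eq_gt_iff] at this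
    exact this.1.trans this.2.symm

/-- Reversal of a partial isomorphism. -/
def ColourIso.comm (f : ColourIso c d) : ColourIso d c :=
  ⟨f.val.comm, by
    intro p hp
    obtain ⟨q, hq, rfl⟩ := Finset.mem_image.1 hp
    exact (f.prop q hq).symm⟩

theorem ColourIso.mem_comm (f : ColourIso c d) (a : α) (b : β) :
    (b, a) ∈ f.comm.val.val ↔ (a, b) ∈ f.val.val := by
  change (b, a) ∈ f.val.val.image _ ↔ _
  rw [Finset.mem_image]
  constructor
  · rintro ⟨⟨a', b'⟩, h, he⟩
    cases he
    exact h
  · intro h; exact ⟨(a, b), h, rfl⟩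

/-- Colour preserving partial isomorphisms defined at a point of the domain. -/
def definedAtLeft [DenselyOrdered β] [NoMinOrder β] [NoMaxOrder β] [Nonempty β]
    (hd : Shuffled d) (hcd : ∀ a, ∃ b, d b = c a) (a : α) : Order.Cofinal (ColourIso c d) where
  carrier := {f | ∃ b : β, (a, b) ∈ f.val.val}
  isCofinal f := by
    obtain ⟨b, a_b, hab⟩ := exists_across hd hcd f a
    refine ⟨⟨⟨insert (a, b) f.val.val, fun p hp q hq => ?_⟩, fun p hp => ?_⟩,
      ⟨b, Finset.mem_insert_self _ _⟩, Finset.subset_insert _ _⟩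
    · rw [Finset.mem_insert] at hp hq
      rcases hp with (rfl | pf) <;> rcases hq with (rfl | qf)
      · simp only [cmp_self_eq_eq]
      · rw [cmp_eq_cmp_symm]
        exact a_b _ qf
      · exact a_b _ pf
      · exact f.val.prop _ pf _ qf
    · rcases Finset.mem_insert.1 hp with rfl | hp
      · exact hab
      · exact f.prop p hp

/-- Colour preserving partial isomorphisms defined at a point of the codomain. -/
def definedAtRight [DenselyOrdered α] [NoMinOrder α] [NoMaxOrder α] [Nonempty α]
    (hc : Shuffled c) (hdc : ∀ b, ∃ a, c a = d b) (b : β) : Order.Cofinal (ColourIso c d) where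
  carrier := {f | ∃ a : α, (a, b) ∈ f.val.val}
  isCofinal f := by
    obtain ⟨f', ⟨a, ha⟩, hl⟩ := (definedAtLeft hc hdc b).isCofinal f.comm
    refine ⟨f'.comm, ⟨a, (f'.mem_comm b a).2 ha⟩, ?_⟩
    rintro ⟨x, y⟩ hxy
    exact (f'.mem_comm y x).2 (hl ((f.mem_comm x y).2 hxy))

/-- Skolem's theorem: the shuffle of a set of colours is unique up to isomorphism. -/
theorem exists_iso [Countable α] [DenselyOrdered α] [NoMinOrder α] [NoMaxOrder α]
    [Nonempty α] [Countable β] [DenselyOrdered β] [NoMinOrder β] [NoMaxOrder β] [Nonempty β]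
    (hc : Shuffled c) (hd : Shuffled d) (hcd : ∀ a, ∃ b, d b = c a) (hdc : ∀ b, ∃ a, c a = d b) :
    ∃ e : α ≃o β, ∀ a, d (e a) = c a := by
  cases nonempty_encodable α
  cases nonempty_encodable β
  let D : α ⊕ β → Order.Cofinal (ColourIso c d) := fun p =>
    Sum.recOn p (definedAtLeft hd hcd) (definedAtRight hc hdc)
  let I : Order.Ideal (ColourIso c d) := Order.idealOfCofinals default D
  have hF : ∀ a, ∃ b, ∃ f ∈ I, (a, b) ∈ f.val.val := fun a => by
    obtain ⟨f, ⟨b, hb⟩, hf⟩ := Order.cofinal_meets_idealOfCofinals default D (Sum.inl a)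
    exact ⟨b, f, hf, hb⟩
  have hG : ∀ b, ∃ a, ∃ f ∈ I, (a, b) ∈ f.val.val := fun b => by
    obtain ⟨f, ⟨a, ha⟩, hf⟩ := Order.cofinal_meets_idealOfCofinals default D (Sum.inr b)
    exact ⟨a, f, hf, ha⟩
  choose F hF using hF
  choose G hG using hG
  refine ⟨OrderIso.ofCmpEqCmp F G fun a b => ?_, fun a => ?_⟩
  · obtain ⟨f, hf, ha⟩ := hF a
    obtain ⟨g, hg, hb⟩ := hG b
    obtain ⟨m, _, fm, gm⟩ := I.directed _ hf _ hg
    exact m.val.prop (a, _) (fm ha) (_, b) (gm hb)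
  · obtain ⟨f, hf, ha⟩ := hF a
    exact (f.prop _ ha).symm

end

/-- Once `2 ^ N * (b - a)` exceeds 2, an odd integer `j` lies strictly between `2 ^ N * a` and `2 ^
N * b`, and `j / 2 ^ N` is in lowest terms. -/
theorem exists_dyadic {a b : ℚ} (hab : a < b) :
    ∃ N₀ : ℕ, ∀ N ≥ N₀, ∃ q : ℚ, a < q ∧ q < b ∧ padicValNat 2 q.den = N := by
  obtain ⟨N₀, hN₀⟩ := pow_unbounded_of_one_lt (2 / (b - a)) (one_lt_two (α := ℚ))
  refine ⟨N₀ + 1, fun N hN => ?_⟩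
  have hba : 0 < b - a := sub_pos.2 hab
  have h2N : 2 < 2 ^ N * (b - a) := by
    rw [div_lt_iff₀ hba] at hN₀
    exact hN₀.trans_le (mul_le_mul_of_nonneg_right
      (pow_le_pow_right₀ (by norm_num) (by omega)) hba.le)
  have hpos : (0 : ℚ) < 2 ^ N := by positivity
  obtain ⟨j, hj, h1, h2⟩ : ∃ j : ℤ, Odd j ∧ 2 ^ N * a < j ∧ (j : ℚ) < 2 ^ N * b := by
    have hf1 := Int.floor_le (2 ^ N * a)
    have hf2 := Int.lt_floor_add_one (2 ^ N * a)
    rcases Int.even_or_odd ⌊2 ^ N * a⌋ with he | ho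
    · refine ⟨⌊2 ^ N * a⌋ + 1, he.add_one, ?_, ?_⟩ <;> push_cast <;> linarith
    · refine ⟨⌊2 ^ N * a⌋ + 2, ho.add_even even_two, ?_, ?_⟩ <;> push_cast <;> linarith
  refine ⟨(j : ℚ) / ((2 ^ N : ℕ) : ℤ), ?_, ?_, ?_⟩
  · push_cast; rw [lt_div_iff₀ hpos]; linarith
  · push_cast; rw [div_lt_iff₀ hpos]; linarith
  · have hden := Rat.den_div_eq_of_coprime (a := j) (b := ((2 ^ N : ℕ) : ℤ)) (by positivity) (by
      rw [Int.natAbs_natCast]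
      exact Nat.Coprime.pow_right _ (Nat.Coprime.symm
        (Nat.coprime_two_left.2 (Int.natAbs_odd.2 hj))))
    have : ((j : ℚ) / ((2 ^ N : ℕ) : ℤ)).den = 2 ^ N := by exact_mod_cast hden
    rw [this, padicValNat.prime_pow]

/-- The shuffle of a nonempty finite set of colours exists on the rational numbers. -/
theorem exists_rat {m : ℕ} (hm : m ≠ 0) :
    ∃ c : ℚ → ℕ, Shuffled c ∧ ∀ i, m.testBit i = true ↔ ∃ q, c q = i := by
  obtain ⟨i₀, hi₀⟩ := Nat.exists_testBit_of_ne_zero hm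
  -- The exponent of 2 in the denominator codes a pair. Its first component proposes the colour,
  -- with `i₀` replacing proposals outside `m`; the second is free and makes the exponent as large
  -- as `exists_dyadic` requires.
  let c : ℚ → ℕ := fun q =>
    if m.testBit (padicValNat 2 q.den).unpair.1 then (padicValNat 2 q.den).unpair.1 else i₀
  have hc : ∀ q, m.testBit (c q) = true := by
    intro q
    by_cases h : m.testBit (padicValNat 2 q.den).unpair.1
    · simp only [c, if_pos h, h]
    · simp only [c, if_neg h]; exact hi₀
  have hd : ∀ i, m.testBit i = true → ∀ a b : ℚ, a < b → ∃ q, a < q ∧ q < b ∧ c q = i := by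
    intro i hi a b hab
    obtain ⟨N₀, hN₀⟩ := exists_dyadic hab
    obtain ⟨q, h1, h2, h3⟩ := hN₀ (Nat.pair i N₀) (Nat.right_le_pair i N₀)
    refine ⟨q, h1, h2, ?_⟩
    simp only [c, h3, Nat.unpair_pair, hi, if_true]
  refine ⟨c, fun a b k hab => hd _ (hc k) a b hab, fun i => ⟨fun hi => ?_, ?_⟩⟩
  · obtain ⟨q, -, -, h⟩ := hd i hi 0 1 one_pos
    exact ⟨q, h⟩
  · rintro ⟨q, rfl⟩; exact hc q

end Shuffled

/-! ### Words realizing elements of a subalgebra -/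

/-- Homomorphisms of algebras. -/
structure CircAlg.IsHom (A B : CircAlg) (π : ℕ → ℕ) : Prop where
  mul : ∀ x y, π (A.mul x y) = B.mul (π x) (π y)
  om : ∀ x, π (A.om x) = B.om (π x)
  os : ∀ x, π (A.os x) = B.os (π x)
  sh : ∀ m, m < 2 ^ A.n →
    π (A.sh m) = B.sh (mask B.n fun b => ∃ a, m.testBit a = true ∧ π a = b)

/-- Some nonempty countable word over `G` evaluates to `x`, also after letters are replaced by
words of the same value and after a homomorphism is applied. -/
def Realized (A : CircAlg) (G : ℕ → Prop) (x : ℕ) : Prop :=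
  ∃ (W : Type) (_ : LinearOrder W) (_ : Countable W) (_ : Nonempty W) (l : W → ℕ),
    (∀ w, G (l w)) ∧ ∀ (P : Type) [LinearOrder P] (B : CircAlg) (π : ℕ → ℕ) (ev : Set P → ℕ),
      A.IsHom B π → IsEval B ev → ∀ s : W → Set P, (∀ w, (s w).Nonempty) →
      (∀ v w, v < w → SetLT (s v) (s w)) → (∀ w, ev (s w) = π (l w)) → ev (⋃ w, s w) = π x

/-- Substitution: the words realizing the `x i` are concatenated along `I` as a lexicographic sum,
and `H` evaluates the outer word. -/
theorem Realized.sum {A : CircAlg} {G : ℕ → Prop} (I : Type) [LinearOrder I] [Countable I]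
    [Nonempty I] (x : I → ℕ) (hx : ∀ i, Realized A G (x i)) (y : ℕ)
    (H : ∀ (P : Type) [LinearOrder P] (B : CircAlg) (π : ℕ → ℕ) (ev : Set P → ℕ),
      A.IsHom B π → IsEval B ev → ∀ s : I → Set P, (∀ w, (s w).Nonempty) →
      (∀ v w, v < w → SetLT (s v) (s w)) → (∀ w, ev (s w) = π (x w)) → ev (⋃ w, s w) = π y) :
    Realized A G y := by
  choose W o hc hn l hl hW using hx
  have : Countable (Σₗ i, W i) := inferInstanceAs (Countable (Σ i, W i))
  have : Nonempty (Σₗ i, W i) := by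
    obtain ⟨i⟩ := ‹Nonempty I›
    obtain ⟨w⟩ := hn i
    exact ⟨toLex ⟨i, w⟩⟩
  refine ⟨Σₗ i, W i, inferInstance, inferInstance, inferInstance, fun w => l w.1 w.2,
    fun w => hl _ _, ?_⟩
  intro P _ B π ev hπ hev s hs hlt hval
  have hu : (⋃ w, s w) = ⋃ i, ⋃ w : W i, s ⟨i, w⟩ := by
    ext p
    simp only [Set.mem_iUnion]
    constructor
    · rintro ⟨⟨i, w⟩, h⟩; exact ⟨i, w, h⟩
    · rintro ⟨i, w, h⟩; exact ⟨⟨i, w⟩, h⟩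
  rw [hu]
  refine H P B π ev hπ hev _ (fun i => ?_) ?_ fun i => ?_
  · obtain ⟨w⟩ := hn i
    obtain ⟨p, hp⟩ := hs ⟨i, w⟩
    exact ⟨p, Set.mem_iUnion.2 ⟨w, hp⟩⟩
  · intro i j hij p hp q hq
    obtain ⟨v, hv⟩ := Set.mem_iUnion.1 hp
    obtain ⟨w, hw⟩ := Set.mem_iUnion.1 hq
    exact hlt _ _ (Sigma.Lex.left v w hij) p hv q hw
  · refine hW i P B π ev hπ hev (fun w => s ⟨i, w⟩) (fun w => hs _) ?_ fun w => hval _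
    intro v w hvw
    exact hlt _ _ (Sigma.Lex.right v w hvw)

/-- Each operation has its own index order: `Bool`, `ℕ`, `ℕᵒᵈ`, and `ℚ` coloured by `exists_rat`. -/
theorem Cl.realized {A : CircAlg} {G : ℕ → Prop} {x : ℕ} (h : Cl A G x) : Realized A G x := by
  induction h with
  | gen x hx hG =>
    refine ⟨Unit, inferInstance, inferInstance, inferInstance, fun _ => x, fun _ => hG, ?_⟩
    intro P _ B π ev hπ hev s hs hlt hval
    rw [show (⋃ w, s w) = s () from iSup_unique (f := s)]
    exact hval ()
  | mul x y _ _ _ ihx ihy =>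
    refine Realized.sum Bool (fun b => if b then y else x) (by rintro (_ | _) <;> simpa) _ ?_
    intro P _ B π ev hπ hev s hs hlt hval
    have hu : (⋃ b, s b) = s false ∪ s true := by
      ext p; simp
    rw [hu, hev.mul _ _ (hs _) (hs _) (hlt _ _ (by decide)), hval, hval, hπ.mul]
    rfl
  | om x _ _ ih =>
    refine Realized.sum ℕ (fun _ => x) (fun _ => ih) _ ?_
    intro P _ B π ev hπ hev s hs hlt hval
    rw [hev.om _ s hs hlt hval, hπ.om]
  | os x _ _ ih =>
    have : Countable ℕᵒᵈ := inferInstanceAs (Countable ℕ)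
    refine Realized.sum ℕᵒᵈ (fun _ => x) (fun _ => ih) _ ?_
    intro P _ B π ev hπ hev s hs hlt hval
    have := hev.os _ (fun i => s (OrderDual.toDual i)) (fun i => hs _)
      (fun i j hij => hlt _ _ hij) (fun i => hval _)
    rw [hπ.os, ← this]
    rfl
  | sh m hm0 hm _ _ ih =>
    obtain ⟨c, hc, hcm⟩ := Shuffled.exists_rat hm0
    refine Realized.sum ℚ c (fun q => ih _ ((hcm _).2 ⟨q, rfl⟩)) _ ?_
    intro P _ B π ev hπ hev s hs hlt hval
    rw [hev.sh ℚ s hs hlt ?_, hπ.sh m hm]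
    · congr 1
      refine mask_congr fun b _ => ?_
      constructor
      · rintro ⟨q, rfl⟩; exact ⟨c q, (hcm _).2 ⟨q, rfl⟩, (hval q).symm⟩
      · rintro ⟨a, ha, rfl⟩
        obtain ⟨q, rfl⟩ := (hcm a).1 ha
        exact ⟨q, hval q⟩
    · intro i j k hij
      obtain ⟨l, h1, h2, h3⟩ := hc i j k hij
      exact ⟨l, h1, h2, by rw [hval, hval, h3]⟩

/-! ### Products of algebras -/

/-- The product of two algebras; pairs of elements are coded by `Nat.pair`. -/
noncomputable def prodAlg (A B : CircAlg) : CircAlg where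
  n := (A.n + B.n) ^ 2
  mul x y := Nat.pair (A.mul x.unpair.1 y.unpair.1) (B.mul x.unpair.2 y.unpair.2)
  om x := Nat.pair (A.om x.unpair.1) (B.om x.unpair.2)
  os x := Nat.pair (A.os x.unpair.1) (B.os x.unpair.2)
  sh m := Nat.pair (A.sh (mask A.n fun a => ∃ x, m.testBit x = true ∧ x.unpair.1 = a))
    (B.sh (mask B.n fun b => ∃ x, m.testBit x = true ∧ x.unpair.2 = b))

theorem prodAlg_isHom_fst (A B : CircAlg) : (prodAlg A B).IsHom A fun x => x.unpair.1 where
  mul x y := by simp [prodAlg]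
  om x := by simp [prodAlg]
  os x := by simp [prodAlg]
  sh m _ := by simp [prodAlg]

theorem prodAlg_isHom_snd (A B : CircAlg) : (prodAlg A B).IsHom B fun x => x.unpair.2 where
  mul x y := by simp [prodAlg]
  om x := by simp [prodAlg]
  os x := by simp [prodAlg]
  sh m _ := by simp [prodAlg]

theorem pair_lt_prod {a b m n : ℕ} (ha : a < m) (hb : b < n) : Nat.pair a b < (m + n) ^ 2 :=
  (Nat.pair_lt_max_add_one_sq a b).trans_le (Nat.pow_le_pow_left (by omega) 2)

theorem IsEval.prod {A B : CircAlg} {P : Type} [LinearOrder P] {ev₁ ev₂ : Set P → ℕ}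
    (h₁ : IsEval A ev₁) (h₂ : IsEval B ev₂) :
    IsEval (prodAlg A B) fun s => Nat.pair (ev₁ s) (ev₂ s) where
  lt s := pair_lt_prod (h₁.lt s) (h₂.lt s)
  mul s t hs ht hst := by
    rw [h₁.mul s t hs ht hst, h₂.mul s t hs ht hst]; simp [prodAlg]
  om a s hs hlt ha := by
    rw [h₁.om a.unpair.1 s hs hlt fun i => by simp [← ha i],
      h₂.om a.unpair.2 s hs hlt fun i => by simp [← ha i]]
    simp [prodAlg]
  os a s hs hlt ha := by
    rw [h₁.os a.unpair.1 s hs hlt fun i => by simp [← ha i],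
      h₂.os a.unpair.2 s hs hlt fun i => by simp [← ha i]]
    simp [prodAlg]
  sh I _ _ _ _ _ _ s hs hlt hd := by
    rw [h₁.sh I s hs hlt fun i j k hij => ?_, h₂.sh I s hs hlt fun i j k hij => ?_]
    · simp only [prodAlg]
      congr 2
      · refine mask_congr fun a _ => ?_
        constructor
        · rintro ⟨i, rfl⟩
          exact ⟨Nat.pair (ev₁ (s i)) (ev₂ (s i)),
            testBit_mask.2 ⟨pair_lt_prod (h₁.lt _) (h₂.lt _), i, rfl⟩, by simp⟩
        · rintro ⟨x, hx, rfl⟩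
          obtain ⟨-, i, rfl⟩ := testBit_mask.1 hx
          exact ⟨i, by simp⟩
      · refine mask_congr fun a _ => ?_
        constructor
        · rintro ⟨i, rfl⟩
          exact ⟨Nat.pair (ev₁ (s i)) (ev₂ (s i)),
            testBit_mask.2 ⟨pair_lt_prod (h₁.lt _) (h₂.lt _), i, rfl⟩, by simp⟩
        · rintro ⟨x, hx, rfl⟩
          obtain ⟨-, i, rfl⟩ := testBit_mask.1 hx
          exact ⟨i, by simp⟩
    · obtain ⟨l, h1, h2, h3⟩ := hd i j k hij
      exact ⟨l, h1, h2, (Nat.pair_eq_pair.1 h3).2⟩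
    · obtain ⟨l, h1, h2, h3⟩ := hd i j k hij
      exact ⟨l, h1, h2, (Nat.pair_eq_pair.1 h3).1⟩

/-- Evaluation of unions of members of an ordered family of sets. -/
theorem IsEval.family {A : CircAlg} {P : Type} [LinearOrder P] {ev : Set P → ℕ} (h : IsEval A ev)
    {I : Type} [LinearOrder I] (s : I → Set P) (hs : ∀ i, (s i).Nonempty)
    (hlt : ∀ i j, i < j → SetLT (s i) (s j)) :
    IsEval A fun J : Set I => ev (⋃ i ∈ J, s i) := by
  have ne : ∀ J : Set I, J.Nonempty → (⋃ i ∈ J, s i).Nonempty := by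
    rintro J ⟨i, hi⟩
    obtain ⟨x, hx⟩ := hs i
    exact ⟨x, Set.mem_biUnion hi hx⟩
  have lt : ∀ J K : Set I, SetLT J K → SetLT (⋃ i ∈ J, s i) (⋃ i ∈ K, s i) := by
    intro J K hJK x hx y hy
    simp only [Set.mem_iUnion] at hx hy
    obtain ⟨i, hi, hx⟩ := hx
    obtain ⟨j, hj, hy⟩ := hy
    exact hlt i j (hJK i hi j hj) x hx y hy
  refine ⟨fun _ => h.lt _, fun J K hJ hK hJK => ?_, fun a t ht htlt ha => ?_,
    fun a t ht htlt ha => ?_, fun I' _ _ _ _ _ _ t ht htlt hd => ?_⟩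
  · rw [Set.biUnion_union, h.mul _ _ (ne J hJ) (ne K hK) (lt J K hJK)]
  · rw [Set.biUnion_iUnion]
    exact h.om a _ (fun k => ne _ (ht k)) (fun i j hij => lt _ _ (htlt i j hij)) ha
  · rw [Set.biUnion_iUnion]
    exact h.os a _ (fun k => ne _ (ht k)) (fun i j hij => lt _ _ (htlt i j hij)) ha
  · rw [Set.biUnion_iUnion]
    exact h.sh I' _ (fun k => ne _ (ht k)) (fun i j hij => lt _ _ (htlt i j hij)) hd

/-! ### The algebra recognizing the shuffle of a set of colours -/

/-- Elements of the shuffle algebra standing for words with a first letter. -/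
def shufMin (x : ℕ) : Bool := decide (5 ≤ x) || decide (x = 2) || decide (x = 4)

/-- Elements of the shuffle algebra standing for words with a last letter. -/
def shufMax (x : ℕ) : Bool := decide (5 ≤ x) || decide (x = 3) || decide (x = 4)

/-- The element standing for intervals with more than one position. -/
def shufCode (a b : Bool) : ℕ := 1 + (if a then 1 else 0) + (if b then 2 else 0)

/-- The algebra recognizing intervals of the shuffle of the colours in the bit mask `M`, with
colours below `N`: `0` stands for other words, `5 + X` for the letter `X`, and `1` to `4` for the
remaining intervals, according to the existence of a first and a last letter. -/
noncomputable def shufAlg (N M : ℕ) : CircAlg where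
  n := 5 + N
  -- Concatenating two intervals fails exactly when a last letter is directly followed by a first
  -- letter, leaving nothing in between.
  mul x y := if x = 0 ∨ y = 0 ∨ (shufMax x = true ∧ shufMin y = true) then 0
    else shufCode (shufMin x) (shufMax y)
  om x := if x = 0 ∨ (shufMax x = true ∧ shufMin x = true) then 0 else shufCode (shufMin x) false
  os x := if x = 0 ∨ (shufMax x = true ∧ shufMin x = true) then 0 else shufCode false (shufMax x)
  sh m := by
    classical
    -- Once bad pieces are excluded, a recurring piece with more than one position already contains
    -- all colours; if all pieces are single letters, every colour has to be among them.
    exact if m.testBit 0 = true then 0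
      else if (∃ i < 5, m.testBit i = true) ∨
        (∀ X < N, M.testBit X = true → m.testBit (5 + X) = true) then 1 else 0

section ShuffleAlgebra

variable {P : Type} [LinearOrder P] {M N : ℕ} {c : P → ℕ}

/-- The coloured set `J` is an interval of a shuffle of the colours in `M`. -/
def IsShuf (M : ℕ) (c : P → ℕ) (J : Set P) : Prop :=
  (∀ x ∈ J, M.testBit (c x) = true) ∧ ∀ x ∈ J, ∀ y ∈ J, x < y → ∀ X, M.testBit X = true →
    ∃ z ∈ J, x < z ∧ z < y ∧ c z = X

/-- The set has a least element. -/
def HasMin (J : Set P) : Prop := ∃ x ∈ J, ∀ y ∈ J, x ≤ y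

/-- The set has a greatest element. -/
def HasMax (J : Set P) : Prop := ∃ x ∈ J, ∀ y ∈ J, y ≤ x

open Classical in
/-- The value of a coloured set in the shuffle algebra. -/
noncomputable def shufEv (M : ℕ) (c : P → ℕ) (J : Set P) : ℕ :=
  if ¬ IsShuf M c J then 0
  else if h : ∃ x, J = {x} then 5 + c h.choose
  else shufCode (decide (HasMin J)) (decide (HasMax J))

theorem shufCode_bounds (a b : Bool) : 1 ≤ shufCode a b ∧ shufCode a b < 5 := by
  cases a <;> cases b <;> simp [shufCode]

theorem shufMin_code (a b : Bool) : shufMin (shufCode a b) = a := by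
  cases a <;> cases b <;> rfl

theorem shufMax_code (a b : Bool) : shufMax (shufCode a b) = b := by
  cases a <;> cases b <;> rfl

theorem shufEv_bad {J : Set P} (h : ¬ IsShuf M c J) : shufEv M c J = 0 := by
  rw [shufEv, if_pos h]

theorem shufEv_singleton {x : P} (h : M.testBit (c x) = true) : shufEv M c {x} = 5 + c x := by
  have hg : IsShuf M c {x} := by
    refine ⟨by rintro y rfl; exact h, ?_⟩
    rintro y rfl z rfl hyz
    exact (lt_irrefl _ hyz).elim
  have hex : ∃ y, ({x} : Set P) = {y} := ⟨x, rfl⟩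
  rw [shufEv, if_neg (not_not.2 hg), dif_pos hex]
  have := hex.choose_spec
  rw [Set.singleton_eq_singleton_iff] at this
  rw [← this]

theorem shufEv_code {J : Set P} {a b : Bool} (h : IsShuf M c J) (hJ : ¬ ∃ x, J = {x})
    (ha : HasMin J ↔ a = true) (hb : HasMax J ↔ b = true) : shufEv M c J = shufCode a b := by
  classical
  rw [shufEv, if_neg (not_not.2 h), dif_neg hJ]
  congr 1
  · rw [Bool.eq_iff_iff, decide_eq_true_iff, ha]
  · rw [Bool.eq_iff_iff, decide_eq_true_iff, hb]

theorem shufEv_cases (J : Set P) (h : IsShuf M c J) :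
    (∃ x, J = {x} ∧ M.testBit (c x) = true ∧ shufEv M c J = 5 + c x) ∨
    ((¬ ∃ x, J = {x}) ∧ ∃ a b, (HasMin J ↔ a = true) ∧ (HasMax J ↔ b = true) ∧
      shufEv M c J = shufCode a b) := by
  classical
  by_cases hJ : ∃ x, J = {x}
  · obtain ⟨x, rfl⟩ := hJ
    exact Or.inl ⟨x, rfl, h.1 x rfl, shufEv_singleton (h.1 x rfl)⟩
  · exact Or.inr ⟨hJ, decide (HasMin J), decide (HasMax J), by simp, by simp,
      shufEv_code h hJ (by simp) (by simp)⟩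

theorem shufEv_eq_zero {J : Set P} : shufEv M c J = 0 ↔ ¬ IsShuf M c J := by
  refine ⟨fun h0 h => ?_, shufEv_bad⟩
  rcases shufEv_cases J h with ⟨x, -, -, hx⟩ | ⟨-, a, b, -, -, hx⟩
  · omega
  · have := shufCode_bounds a b; omega

theorem shufEv_min {J : Set P} (h : IsShuf M c J) : HasMin J ↔ shufMin (shufEv M c J) = true := by
  rcases shufEv_cases J h with ⟨x, rfl, -, hx⟩ | ⟨-, a, b, ha, -, hx⟩
  · rw [hx]
    simp [shufMin, HasMin]
  · rw [hx, shufMin_code, ha]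

theorem shufEv_max {J : Set P} (h : IsShuf M c J) : HasMax J ↔ shufMax (shufEv M c J) = true := by
  rcases shufEv_cases J h with ⟨x, rfl, -, hx⟩ | ⟨-, a, b, -, hb, hx⟩
  · rw [hx]
    simp [shufMax, HasMax]
  · rw [hx, shufMax_code, hb]

theorem shufEv_lt (hM : M < 2 ^ N) (J : Set P) : shufEv M c J < 5 + N := by
  by_cases h : IsShuf M c J
  · rcases shufEv_cases J h with ⟨x, -, hb, hx⟩ | ⟨-, a, b, -, -, hx⟩
    · have := lt_of_testBit hM hb; omega
    · have := shufCode_bounds a b; omega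
  · rw [shufEv_bad h]; omega

/-- A point strictly between two points of one part can only belong to that part. -/
theorem IsShuf.part {I : Type} [LinearOrder I] {s : I → Set P}
    (hlt : ∀ i j, i < j → SetLT (s i) (s j)) (h : IsShuf M c (⋃ i, s i)) (i : I) :
    IsShuf M c (s i) := by
  refine ⟨fun x hx => h.1 x (Set.mem_iUnion.2 ⟨i, hx⟩), fun x hx y hy hxy X hX => ?_⟩
  obtain ⟨z, hz, h1, h2, h3⟩ :=
    h.2 x (Set.mem_iUnion.2 ⟨i, hx⟩) y (Set.mem_iUnion.2 ⟨i, hy⟩) hxy X hX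
  obtain ⟨j, hz⟩ := Set.mem_iUnion.1 hz
  rcases lt_trichotomy i j with hij | rfl | hij
  · exact absurd (hlt i j hij y hy z hz) (not_lt.2 h2.le)
  · exact ⟨z, hz, h1, h2, h3⟩
  · exact absurd (hlt j i hij z hz x hx) (not_lt.2 h1.le)

theorem IsShuf.iUnion {I : Type} [LinearOrder I] {s : I → Set P}
    (hlt : ∀ i j, i < j → SetLT (s i) (s j)) (h : ∀ i, IsShuf M c (s i))
    (hb : ∀ i j, i < j → ∀ x ∈ s i, ∀ y ∈ s j, ∀ X, M.testBit X = true →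
      ∃ z ∈ ⋃ i, s i, x < z ∧ z < y ∧ c z = X) : IsShuf M c (⋃ i, s i) := by
  refine ⟨fun x hx => ?_, fun x hx y hy hxy X hX => ?_⟩
  · obtain ⟨i, hx⟩ := Set.mem_iUnion.1 hx
    exact (h i).1 x hx
  · obtain ⟨i, hx⟩ := Set.mem_iUnion.1 hx
    obtain ⟨j, hy⟩ := Set.mem_iUnion.1 hy
    rcases lt_trichotomy i j with hij | rfl | hij
    · exact hb i j hij x hx y hy X hX
    · obtain ⟨z, hz, h'⟩ := (h i).2 x hx y hy hxy X hX
      exact ⟨z, Set.mem_iUnion.2 ⟨i, hz⟩, h'⟩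
    · exact absurd (hlt j i hij y hy x hx) (not_lt.2 hxy.le)

/-- Between two parts that do not meet in two adjacent letters all colours occur. -/
theorem IsShuf.between {I : Type} [LinearOrder I] {s : I → Set P}
    (hlt : ∀ i j, i < j → SetLT (s i) (s j)) (h : ∀ i, IsShuf M c (s i)) {i j : I} (hij : i < j)
    (hn : ¬ (HasMax (s i) ∧ HasMin (s j))) {x y : P} (hx : x ∈ s i) (hy : y ∈ s j) {X : ℕ}
    (hX : M.testBit X = true) : ∃ z ∈ ⋃ i, s i, x < z ∧ z < y ∧ c z = X := by
  by_cases hm : HasMax (s i)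
  · have hm' : ¬ HasMin (s j) := fun h => hn ⟨hm, h⟩
    simp only [HasMin] at hm'
    push Not at hm'
    obtain ⟨w, hw, hwy⟩ := hm' y hy
    obtain ⟨z, hz, h1, h2, h3⟩ := (h j).2 w hw y hy hwy X hX
    exact ⟨z, Set.mem_iUnion.2 ⟨j, hz⟩, (hlt i j hij x hx w hw).trans h1, h2, h3⟩
  · simp only [HasMax] at hm
    push Not at hm
    obtain ⟨w, hw, hxw⟩ := hm x hx
    obtain ⟨z, hz, h1, h2, h3⟩ := (h i).2 x hx w hw hxw X hX
    exact ⟨z, Set.mem_iUnion.2 ⟨i, hz⟩, h1, h2.trans (hlt i j hij w hw y hy), h3⟩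

/-- Two parts without a part in between do not meet in two adjacent letters. -/
theorem IsShuf.not_adjacent {I : Type} [LinearOrder I] {s : I → Set P}
    (hlt : ∀ i j, i < j → SetLT (s i) (s j)) (h : IsShuf M c (⋃ i, s i)) {i j : I} (hij : i < j)
    (hno : ∀ k, ¬ (i < k ∧ k < j)) : ¬ (HasMax (s i) ∧ HasMin (s j)) := by
  rintro ⟨⟨x, hx, hxm⟩, ⟨y, hy, hym⟩⟩
  obtain ⟨z, hz, h1, h2, -⟩ := h.2 x (Set.mem_iUnion.2 ⟨i, hx⟩) y (Set.mem_iUnion.2 ⟨j, hy⟩)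
    (hlt i j hij x hx y hy) _ (h.1 x (Set.mem_iUnion.2 ⟨i, hx⟩))
  obtain ⟨k, hz⟩ := Set.mem_iUnion.1 hz
  rcases lt_trichotomy k i with hk | rfl | hk
  · exact absurd (hlt k i hk z hz x hx) (not_lt.2 h1.le)
  · exact absurd (hxm z hz) (not_le.2 h1)
  rcases lt_trichotomy k j with hk' | rfl | hk'
  · exact hno k ⟨hk, hk'⟩
  · exact absurd (hym z hz) (not_le.2 h2)
  · exact absurd (hlt j k hk' y hy z hz) (not_lt.2 h2.le)

theorem not_singleton_iUnion {I : Type} [LinearOrder I] {s : I → Set P}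
    (hs : ∀ i, (s i).Nonempty) (hlt : ∀ i j, i < j → SetLT (s i) (s j)) {i j : I} (hij : i < j) :
    ¬ ∃ x, (⋃ i, s i) = {x} := by
  rintro ⟨w, hw⟩
  obtain ⟨x, hx⟩ := hs i
  obtain ⟨y, hy⟩ := hs j
  have h1 : x ∈ ({w} : Set P) := hw ▸ Set.mem_iUnion.2 ⟨i, hx⟩
  have h2 : y ∈ ({w} : Set P) := hw ▸ Set.mem_iUnion.2 ⟨j, hy⟩
  have := hlt i j hij x hx y hy
  rw [Set.mem_singleton_iff.1 h1, Set.mem_singleton_iff.1 h2] at this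
  exact lt_irrefl _ this

theorem hasMin_iUnion {I : Type} [LinearOrder I] {s : I → Set P}
    (hs : ∀ i, (s i).Nonempty) (hlt : ∀ i j, i < j → SetLT (s i) (s j)) :
    HasMin (⋃ i, s i) ↔ ∃ i, (∀ j, i ≤ j) ∧ HasMin (s i) := by
  constructor
  · rintro ⟨x, hx, hm⟩
    obtain ⟨i, hx⟩ := Set.mem_iUnion.1 hx
    refine ⟨i, fun j => not_lt.1 fun hji => ?_, x, hx, fun y hy => hm y (Set.mem_iUnion.2 ⟨i, hy⟩)⟩
    obtain ⟨y, hy⟩ := hs j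
    exact absurd (hm y (Set.mem_iUnion.2 ⟨j, hy⟩)) (not_le.2 (hlt j i hji y hy x hx))
  · rintro ⟨i, hi, x, hx, hm⟩
    refine ⟨x, Set.mem_iUnion.2 ⟨i, hx⟩, fun y hy => ?_⟩
    obtain ⟨j, hy⟩ := Set.mem_iUnion.1 hy
    rcases (hi j).eq_or_lt with rfl | hij
    · exact hm y hy
    · exact (hlt i j hij x hx y hy).le

theorem hasMax_iUnion {I : Type} [LinearOrder I] {s : I → Set P}
    (hs : ∀ i, (s i).Nonempty) (hlt : ∀ i j, i < j → SetLT (s i) (s j)) :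
    HasMax (⋃ i, s i) ↔ ∃ i, (∀ j, j ≤ i) ∧ HasMax (s i) :=
  hasMin_iUnion (P := Pᵒᵈ) (I := Iᵒᵈ) (s := fun i => OrderDual.ofDual ⁻¹' s (OrderDual.ofDual i))
    hs fun i j hij x hx y hy => hlt j i hij y hy x hx

/-- For products and ω-sums, the union is an interval of a shuffle iff all parts are and no last
letter meets the first letter of the next part. In a dense sum no parts are neighbours, and the
question is whether every colour occurs between any two parts. -/
theorem shufAlg_isEval (hM : M < 2 ^ N) : IsEval (shufAlg N M) (shufEv M c) where
  lt J := shufEv_lt hM J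
  mul s t hs ht hst := by
    let u : Bool → Set P := fun b => if b then t else s
    have hu : (s ∪ t) = ⋃ b, u b := by ext p; simp [u]
    have hne : ∀ b, (u b).Nonempty := by rintro (_ | _) <;> simpa [u]
    have hlt : ∀ i j, i < j → SetLT (u i) (u j) := by
      rintro (_ | _) (_ | _) h <;> first | exact absurd h (by decide) | exact hst
    rw [hu]
    simp only [shufAlg]
    split_ifs with hc
    · rw [shufEv_eq_zero]
      intro hg
      have h1 := hg.part hlt false
      have h2 := hg.part hlt true
      rcases hc with hc | hc | ⟨hc1, hc2⟩
      · exact shufEv_eq_zero.1 hc h1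
      · exact shufEv_eq_zero.1 hc h2
      · refine hg.not_adjacent hlt (i := false) (j := true) (by decide) (by decide)
          ⟨(shufEv_max h1).2 hc1, (shufEv_min h2).2 hc2⟩
    · push Not at hc
      obtain ⟨hc1, hc2, hc3⟩ := hc
      have h1 : IsShuf M c s := not_not.1 fun h => hc1 (shufEv_eq_zero.2 h)
      have h2 : IsShuf M c t := not_not.1 fun h => hc2 (shufEv_eq_zero.2 h)
      have hall : ∀ b, IsShuf M c (u b) := by rintro (_ | _) <;> simpa [u]
      refine shufEv_code (IsShuf.iUnion hlt hall ?_)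
        (not_singleton_iUnion hne hlt (i := false) (j := true) (by decide)) ?_ ?_
      · rintro (_ | _) (_ | _) h x hx y hy X hX
        · exact absurd h (by decide)
        · exact IsShuf.between hlt hall h
            (fun hh => hc3 ((shufEv_max h1).1 hh.1) ((shufEv_min h2).1 hh.2)) hx hy hX
        · exact absurd h (by decide)
        · exact absurd h (by decide)
      · rw [hasMin_iUnion hne hlt, ← shufEv_min h1]
        constructor
        · rintro ⟨_ | _, h, h'⟩
          · exact h'
          · exact absurd (h false) (by decide)
        · intro h; exact ⟨false, by decide, h⟩
      · rw [hasMax_iUnion hne hlt, ← shufEv_max h2]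
        constructor
        · rintro ⟨_ | _, h, h'⟩
          · exact absurd (h true) (by decide)
          · exact h'
        · intro h; exact ⟨true, by decide, h⟩
  om a s hne hlt ha := by
    simp only [shufAlg]
    split_ifs with hc
    · rw [shufEv_eq_zero]
      intro hg
      rcases hc with hc | ⟨hc1, hc2⟩
      · exact shufEv_eq_zero.1 ((ha 0).trans hc) (hg.part hlt 0)
      · refine hg.not_adjacent hlt (i := 0) (j := 1) (by decide) (by omega)
          ⟨(shufEv_max (hg.part hlt 0)).2 ?_, (shufEv_min (hg.part hlt 1)).2 ?_⟩
        · rw [ha]; exact hc1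
        · rw [ha]; exact hc2
    · push Not at hc
      obtain ⟨hc1, hc2⟩ := hc
      have hall : ∀ i, IsShuf M c (s i) := fun i =>
        not_not.1 fun h => hc1 (by rw [← ha i]; exact shufEv_eq_zero.2 h)
      refine shufEv_code (IsShuf.iUnion hlt hall fun i j hij x hx y hy X hX => ?_)
        (not_singleton_iUnion hne hlt (i := 0) (j := 1) (by decide)) ?_ ?_
      · refine IsShuf.between hlt hall hij (fun hh => ?_) hx hy hX
        rw [shufEv_max (hall i), shufEv_min (hall j), ha, ha] at hh
        exact hc2 hh.1 hh.2
      · rw [hasMin_iUnion hne hlt, ← ha 0, ← shufEv_min (hall 0)]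
        constructor
        · rintro ⟨i, hi, h⟩
          obtain rfl : i = 0 := Nat.le_zero.1 (hi 0)
          exact h
        · intro h; exact ⟨0, Nat.zero_le, h⟩
      · rw [hasMax_iUnion hne hlt]
        simp only [Bool.false_eq_true, iff_false]
        rintro ⟨i, hi, -⟩
        exact absurd (hi (i + 1)) (by omega)
  os a s hne hlt ha := by
    let u : ℕᵒᵈ → Set P := fun i => s (OrderDual.ofDual i)
    have hne' : ∀ i, (u i).Nonempty := fun i => hne _
    have hlt' : ∀ i j, i < j → SetLT (u i) (u j) := fun i j hij => hlt _ _ hij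
    have ha' : ∀ i, shufEv M c (u i) = a := fun i => ha _
    change shufEv M c (⋃ i, u i) = _
    have h01 : OrderDual.toDual 1 < OrderDual.toDual 0 := Nat.one_pos
    simp only [shufAlg]
    split_ifs with hc
    · rw [shufEv_eq_zero]
      intro hg
      rcases hc with hc | ⟨hc1, hc2⟩
      · exact shufEv_eq_zero.1 ((ha 0).trans hc) (hg.part hlt' (OrderDual.toDual 0))
      · refine hg.not_adjacent hlt' h01 ?_
          ⟨(shufEv_max (hg.part hlt' _)).2 ?_, (shufEv_min (hg.part hlt' _)).2 ?_⟩
        · rintro k ⟨h1, h2⟩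
          have h1 : OrderDual.ofDual k < 1 := h1
          have h2 : 0 < OrderDual.ofDual k := h2
          omega
        · rw [ha']; exact hc1
        · rw [ha']; exact hc2
    · push Not at hc
      obtain ⟨hc1, hc2⟩ := hc
      have hall : ∀ i, IsShuf M c (u i) := fun i =>
        not_not.1 fun h => hc1 (by rw [← ha' i]; exact shufEv_eq_zero.2 h)
      refine shufEv_code (IsShuf.iUnion hlt' hall fun i j hij x hx y hy X hX => ?_)
        (not_singleton_iUnion hne' hlt' h01) ?_ ?_
      · refine IsShuf.between hlt' hall hij (fun hh => ?_) hx hy hX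
        rw [shufEv_max (hall i), shufEv_min (hall j), ha', ha'] at hh
        exact hc2 hh.1 hh.2
      · rw [hasMin_iUnion hne' hlt']
        simp only [Bool.false_eq_true, iff_false]
        rintro ⟨i, hi, -⟩
        have : OrderDual.ofDual i + 1 ≤ OrderDual.ofDual i :=
          hi (OrderDual.toDual (OrderDual.ofDual i + 1))
        omega
      · rw [hasMax_iUnion hne' hlt', ← ha' (OrderDual.toDual 0), ← shufEv_max (hall _)]
        constructor
        · rintro ⟨i, hi, h⟩
          have h0 : OrderDual.ofDual i ≤ 0 := hi (OrderDual.toDual 0)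
          obtain rfl : i = OrderDual.toDual 0 := Nat.le_zero.1 h0
          exact h
        · intro h; exact ⟨_, fun j => Nat.zero_le _, h⟩
  sh I _ _ _ _ _ _ s hne hlt hd := by
    classical
    obtain ⟨i₀⟩ := ‹Nonempty I›
    obtain ⟨j₀, hij₀⟩ := exists_gt i₀
    have hbit : ∀ x, (mask (shufAlg N M).n fun a => ∃ i, shufEv M c (s i) = a).testBit x = true ↔
        ∃ i, shufEv M c (s i) = x := by
      intro x
      rw [testBit_mask]
      constructor
      · exact fun h => h.2
      · rintro ⟨i, rfl⟩; exact ⟨shufEv_lt hM _, i, rfl⟩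
    generalize (mask (shufAlg N M).n fun a => ∃ i, shufEv M c (s i) = a) = m at hbit
    simp only [shufAlg]
    split_ifs with h0 h1
    · obtain ⟨i, hi⟩ := (hbit 0).1 h0
      rw [shufEv_eq_zero] at hi ⊢
      exact fun hg => hi (hg.part hlt i)
    · have hall : ∀ i, IsShuf M c (s i) := fun i =>
        not_not.1 fun h => h0 ((hbit 0).2 ⟨i, shufEv_eq_zero.2 h⟩)
      refine shufEv_code (a := false) (b := false)
        (IsShuf.iUnion hlt hall fun i j hij x hx y hy X hX => ?_)
        (not_singleton_iUnion hne hlt hij₀) ?_ ?_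
      · rcases h1 with ⟨v, hv5, hv⟩ | h1
        · obtain ⟨k, hk⟩ := (hbit v).1 hv
          obtain ⟨l, hil, hlj, hlk⟩ := hd i j k hij
          rw [hk] at hlk
          have hl : ¬ ∃ x, s l = {x} := by
            rintro ⟨w, hw⟩
            have hb := (hall l).1 w (hw ▸ rfl)
            rw [hw, shufEv_singleton hb] at hlk
            omega
          obtain ⟨p, hp⟩ := hne l
          have : ∃ q ∈ s l, q ≠ p := by
            by_contra hno
            push Not at hno
            exact hl ⟨p, Set.eq_singleton_iff_unique_mem.2 ⟨hp, hno⟩⟩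
          obtain ⟨q, hq, hqp⟩ := this
          have : ∃ z ∈ s l, c z = X := by
            rcases lt_or_gt_of_ne hqp with h | h
            · obtain ⟨z, hz, -, -, hzX⟩ := (hall l).2 q hq p hp h X hX
              exact ⟨z, hz, hzX⟩
            · obtain ⟨z, hz, -, -, hzX⟩ := (hall l).2 p hp q hq h X hX
              exact ⟨z, hz, hzX⟩
          obtain ⟨z, hz, hzX⟩ := this
          exact ⟨z, Set.mem_iUnion.2 ⟨l, hz⟩, hlt i l hil x hx z hz, hlt l j hlj z hz y hy, hzX⟩
        · obtain ⟨k, hk⟩ := (hbit _).1 (h1 X (lt_of_testBit hM hX) hX)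
          obtain ⟨l, hil, hlj, hlk⟩ := hd i j k hij
          rw [hk] at hlk
          rcases shufEv_cases _ (hall l) with ⟨z, hz, -, hv⟩ | ⟨-, a, b, -, -, hv⟩
          · have hzl : z ∈ s l := hz ▸ rfl
            exact ⟨z, Set.mem_iUnion.2 ⟨l, hzl⟩, hlt i l hil x hx z hzl, hlt l j hlj z hzl y hy,
              by omega⟩
          · have := shufCode_bounds a b; omega
      · rw [hasMin_iUnion hne hlt]
        simp only [Bool.false_eq_true, iff_false]
        rintro ⟨i, hi, -⟩
        obtain ⟨j, hj⟩ := exists_lt i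
        exact absurd (hi j) (not_le.2 hj)
      · rw [hasMax_iUnion hne hlt]
        simp only [Bool.false_eq_true, iff_false]
        rintro ⟨i, hi, -⟩
        obtain ⟨j, hj⟩ := exists_gt i
        exact absurd (hi j) (not_le.2 hj)
    · rw [shufEv_eq_zero]
      intro hg
      push Not at h1
      obtain ⟨h1, X, -, hX, hXm⟩ := h1
      obtain ⟨x, hx⟩ := hne i₀
      obtain ⟨y, hy⟩ := hne j₀
      obtain ⟨z, hz, -, -, hzX⟩ := hg.2 x (Set.mem_iUnion.2 ⟨i₀, hx⟩) y
        (Set.mem_iUnion.2 ⟨j₀, hy⟩) (hlt i₀ j₀ hij₀ x hx y hy) X hX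
      obtain ⟨k, hz⟩ := Set.mem_iUnion.1 hz
      rcases shufEv_cases _ (hg.part hlt k) with ⟨w, hw, -, hv⟩ | ⟨-, a, b, -, -, hv⟩
      · rw [hw] at hz
        obtain rfl : z = w := hz
        exact hXm ((hbit _).2 ⟨k, by rw [hv, hzX]⟩)
      · have := shufCode_bounds a b
        exact h1 _ this.2 ((hbit _).2 ⟨k, hv⟩)

theorem shufEv_univ_of_shuffled [NoMinOrder P] [NoMaxOrder P] [Nonempty P] (hc : Shuffled c)
    (hM : ∀ X, M.testBit X = true ↔ ∃ p, c p = X) : shufEv M c Set.univ = 1 := by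
  refine shufEv_code (a := false) (b := false)
    ⟨fun x _ => (hM _).2 ⟨x, rfl⟩, fun x _ y _ hxy X hX => ?_⟩ ?_ ?_ ?_
  · obtain ⟨k, rfl⟩ := (hM X).1 hX
    obtain ⟨l, h1, h2, h3⟩ := hc x y k hxy
    exact ⟨l, Set.mem_univ _, h1, h2, h3⟩
  · rintro ⟨x, hx⟩
    obtain ⟨y, hy⟩ := exists_gt x
    exact hy.ne' (hx ▸ Set.mem_univ y : y ∈ ({x} : Set P))
  · simp only [Bool.false_eq_true, iff_false]
    rintro ⟨x, -, hx⟩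
    obtain ⟨y, hy⟩ := exists_lt x
    exact absurd (hx y (Set.mem_univ y)) (not_le.2 hy)
  · simp only [Bool.false_eq_true, iff_false]
    rintro ⟨x, -, hx⟩
    obtain ⟨y, hy⟩ := exists_gt x
    exact absurd (hx y (Set.mem_univ y)) (not_le.2 hy)

/-- With `shufEv_univ_of_shuffled` this makes `1` the accepting value for shuffles of exactly the
colours in `M`. The empty set has value `1` too, hence the assumption that `P` is nonempty. -/
theorem shuffled_of_shufEv_univ [Nonempty P] (h : shufEv M c Set.univ = 1) :
    DenselyOrdered P ∧ NoMinOrder P ∧ NoMaxOrder P ∧ Shuffled c ∧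
      ∀ X, M.testBit X = true ↔ ∃ p, c p = X := by
  have hg : IsShuf M c Set.univ := not_not.1 fun hh => by rw [shufEv_bad hh] at h; omega
  have hmin : ¬ HasMin (Set.univ : Set P) := by rw [shufEv_min hg, h]; decide
  have hmax : ¬ HasMax (Set.univ : Set P) := by rw [shufEv_max hg, h]; decide
  simp only [HasMin, HasMax, Set.mem_univ, true_and, forall_const] at hmin hmax
  push Not at hmin hmax
  have hb : ∀ x y : P, x < y → ∀ X, M.testBit X = true → ∃ z, x < z ∧ z < y ∧ c z = X := by
    intro x y hxy X hX
    obtain ⟨z, -, hz⟩ := hg.2 x (Set.mem_univ _) y (Set.mem_univ _) hxy X hX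
    exact ⟨z, hz⟩
  have hcM : ∀ x, M.testBit (c x) = true := fun x => hg.1 x (Set.mem_univ x)
  refine ⟨⟨fun x y hxy => ?_⟩, ⟨hmin⟩, ⟨hmax⟩, fun x y k hxy => hb x y hxy _ (hcM k),
    fun X => ⟨fun hX => ?_, ?_⟩⟩
  · obtain ⟨z, h1, h2, -⟩ := hb x y hxy _ (hcM x)
    exact ⟨z, h1, h2⟩
  · obtain ⟨x⟩ := ‹Nonempty P›
    obtain ⟨y, hy⟩ := hmax x
    obtain ⟨z, -, -, hz⟩ := hb x y hy X hX
    exact ⟨z, hz⟩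
  · rintro ⟨p, rfl⟩; exact hcM p

end ShuffleAlgebra

/-! ### Tables of algebras -/

/-- An algebra given by its number of elements and the tables of its operations. -/
abbrev AlgTab : Type := ℕ × List ℕ × List ℕ × List ℕ × List ℕ

/-- The algebra with the given tables. -/
def AlgTab.alg (T : AlgTab) : CircAlg where
  n := T.1
  mul x y := T.2.1.getD (x * T.1 + y) 0
  om x := T.2.2.1.getD x 0
  os x := T.2.2.2.1.getD x 0
  sh m := T.2.2.2.2.getD m 0

/-- The table of a function. -/
def tabulate (k : ℕ) (f : ℕ → ℕ) : List ℕ := (List.range k).map f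

theorem getD_tabulate {k i : ℕ} (f : ℕ → ℕ) (h : i < k) : (tabulate k f).getD i 0 = f i := by
  simp [tabulate, List.getD_eq_getElem?_getD, h]

theorem tabulate_congr {k : ℕ} {f g : ℕ → ℕ} (h : ∀ i < k, f i = g i) :
    tabulate k f = tabulate k g :=
  List.map_congr_left fun i hi => h i (List.mem_range.1 hi)

/-- The tables of an algebra. -/
def CircAlg.tab (A : CircAlg) : AlgTab :=
  (A.n, tabulate (A.n * A.n) fun i => A.mul (i / A.n) (i % A.n), tabulate A.n A.om,
    tabulate A.n A.os, tabulate (2 ^ A.n) A.sh)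

theorem CircAlg.tab_mul {A : CircAlg} {x y : ℕ} (hx : x < A.n) (hy : y < A.n) :
    A.tab.alg.mul x y = A.mul x y := by
  change (tabulate (A.n * A.n) fun i => A.mul (i / A.n) (i % A.n)).getD (x * A.n + y) 0 = _
  rw [getD_tabulate]
  · have hpos : 0 < A.n := by omega
    rw [Nat.mul_comm, Nat.mul_add_div hpos, Nat.div_eq_of_lt hy, Nat.mul_add_mod,
      Nat.mod_eq_of_lt hy, Nat.add_zero]
  · calc x * A.n + y < x * A.n + A.n := by omega
      _ = (x + 1) * A.n := by ring
      _ ≤ A.n * A.n := Nat.mul_le_mul_right _ hx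

theorem CircAlg.tab_om {A : CircAlg} {x : ℕ} (hx : x < A.n) : A.tab.alg.om x = A.om x :=
  getD_tabulate _ hx

theorem CircAlg.tab_os {A : CircAlg} {x : ℕ} (hx : x < A.n) : A.tab.alg.os x = A.os x :=
  getD_tabulate _ hx

theorem CircAlg.tab_sh {A : CircAlg} {m : ℕ} (hm : m < 2 ^ A.n) : A.tab.alg.sh m = A.sh m :=
  getD_tabulate _ hm

theorem IsEval.tab {A : CircAlg} {P : Type} [LinearOrder P] {ev : Set P → ℕ} (h : IsEval A ev) :
    IsEval A.tab.alg ev where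
  lt := h.lt
  mul s t hs ht hst := by
    rw [h.mul s t hs ht hst, CircAlg.tab_mul (h.lt s) (h.lt t)]
  om a s hs hlt ha := by
    rw [h.om a s hs hlt ha, CircAlg.tab_om (ha 0 ▸ h.lt _)]
  os a s hs hlt ha := by
    rw [h.os a s hs hlt ha, CircAlg.tab_os (ha 0 ▸ h.lt _)]
  sh I _ _ _ _ _ _ s hs hlt hd := by
    rw [h.sh I s hs hlt hd]
    exact (CircAlg.tab_sh (mask_lt _ _)).symm

theorem SGen.lt {A : CircAlg} {G : ℕ → Prop} {x : ℕ} (h : SGen A G x) : x < A.n := by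
  cases h <;> assumption

theorem Cl.lt {A : CircAlg} {G : ℕ → Prop} {x : ℕ} (h : Cl A G x) : x < A.n := by
  cases h <;> assumption

/-- Generation applies the operations only to arguments in range, where the tables agree with the
functions. -/
theorem Cl.tab_iff {A : CircAlg} {G : ℕ → Prop} {x : ℕ} : Cl A.tab.alg G x ↔ Cl A G x := by
  constructor
  · intro h
    induction h with
    | gen g hg hG => exact Cl.gen g hg hG
    | mul a b ha hb hlt iha ihb =>
      rw [CircAlg.tab_mul (A := A) ha.lt hb.lt] at hlt ⊢
      exact Cl.mul a b iha ihb hlt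
    | om a ha hlt iha =>
      rw [CircAlg.tab_om (A := A) ha.lt] at hlt ⊢
      exact Cl.om a iha hlt
    | os a ha hlt iha =>
      rw [CircAlg.tab_os (A := A) ha.lt] at hlt ⊢
      exact Cl.os a iha hlt
    | sh m hm0 hm hi hlt ih =>
      rw [CircAlg.tab_sh (A := A) hm] at hlt ⊢
      exact Cl.sh m hm0 hm ih hlt
  · intro h
    induction h with
    | gen g hg hG => exact Cl.gen (A := A.tab.alg) g hg hG
    | mul a b ha hb hlt iha ihb =>
      rw [← CircAlg.tab_mul ha.lt hb.lt] at hlt ⊢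
      exact Cl.mul a b iha ihb hlt
    | om a ha hlt iha =>
      rw [← CircAlg.tab_om ha.lt] at hlt ⊢
      exact Cl.om a iha hlt
    | os a ha hlt iha =>
      rw [← CircAlg.tab_os ha.lt] at hlt ⊢
      exact Cl.os a iha hlt
    | sh m hm0 hm hi hlt ih =>
      rw [← CircAlg.tab_sh hm] at hlt ⊢
      exact Cl.sh m hm0 hm ih hlt

/-! ### The power algebra -/

/-- Letters of the product of an algebra with the shuffle algebra: an element of a colour together
with that colour, where colours are bit masks of sets of elements. -/
def shufGen (M z : ℕ) : Prop :=
  ∃ X x, M.testBit X = true ∧ X.testBit x = true ∧ z = Nat.pair x (5 + X)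

/-- The algebra of sets of elements, for projections of languages. -/
noncomputable def powAlg (A : CircAlg) : CircAlg where
  n := 2 ^ A.n
  mul X Y := mask A.n fun a =>
    ∃ x y, X.testBit x = true ∧ Y.testBit y = true ∧ A.mul x y = a
  -- The letters chosen along an ω-sequence may vary; after factorization the value is `x` times the
  -- ω-power of `y`, with `x` and `y` products of elements of `X`.
  om X := mask A.n fun a =>
    ∃ x y, SGen A (fun i => X.testBit i = true) x ∧ SGen A (fun i => X.testBit i = true) y ∧
      A.mul x (A.om y) = a
  os X := mask A.n fun a =>
    ∃ x y, SGen A (fun i => X.testBit i = true) x ∧ SGen A (fun i => X.testBit i = true) y ∧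
      A.mul (A.os y) x = a
  -- Occurrences of one set may contribute different elements. So words over pairs of a set `X` and
  -- an element `x` of it are considered, and the value `1` in the shuffle algebra forces the sets
  -- to form the shuffle of `M`.
  sh M := mask A.n fun a =>
    Cl (prodAlg A (shufAlg (2 ^ A.n) M).tab.alg) (shufGen M) (Nat.pair a 1)

section Power

variable {P : Type} {E : P → ℕ → Prop} {ev : (P → ℕ) → Set P → ℕ}

/-- The labellings that choose an admissible letter at each position. -/
def Choice (E : P → ℕ → Prop) (l : P → ℕ) : Prop := ∀ p, E p (l p)

/-- The set of values of a word over all choices of letters. -/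
noncomputable def powEv (n : ℕ) (E : P → ℕ → Prop) (ev : (P → ℕ) → Set P → ℕ) (s : Set P) : ℕ :=
  mask n fun a => ∃ l, Choice E l ∧ ev l s = a

/-- The value of a word depends only on the letters of the word. -/
def LocalEv (ev : (P → ℕ) → Set P → ℕ) : Prop :=
  ∀ l l' s, (∀ p ∈ s, l p = l' p) → ev l s = ev l' s

theorem SetLT.not_mem [LinearOrder P] {s t : Set P} (h : SetLT s t) {p : P} (hp : p ∈ s) :
    p ∉ t := fun hp' => lt_irrefl _ (h p hp p hp')

/-- Ordered parts are disjoint, so each position follows the labelling of its own part; `hE` serves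
the positions outside all parts. -/
theorem Choice.glue [LinearOrder P] {I : Type} [LinearOrder I] (s : I → Set P)
    (hlt : ∀ i j, i < j → SetLT (s i) (s j)) (hE : ∃ l, Choice E l) (l : I → P → ℕ)
    (hl : ∀ i, Choice E (l i)) : ∃ l', Choice E l' ∧ ∀ i, ∀ p ∈ s i, l' p = l i p := by
  classical
  obtain ⟨l₀, hl₀⟩ := hE
  refine ⟨fun p => if h : ∃ i, p ∈ s i then l h.choose p else l₀ p, fun p => ?_, fun i p hp => ?_⟩
  · dsimp only
    split_ifs with h
    · exact hl _ p
    · exact hl₀ p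
  · have h : ∃ i, p ∈ s i := ⟨i, hp⟩
    dsimp only
    rw [dif_pos h]
    have hc := h.choose_spec
    rcases lt_trichotomy i h.choose with hi | hi | hi
    · exact ((hlt _ _ hi).not_mem hp hc).elim
    · rw [← hi]
    · exact ((hlt _ _ hi).not_mem hc hp).elim

theorem Choice.glue_pair [LinearOrder P] {s t : Set P} (hst : SetLT s t) {l₁ l₂ : P → ℕ}
    (h₁ : Choice E l₁) (h₂ : Choice E l₂) :
    ∃ l, Choice E l ∧ (∀ p ∈ s, l p = l₁ p) ∧ ∀ p ∈ t, l p = l₂ p := by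
  classical
  refine ⟨fun p => if p ∈ s then l₁ p else l₂ p, fun p => ?_, fun p hp => if_pos hp,
    fun p hp => if_neg fun hp' => hst.not_mem hp' hp⟩
  dsimp only
  split_ifs
  · exact h₁ p
  · exact h₂ p

variable [LinearOrder P] {A : CircAlg}

theorem powEv_testBit (h : ∀ l, Choice E l → IsEval A (ev l)) {s : Set P} {a : ℕ} :
    (powEv A.n E ev s).testBit a = true ↔ ∃ l, Choice E l ∧ ev l s = a := by
  rw [powEv, testBit_mask]
  constructor
  · exact fun h => h.2
  · rintro ⟨l, hl, rfl⟩; exact ⟨(h l hl).lt s, l, hl, rfl⟩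

theorem powEv_om (hE : ∃ l, Choice E l) (h : ∀ l, Choice E l → IsEval A (ev l))
    (hloc : LocalEv ev) (X : ℕ) (s : ℕ → Set P) (hs : ∀ i, (s i).Nonempty)
    (hlt : ∀ i j, i < j → SetLT (s i) (s j)) (hX : ∀ i, powEv A.n E ev (s i) = X) :
    powEv A.n E ev (⋃ i, s i) = (powAlg A).om X := by
  refine mask_congr fun a _ => ?_
  constructor
  · rintro ⟨l, hl, rfl⟩
    obtain ⟨x, y, hx, hy, -, hxy⟩ := (h l hl).exists_factor s hs hlt
    have mono : ∀ z, SGen A (fun a => ∃ i, ev l (s i) = a) z →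
        SGen A (fun i => X.testBit i = true) z := fun z hz =>
      hz.closed (fun a ha ⟨i, hi⟩ => SGen.gen _ ha (by
        rw [← hX i]; exact (powEv_testBit h).2 ⟨l, hl, hi⟩)) SGen.mul
    exact ⟨x, y, mono x hx, mono y hy, hxy.symm⟩
  -- Every `s i` can take every value in `X`, so a product of `k` elements of `X` is attained on any
  -- `k` consecutive parts, wherever they start.
  · have key : ∀ x, SGen A (fun i => X.testBit i = true) x →
        ∃ k, 0 < k ∧ ∀ b, ∃ l, Choice E l ∧ ev l (block s b (b + k)) = x := by
      intro x hx
      induction hx with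
      | gen x hx hxX =>
        refine ⟨1, one_pos, fun b => ?_⟩
        rw [block_one]
        exact (powEv_testBit h).1 (by rw [hX b]; exact hxX)
      | mul x y _ _ _ ihx ihy =>
        obtain ⟨k, hk, hx⟩ := ihx
        obtain ⟨m, hm, hy⟩ := ihy
        refine ⟨k + m, by omega, fun b => ?_⟩
        obtain ⟨l₁, hl₁, h₁⟩ := hx b
        obtain ⟨l₂, hl₂, h₂⟩ := hy (b + k)
        have hst : SetLT (block s b (b + k)) (block s (b + k) (b + k + m)) :=
          block_lt hlt _ _ _ _ le_rfl
        obtain ⟨l, hl, hls, hlt'⟩ := Choice.glue_pair hst hl₁ hl₂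
        refine ⟨l, hl, ?_⟩
        rw [← add_assoc, ← block_union (b := b + k) (by omega) (by omega),
          (h l hl).mul _ _ (block_nonempty hs (by omega)) (block_nonempty hs (by omega)) hst,
          hloc l l₁ _ hls, hloc l l₂ _ hlt', h₁, h₂]
    rintro ⟨x, y, hx, hy, rfl⟩
    obtain ⟨k, hk, hx⟩ := key x hx
    obtain ⟨m, hm, hy⟩ := key y hy
    let q : ℕ → ℕ := fun i => k + i * m
    have hq : StrictMono q := strictMono_nat_of_lt_succ fun i => by
      simp only [q, add_mul]; omega
    have hq0 : q 0 = k := by simp [q]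
    have hqs : ∀ i, q (i + 1) = q i + m := fun i => by simp only [q]; ring
    -- The cut `0` is put in front of `q`: the first block is to have value `x`, all later ones `y`.
    let q' : ℕ → ℕ := fun i => Nat.casesOn i 0 q
    have hq' : StrictMono q' := strictMono_nat_of_lt_succ fun i => by
      cases i with
      | zero => change 0 < q 0; omega
      | succ i => exact hq (Nat.lt_succ_self i)
    have hch : ∀ i, ∃ l, Choice E l ∧ ev l (block s (q' i) (q' (i + 1))) = if i = 0 then x else y := by
      intro i
      cases i with
      | zero =>
        change ∃ l, Choice E l ∧ ev l (block s 0 (q 0)) = x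
        rw [hq0, ← Nat.zero_add k]; exact hx 0
      | succ i =>
        change ∃ l, Choice E l ∧ ev l (block s (q i) (q (i + 1))) = y
        rw [hqs]; exact hy _
    choose l hl hlv using hch
    obtain ⟨l', hl', hloc'⟩ := Choice.glue (fun i => block s (q' i) (q' (i + 1)))
      (fun i j hij => block_lt hlt _ _ _ _ (hq'.monotone hij)) hE l hl
    have hval : ∀ i, ev l' (block s (q' i) (q' (i + 1))) = if i = 0 then x else y := fun i => by
      rw [hloc l' (l i) _ (hloc' i), hlv]
    refine ⟨l', hl', ?_⟩
    have h0 : ev l' (block s 0 (q 0)) = x := hval 0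
    rw [((h l' hl').blocks hs hlt hq (by omega) (e := y) fun i => hval (i + 1)).2, h0]

theorem powAlg_isEval [Countable P] (hE : ∃ l, Choice E l)
    (h : ∀ l, Choice E l → IsEval A (ev l)) (hloc : LocalEv ev) :
    IsEval (powAlg A) (powEv A.n E ev) where
  lt s := mask_lt _ _
  mul s t hs ht hst := by
    refine mask_congr fun a _ => ?_
    constructor
    · rintro ⟨l, hl, rfl⟩
      exact ⟨ev l s, ev l t, (powEv_testBit h).2 ⟨l, hl, rfl⟩, (powEv_testBit h).2 ⟨l, hl, rfl⟩,
        ((h l hl).mul s t hs ht hst).symm⟩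
    · rintro ⟨x, y, hx, hy, rfl⟩
      obtain ⟨l₁, hl₁, rfl⟩ := (powEv_testBit h).1 hx
      obtain ⟨l₂, hl₂, rfl⟩ := (powEv_testBit h).1 hy
      obtain ⟨l, hl, hls, hlt'⟩ := Choice.glue_pair hst hl₁ hl₂
      refine ⟨l, hl, ?_⟩
      rw [(h l hl).mul s t hs ht hst, hloc l l₁ _ hls, hloc l l₂ _ hlt']
  om X s hs hlt hX := powEv_om hE h hloc X s hs hlt hX
  os X s hs hlt hX := by
    refine (powEv_om (P := Pᵒᵈ) (A := A.op) (E := E)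
      (ev := fun l t => ev l (OrderDual.toDual ⁻¹' t)) hE (fun l hl => (h l hl).op)
      (fun l l' t ht => hloc l l' _ ht) X (fun i => OrderDual.ofDual ⁻¹' s i) hs
      (fun i j hij x hx y hy => hlt i j hij y hy x hx) hX).trans ?_
    refine mask_congr fun a _ => ?_
    simp only [SGen.op_iff]
    rfl
  sh I _ _ _ _ _ _ s hs hlt hd := by
    let X : I → ℕ := fun i => powEv A.n E ev (s i)
    have hbit : ∀ Y, (mask (powAlg A).n fun a => ∃ i, X i = a).testBit Y = true ↔
        ∃ i, X i = Y := by
      intro Y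
      rw [testBit_mask]
      constructor
      · exact fun h => h.2
      · rintro ⟨i, rfl⟩; exact ⟨mask_lt _ _, i, rfl⟩
    have hMlt : (mask (powAlg A).n fun a => ∃ i, X i = a) < 2 ^ 2 ^ A.n := mask_lt _ _
    change _ = (powAlg A).sh (mask (powAlg A).n fun a => ∃ i, X i = a)
    generalize (mask (powAlg A).n fun a => ∃ i, X i = a) = M at hbit hMlt
    refine mask_congr fun a _ => ?_
    constructor
    · rintro ⟨l, hl, rfl⟩
      -- The index order is read as a word whose letters pair the chosen value of a part with its
      -- set of possible values; its shuffle component evaluates to `1`.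
      have h1 := ((h l hl).family s hs hlt).prod (shufAlg_isEval (c := X) hMlt).tab
      have h2 := h1.cl_univ (G := shufGen M) fun i => by
        refine ⟨X i, ev l (s i), (hbit _).2 ⟨i, rfl⟩, (powEv_testBit h).2 ⟨l, hl, rfl⟩, ?_⟩
        rw [shufEv_singleton ((hbit _).2 ⟨i, rfl⟩)]
        simp
      rw [shufEv_univ_of_shuffled hd hbit] at h2
      simpa using h2
    · intro hcl
      -- The realizing word is evaluated twice. Its shuffle component, evaluated on `W` itself,
      -- shows that `W` is coloured as the shuffle of `M`, hence isomorphic to `I`. Its component in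
      -- `A` is then evaluated on the parts `s i`, matched with the letters through this
      -- isomorphism.
      obtain ⟨W, _, _, _, g, hg, hW⟩ := hcl.realized
      choose Y x hY hx hgx using hg
      have hsing : ∀ w, shufEv M Y {w} = 5 + Y w := fun w => shufEv_singleton (hY w)
      have h1 := hW W _ _ (shufEv M Y) (prodAlg_isHom_snd _ _) (shufAlg_isEval hMlt).tab
        (fun w => {w}) (fun w => Set.singleton_nonempty w)
        (fun v w hvw => by rintro _ rfl _ rfl; exact hvw)
        (fun w => by rw [hsing, hgx]; simp)
      rw [Set.iUnion_of_singleton] at h1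
      simp only [Nat.unpair_pair] at h1
      obtain ⟨_, _, _, hsh, hcol⟩ := shuffled_of_shufEv_univ h1
      obtain ⟨e, he⟩ := Shuffled.exists_iso (c := X) (d := Y) hd hsh
        (fun i => (hcol _).1 ((hbit _).2 ⟨i, rfl⟩)) (fun w => (hbit _).1 (hY w))
      have hch : ∀ i, ∃ l, Choice E l ∧ ev l (s i) = x (e i) := fun i => by
        refine (powEv_testBit h).1 ?_
        change (X i).testBit _ = true
        rw [← he i]; exact hx _
      choose l hl hlv using hch
      obtain ⟨l', hl', hll⟩ := Choice.glue s hlt hE l hl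
      refine ⟨l', hl', ?_⟩
      have h2 := hW P _ _ (ev l') (prodAlg_isHom_fst _ _) (h l' hl') (fun w => s (e.symm w))
        (fun w => hs _) (fun v w hvw => hlt _ _ (e.symm.lt_iff_lt.2 hvw))
        (fun w => by
          rw [hloc l' (l (e.symm w)) _ (hll _), hlv, hgx, e.apply_symm_apply]; simp)
      simp only [Nat.unpair_pair] at h2
      rw [← h2]
      congr 1
      exact (e.symm.toEquiv.iSup_congr (g := s) fun w => rfl).symm

end Power

/-! ### Recognizers -/

/-- A recognizer: tables of an algebra, the value of the empty word, the table of the values of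
the letters, and the bit mask of the accepted values. -/
abbrev Recognizer : Type := AlgTab × ℕ × List ℕ × ℕ

/-- Properties of labelled linear orders, where letters are bit masks. -/
abbrev WordProp : Type 1 := ∀ (P : Type) [LinearOrder P], (P → ℕ) → Prop

/-- The recognizer decides the property of words over the letters below `2 ^ m`. -/
def Recognizes (m : ℕ) (R : Recognizer) (Q : WordProp) : Prop :=
  ∀ (P : Type) [LinearOrder P] [Countable P], ∃ ev : (P → ℕ) → Set P → ℕ, LocalEv ev ∧
    (∀ l, (∀ p, l p < 2 ^ m) → IsEval R.1.alg (ev l)) ∧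
    (∀ l p, l p < 2 ^ m → ev l {p} = R.2.2.1.getD (l p) 0) ∧
    (∀ l, ev l ∅ = R.2.1) ∧
    ∀ l, (∀ p, l p < 2 ^ m) → (R.2.2.2.testBit (ev l Set.univ) = true ↔ Q P l)

/-- Complementation. -/
noncomputable def recNeg (R : Recognizer) : Recognizer :=
  (R.1, R.2.1, R.2.2.1, mask R.1.1 fun x => ¬ R.2.2.2.testBit x = true)

theorem Recognizes.neg {m : ℕ} {R : Recognizer} {Q : WordProp} (h : Recognizes m R Q) :
    Recognizes m (recNeg R) fun P _ l => ¬ Q P l := by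
  intro P _ _
  obtain ⟨ev, h1, h2, h3, h4, h5⟩ := h P
  refine ⟨ev, h1, h2, h3, h4, fun l hl => ?_⟩
  simp only [recNeg, testBit_mask, ← h5 l hl]
  exact ⟨fun h => h.2, fun h => ⟨(h2 l hl).lt _, h⟩⟩

/-- Intersection. -/
noncomputable def recAnd (m : ℕ) (R S : Recognizer) : Recognizer :=
  ((prodAlg R.1.alg S.1.alg).tab, Nat.pair R.2.1 S.2.1,
    tabulate (2 ^ m) fun c => Nat.pair (R.2.2.1.getD c 0) (S.2.2.1.getD c 0),
    mask ((R.1.1 + S.1.1) ^ 2) fun x =>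
      R.2.2.2.testBit x.unpair.1 = true ∧ S.2.2.2.testBit x.unpair.2 = true)

theorem Recognizes.and {m : ℕ} {R S : Recognizer} {Q Q' : WordProp} (h : Recognizes m R Q)
    (h' : Recognizes m S Q') : Recognizes m (recAnd m R S) fun P _ l => Q P l ∧ Q' P l := by
  intro P _ _
  obtain ⟨ev, h1, h2, h3, h4, h5⟩ := h P
  obtain ⟨ev', h1', h2', h3', h4', h5'⟩ := h' P
  refine ⟨fun l s => Nat.pair (ev l s) (ev' l s), fun l l' s hl => ?_,
    fun l hl => ((h2 l hl).prod (h2' l hl)).tab, fun l p hl => ?_, fun l => ?_, fun l hl => ?_⟩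
  · simp only [h1 l l' s hl, h1' l l' s hl]
  · simp only [h3 l p hl, h3' l p hl, recAnd]
    rw [getD_tabulate _ hl]
  · simp only [h4, h4', recAnd]
  · simp only [recAnd, testBit_mask, Nat.unpair_pair, ← h5 l hl, ← h5' l hl]
    exact ⟨fun h => h.2, fun h => ⟨pair_lt_prod ((h2 l hl).lt _) ((h2' l hl).lt _), h⟩⟩

/-- The letters `c` and `d` with tracks below `m` differ at most at track `t`. -/
def SameBut (m t c d : ℕ) : Prop := ∀ j < m, j ≠ t → d.testBit j = c.testBit j

/-- Projection along track `t`. -/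
noncomputable def recEx (m t : ℕ) (R : Recognizer) : Recognizer :=
  ((powAlg R.1.alg).tab, mask R.1.1 fun a => R.2.1 = a,
    tabulate (2 ^ m) fun c => mask R.1.1 fun a =>
      ∃ d < 2 ^ m, SameBut m t c d ∧ R.2.2.1.getD d 0 = a,
    mask (2 ^ R.1.1) fun X => ∃ a < R.1.1, X.testBit a = true ∧ R.2.2.2.testBit a = true)

/-- The projection of a property along track `t`. -/
def WordProp.ex (m t : ℕ) (Q : WordProp) : WordProp := fun P _ l =>
  ∃ l' : P → ℕ, (∀ p, l' p < 2 ^ m ∧ SameBut m t (l p) (l' p)) ∧ Q P l'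

theorem Recognizes.ex {m t : ℕ} {R : Recognizer} {Q : WordProp} (h : Recognizes m R Q) :
    Recognizes m (recEx m t R) (Q.ex m t) := by
  intro P _ _
  obtain ⟨ev, h1, h2, h3, h4, h5⟩ := h P
  let E : (P → ℕ) → P → ℕ → Prop := fun l p c => c < 2 ^ m ∧ SameBut m t (l p) c
  have hE : ∀ l, ∃ l', Choice (E l) l' := fun l => by
    -- The labels are arbitrary here; reduction modulo `2 ^ m` retains precisely the tracks below
    -- `m`.
    refine ⟨fun p => l p % 2 ^ m, fun p => ⟨Nat.mod_lt _ (by positivity), fun j hj _ => ?_⟩⟩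
    simp [Nat.testBit_mod_two_pow, hj]
  have hEv : ∀ l l', Choice (E l) l' → IsEval R.1.alg (ev l') := fun l l' hl' =>
    h2 l' fun p => (hl' p).1
  -- Locality of the set of values: outside `s` any admissible labelling may be substituted.
  have transfer : ∀ l l₂ s, (∀ p ∈ s, l p = l₂ p) → ∀ a,
      (∃ l', Choice (E l) l' ∧ ev l' s = a) → ∃ l', Choice (E l₂) l' ∧ ev l' s = a := by
    classical
    rintro l l₂ s hs a ⟨l', hl', rfl⟩
    obtain ⟨l₀, hl₀⟩ := hE l₂
    refine ⟨fun p => if p ∈ s then l' p else l₀ p, fun p => ?_, h1 _ _ _ fun p hp => if_pos hp⟩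
    by_cases hp : p ∈ s
    · simp only [if_pos hp, E, ← hs p hp]; exact hl' p
    · simp only [if_neg hp]; exact hl₀ p
  refine ⟨fun l s => powEv R.1.1 (E l) ev s, fun l l₂ s hs => ?_,
    fun l hl => (powAlg_isEval (hE l) (hEv l) h1).tab, fun l p hl => ?_, fun l => ?_,
    fun l hl => ?_⟩
  · exact mask_congr fun a _ => ⟨transfer l l₂ s hs a, transfer l₂ l s (fun p hp => (hs p hp).symm) a⟩
  · simp only [recEx]
    rw [getD_tabulate _ hl]
    refine mask_congr fun a _ => ?_
    constructor
    · rintro ⟨l', hl', rfl⟩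
      exact ⟨l' p, (hl' p).1, (hl' p).2, (h3 l' p (hl' p).1).symm⟩
    · rintro ⟨d, hd, hsame, rfl⟩
      classical
      obtain ⟨l₀, hl₀⟩ := hE l
      refine ⟨Function.update l₀ p d, fun q => ?_, ?_⟩
      · by_cases hq : q = p
        · subst hq; simp only [Function.update_self]; exact ⟨hd, hsame⟩
        · simp only [Function.update_of_ne hq]; exact hl₀ q
      · rw [h3 _ p (by simpa using hd), Function.update_self]
  · refine mask_congr fun a _ => ?_
    simp only [h4]
    constructor
    · rintro ⟨_, _, h⟩; exact h
    · intro h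
      obtain ⟨l₀, hl₀⟩ := hE l
      exact ⟨l₀, hl₀, h⟩
  · simp only [recEx, testBit_mask]
    constructor
    · rintro ⟨-, a, -, ha, hacc⟩
      obtain ⟨l', hl', rfl⟩ := (powEv_testBit (A := R.1.alg) (hEv l)).1 ha
      exact ⟨l', hl', (h5 l' fun p => (hl' p).1).1 hacc⟩
    · rintro ⟨l', hl', hQ⟩
      have hlt := (hEv l l' hl').lt Set.univ
      exact ⟨mask_lt _ _, _, hlt, (powEv_testBit (A := R.1.alg) (hEv l)).2 ⟨l', hl', rfl⟩,
        (h5 l' fun p => (hl' p).1).2 hQ⟩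

/-! ### Recognizers of atomic properties -/

/-- The algebra for atomic properties of two tracks. The digits of an element tell whether the
first and the second track occur, whether a position of the first precedes one of the second, and
whether the two tracks meet. -/
noncomputable def atomAlg : CircAlg where
  n := 2 ^ 4
  mul x y := mask 4 fun i => (x.testBit i = true ∨ y.testBit i = true) ∨
    (i = 2 ∧ x.testBit 0 = true ∧ y.testBit 1 = true)
  om x := mask 4 fun i => x.testBit i = true ∨
    (i = 2 ∧ x.testBit 0 = true ∧ x.testBit 1 = true)
  os x := mask 4 fun i => x.testBit i = true ∨
    (i = 2 ∧ x.testBit 0 = true ∧ x.testBit 1 = true)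
  sh m := mask 4 fun i => (∃ x, m.testBit x = true ∧ x.testBit i = true) ∨
    (i = 2 ∧ (∃ x, m.testBit x = true ∧ x.testBit 0 = true) ∧
      ∃ x, m.testBit x = true ∧ x.testBit 1 = true)

/-- The digits of the value of a letter in `atomAlg`. -/
def AtomBit (s t i c : ℕ) : Prop :=
  (i = 0 ∧ c.testBit s = true) ∨ (i = 1 ∧ c.testBit t = true) ∨
    (i = 3 ∧ c.testBit s = true ∧ c.testBit t = true)

/-- The value of a word in `atomAlg`. -/
noncomputable def atomEv {P : Type} [LinearOrder P] (s t : ℕ) (l : P → ℕ) (J : Set P) : ℕ :=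
  mask 4 fun i => (∃ p ∈ J, AtomBit s t i (l p)) ∨
    (i = 2 ∧ ∃ p ∈ J, ∃ q ∈ J, p < q ∧ (l p).testBit s = true ∧ (l q).testBit t = true)

section Atom

variable {P : Type} [LinearOrder P] {s t : ℕ} {l : P → ℕ}

theorem atomEv_testBit_zero {J : Set P} :
    (atomEv s t l J).testBit 0 = true ↔ ∃ p ∈ J, (l p).testBit s = true := by
  rw [atomEv, testBit_mask]; simp [AtomBit]

theorem atomEv_testBit_one {J : Set P} :
    (atomEv s t l J).testBit 1 = true ↔ ∃ p ∈ J, (l p).testBit t = true := by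
  simp [atomEv, testBit_mask, AtomBit]

theorem atomEv_testBit_two {J : Set P} : (atomEv s t l J).testBit 2 = true ↔
    ∃ p ∈ J, ∃ q ∈ J, p < q ∧ (l p).testBit s = true ∧ (l q).testBit t = true := by
  simp [atomEv, testBit_mask, AtomBit]

theorem atomEv_testBit_three {J : Set P} : (atomEv s t l J).testBit 3 = true ↔
    ∃ p ∈ J, (l p).testBit s = true ∧ (l p).testBit t = true := by
  simp [atomEv, testBit_mask, AtomBit]

/-- Two positions in order lie in one part or in two parts in order. This single formula yields all
four operations of `atomAlg`. -/
theorem atomEv_iUnion {I : Type} [LinearOrder I] {J : I → Set P}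
    (hlt : ∀ i j, i < j → SetLT (J i) (J j)) : atomEv s t l (⋃ i, J i) = mask 4 fun k =>
      (∃ i, (atomEv s t l (J i)).testBit k = true) ∨
      (k = 2 ∧ ∃ i j, i < j ∧ (atomEv s t l (J i)).testBit 0 = true ∧
        (atomEv s t l (J j)).testBit 1 = true) := by
  refine mask_congr fun k hk => ?_
  simp only [atomEv_testBit_zero, atomEv_testBit_one]
  simp only [atomEv, testBit_mask]
  constructor
  · rintro (⟨p, hp, hpk⟩ | ⟨rfl, p, hp, q, hq, hpq, h1, h2⟩)
    · obtain ⟨i, hp⟩ := Set.mem_iUnion.1 hp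
      exact Or.inl ⟨i, hk, Or.inl ⟨p, hp, hpk⟩⟩
    · obtain ⟨i, hp⟩ := Set.mem_iUnion.1 hp
      obtain ⟨j, hq⟩ := Set.mem_iUnion.1 hq
      rcases lt_trichotomy i j with hij | rfl | hij
      · exact Or.inr ⟨rfl, i, j, hij, ⟨p, hp, h1⟩, q, hq, h2⟩
      · exact Or.inl ⟨i, hk, Or.inr ⟨rfl, p, hp, q, hq, hpq, h1, h2⟩⟩
      · exact absurd (hlt j i hij q hq p hp) (not_lt.2 hpq.le)
  · rintro (⟨i, -, ⟨p, hp, hpk⟩ | ⟨rfl, p, hp, q, hq, h⟩⟩ | ⟨rfl, i, j, hij, ⟨p, hp, h1⟩, q, hq, h2⟩)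
    · exact Or.inl ⟨p, Set.mem_iUnion.2 ⟨i, hp⟩, hpk⟩
    · exact Or.inr ⟨rfl, p, Set.mem_iUnion.2 ⟨i, hp⟩, q, Set.mem_iUnion.2 ⟨i, hq⟩, h⟩
    · exact Or.inr ⟨rfl, p, Set.mem_iUnion.2 ⟨i, hp⟩, q, Set.mem_iUnion.2 ⟨j, hq⟩,
        hlt i j hij p hp q hq, h1, h2⟩

theorem atomAlg_isEval : IsEval atomAlg (atomEv s t l) where
  lt J := mask_lt _ _
  mul J K _ _ hJK := by
    have hu : J ∪ K = ⋃ b : Bool, if b then K else J := by ext p; simp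
    rw [hu, atomEv_iUnion (by
      rintro (_ | _) (_ | _) hij <;> first | exact absurd hij (by decide) | exact hJK)]
    refine mask_congr fun k _ => or_congr (by simp) (and_congr_right fun _ => ?_)
    constructor
    · rintro ⟨_ | _, _ | _, hij, h⟩ <;> first | exact absurd hij (by decide) | exact h
    · exact fun h => ⟨false, true, by decide, h⟩
  om a J _ hlt ha := by
    rw [atomEv_iUnion hlt]
    refine mask_congr fun k _ => ?_
    simp only [ha, exists_const]
    refine or_congr Iff.rfl (and_congr_right fun _ => ⟨?_, fun h => ⟨0, 1, by decide, h⟩⟩)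
    rintro ⟨_, _, _, h⟩; exact h
  os a J _ hlt ha := by
    have := atomEv_iUnion (s := s) (t := t) (l := l) (I := ℕᵒᵈ)
      (J := fun i => J (OrderDual.ofDual i)) fun i j hij => hlt _ _ hij
    refine this.trans (mask_congr fun k _ => ?_)
    simp only [ha, exists_const]
    refine or_congr Iff.rfl (and_congr_right fun _ =>
      ⟨?_, fun h => ⟨OrderDual.toDual 1, OrderDual.toDual 0, Nat.one_pos, h⟩⟩)
    rintro ⟨_, _, _, h⟩; exact h
  sh I _ _ _ _ _ _ J _ hlt hd := by
    rw [atomEv_iUnion hlt]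
    have hbit : ∀ x, (mask atomAlg.n fun a => ∃ i, atomEv s t l (J i) = a).testBit x = true ↔
        ∃ i, atomEv s t l (J i) = x := by
      intro x
      rw [testBit_mask]
      constructor
      · exact fun h => h.2
      · rintro ⟨i, rfl⟩; exact ⟨mask_lt _ _, i, rfl⟩
    have hex : ∀ k, (∃ x, (mask atomAlg.n fun a => ∃ i, atomEv s t l (J i) = a).testBit x = true ∧
        x.testBit k = true) ↔ ∃ i, (atomEv s t l (J i)).testBit k = true := by
      intro k
      constructor
      · rintro ⟨x, hx, hk⟩
        obtain ⟨i, rfl⟩ := (hbit x).1 hx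
        exact ⟨i, hk⟩
      · rintro ⟨i, hk⟩; exact ⟨_, (hbit _).2 ⟨i, rfl⟩, hk⟩
    refine mask_congr fun k _ => ?_
    rw [hex, hex, hex]
    refine or_congr Iff.rfl (and_congr_right fun _ => ⟨?_, ?_⟩)
    · rintro ⟨i, j, -, h1, h2⟩; exact ⟨⟨i, h1⟩, j, h2⟩
    -- The parts `i` and `j` may come in the wrong order, but the value of part `j` recurs after
    -- `i`.
    · rintro ⟨⟨i, h1⟩, j, h2⟩
      obtain ⟨k, hk⟩ := exists_gt i
      obtain ⟨m, hm, -, hmj⟩ := hd i k j hk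
      exact ⟨i, m, hm, h1, by rw [hmj]; exact h2⟩

end Atom

/-- The recognizer of an atomic property of tracks `s` and `t`. -/
noncomputable def recAtom (m s t acc : ℕ) : Recognizer :=
  (atomAlg.tab, 0, tabulate (2 ^ m) fun c => mask 4 fun i => AtomBit s t i c, acc)

/-- Accepted values: the tracks meet. -/
noncomputable def accMeet : ℕ := mask (2 ^ 4) fun x => x.testBit 3 = true

/-- Accepted values: a position of the first track is below or equal to one of the second. -/
noncomputable def accLe : ℕ := mask (2 ^ 4) fun x => x.testBit 2 = true ∨ x.testBit 3 = true

/-- Accepted values: the tracks meet, but no position of the first precedes one of the second. -/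
noncomputable def accSing : ℕ := mask (2 ^ 4) fun x => x.testBit 3 = true ∧ ¬ x.testBit 2 = true

theorem recAtom_recognizes {m s t acc : ℕ} {Q : WordProp}
    (hQ : ∀ (P : Type) [LinearOrder P] (l : P → ℕ),
      acc.testBit (atomEv s t l Set.univ) = true ↔ Q P l) : Recognizes m (recAtom m s t acc) Q := by
  intro P _ _
  refine ⟨atomEv s t, fun l l' J hl => ?_, fun l _ => atomAlg_isEval.tab, fun l p hl => ?_,
    fun l => ?_, fun l _ => hQ P l⟩
  · refine mask_congr fun i _ => or_congr ?_ (and_congr_right fun _ => ?_)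
    · refine exists_congr fun p => and_congr_right fun hp => ?_
      rw [hl p hp]
    · refine exists_congr fun p => and_congr_right fun hp => exists_congr fun q =>
        and_congr_right fun hq => ?_
      rw [hl p hp, hl q hq]
  · simp only [recAtom]
    rw [getD_tabulate _ hl]
    refine mask_congr fun i _ => ?_
    constructor
    · rintro (⟨q, rfl, h⟩ | ⟨rfl, q, rfl, r, rfl, h, -⟩)
      · exact h
      · exact (lt_irrefl _ h).elim
    · intro h; exact Or.inl ⟨p, rfl, h⟩
  · exact mask_eq_of_testBit (by simp [recAtom]) fun i _ => by simp [recAtom]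

/-- Tracks `s` and `t` meet. -/
def WordProp.meet (s t : ℕ) : WordProp := fun P _ l =>
  ∃ p : P, (l p).testBit s = true ∧ (l p).testBit t = true

/-- A position of track `s` is below or equal to one of track `t`. -/
def WordProp.le (s t : ℕ) : WordProp := fun P _ l =>
  ∃ p q : P, p ≤ q ∧ (l p).testBit s = true ∧ (l q).testBit t = true

/-- Track `s` has exactly one position. -/
def WordProp.sing (s : ℕ) : WordProp := fun P _ l => ∃! p : P, (l p).testBit s = true

theorem recognizes_meet (m s t : ℕ) :
    Recognizes m (recAtom m s t accMeet) (WordProp.meet s t) := by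
  refine recAtom_recognizes fun P _ l => ?_
  rw [accMeet, testBit_mask, atomEv_testBit_three]
  simp only [Set.mem_univ, true_and]
  exact ⟨fun h => h.2, fun h => ⟨mask_lt _ _, h⟩⟩

theorem recognizes_le (m s t : ℕ) : Recognizes m (recAtom m s t accLe) (WordProp.le s t) := by
  refine recAtom_recognizes fun P _ l => ?_
  rw [accLe, testBit_mask, atomEv_testBit_three, atomEv_testBit_two]
  simp only [Set.mem_univ, true_and]
  constructor
  · rintro ⟨-, ⟨p, q, hpq, h⟩ | ⟨p, h⟩⟩
    · exact ⟨p, q, hpq.le, h⟩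
    · exact ⟨p, p, le_rfl, h⟩
  · rintro ⟨p, q, hpq, h⟩
    refine ⟨mask_lt _ _, ?_⟩
    rcases hpq.eq_or_lt with rfl | hlt
    · exact Or.inr ⟨p, h⟩
    · exact Or.inl ⟨p, q, hlt, h⟩

theorem recognizes_sing (m s : ℕ) : Recognizes m (recAtom m s s accSing) (WordProp.sing s) := by
  refine recAtom_recognizes fun P _ l => ?_
  rw [accSing, testBit_mask, atomEv_testBit_three, atomEv_testBit_two]
  simp only [Set.mem_univ, true_and, and_self]
  constructor
  · rintro ⟨-, ⟨p, hp⟩, hno⟩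
    refine ⟨p, hp, fun q hq => ?_⟩
    rcases lt_trichotomy p q with h | h | h
    · exact (hno ⟨p, q, h, hp, hq⟩).elim
    · exact h.symm
    · exact (hno ⟨q, p, h, hq, hp⟩).elim
  · rintro ⟨p, hp, hu⟩
    refine ⟨mask_lt _ _, ⟨p, hp⟩, ?_⟩
    rintro ⟨q, r, hqr, hq, hr⟩
    rw [hu q hq, hu r hr] at hqr
    exact lt_irrefl _ hqr

/-! ### Recognizers of formulas -/

/-- The recognizer of a formula. An element variable `x` is represented by track `3 * x`, a set
variable `X` by track `3 * X + 1`, and a letter `a` by track `3 * a + 2`. -/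
noncomputable def recOf (m : ℕ) : MSOFormula → Recognizer
  | .le x y => recAtom m (3 * x) (3 * y) accLe
  | .eq x y => recAtom m (3 * x) (3 * y) accMeet
  | .lab a x => recAtom m (3 * a + 2) (3 * x) accMeet
  | .mem x X => recAtom m (3 * x) (3 * X + 1) accMeet
  | .neg φ => recNeg (recOf m φ)
  | .conj φ ψ => recAnd m (recOf m φ) (recOf m ψ)
  | .disj φ ψ => recNeg (recAnd m (recNeg (recOf m φ)) (recNeg (recOf m ψ)))
  -- An element quantifier is a set quantifier restricted to tracks with exactly one position.
  | .exElem x φ => recEx m (3 * x) (recAnd m (recAtom m (3 * x) (3 * x) accSing) (recOf m φ))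
  | .allElem x φ =>
    recNeg (recEx m (3 * x) (recAnd m (recAtom m (3 * x) (3 * x) accSing) (recNeg (recOf m φ))))
  | .exSet X φ => recEx m (3 * X + 1) (recOf m φ)
  | .allSet X φ => recNeg (recEx m (3 * X + 1) (recNeg (recOf m φ)))

/-- The property of words over tracks expressed by a formula. -/
def trackSat (m : ℕ) : MSOFormula → WordProp
  | .le x y => WordProp.le (3 * x) (3 * y)
  | .eq x y => WordProp.meet (3 * x) (3 * y)
  | .lab a x => WordProp.meet (3 * a + 2) (3 * x)
  | .mem x X => WordProp.meet (3 * x) (3 * X + 1)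
  | .neg φ => fun P _ l => ¬ trackSat m φ P l
  | .conj φ ψ => fun P _ l => trackSat m φ P l ∧ trackSat m ψ P l
  | .disj φ ψ => fun P _ l => ¬ (¬ trackSat m φ P l ∧ ¬ trackSat m ψ P l)
  | .exElem x φ =>
    WordProp.ex m (3 * x) fun P _ l => WordProp.sing (3 * x) P l ∧ trackSat m φ P l
  | .allElem x φ => fun P _ l =>
    ¬ WordProp.ex m (3 * x) (fun P _ l => WordProp.sing (3 * x) P l ∧ ¬ trackSat m φ P l) P l
  | .exSet X φ => WordProp.ex m (3 * X + 1) (trackSat m φ)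
  | .allSet X φ => fun P _ l =>
    ¬ WordProp.ex m (3 * X + 1) (fun P _ l => ¬ trackSat m φ P l) P l

theorem recOf_recognizes (m : ℕ) (φ : MSOFormula) : Recognizes m (recOf m φ) (trackSat m φ) := by
  induction φ with
  | le x y => exact recognizes_le m _ _
  | eq x y => exact recognizes_meet m _ _
  | lab a x => exact recognizes_meet m _ _
  | mem x X => exact recognizes_meet m _ _
  | neg φ ih => exact ih.neg
  | conj φ ψ ih₁ ih₂ => exact ih₁.and ih₂
  | disj φ ψ ih₁ ih₂ => exact (ih₁.neg.and ih₂.neg).neg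
  | exElem x φ ih => exact ((recognizes_sing m (3 * x)).and ih).ex
  | allElem x φ ih => exact (((recognizes_sing m (3 * x)).and ih.neg).ex).neg
  | exSet X φ ih => exact ih.ex
  | allSet X φ ih => exact ih.neg.ex.neg

/-- The labelling `l` of the positions by bit masks represents a labelled order together with
values of variables. -/
structure Represents {n : ℕ} (m : ℕ) (w : CountableLabelledOrder (Fin n)) (l : w.Pos → ℕ)
    (v : ℕ → Option w.Pos) (V : ℕ → Set w.Pos) : Prop where
  -- A variable without a value becomes an empty track, on which atomic formulas fail just as in
  -- `Sat`.
  elem : ∀ x, 3 * x < m → ∀ p, (l p).testBit (3 * x) = true ↔ v x = some p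
  set : ∀ X, 3 * X + 1 < m → ∀ p, (l p).testBit (3 * X + 1) = true ↔ p ∈ V X
  lab : ∀ a, 3 * a + 2 < m → ∀ p, (l p).testBit (3 * a + 2) = true ↔ (w.label p : ℕ) = a

section Represents

variable {n m : ℕ} {w : CountableLabelledOrder (Fin n)} {l : w.Pos → ℕ}
  {v : ℕ → Option w.Pos} {V : ℕ → Set w.Pos}

theorem Represents.of_sameBut_elem (h : Represents m w l v V) {x : ℕ} (hx : 3 * x < m)
    {l' : w.Pos → ℕ} (hs : ∀ p, SameBut m (3 * x) (l p) (l' p)) {q : w.Pos}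
    (hq : ∀ p, (l' p).testBit (3 * x) = true ↔ p = q) :
    Represents m w l' (Function.update v x (some q)) V where
  elem y hy p := by
    by_cases hxy : y = x
    · subst hxy
      rw [hq, Function.update_self, Option.some_inj, eq_comm]
    · rw [hs p _ hy (by omega), h.elem y hy, Function.update_of_ne hxy]
  set X hX p := by rw [hs p _ hX (by omega), h.set X hX]
  lab a ha p := by rw [hs p _ ha (by omega), h.lab a ha]

theorem Represents.of_sameBut_set (h : Represents m w l v V) {X : ℕ}
    {l' : w.Pos → ℕ} (hs : ∀ p, SameBut m (3 * X + 1) (l p) (l' p)) {S : Set w.Pos}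
    (hS : ∀ p, (l' p).testBit (3 * X + 1) = true ↔ p ∈ S) :
    Represents m w l' v (Function.update V X S) where
  elem y hy p := by rw [hs p _ hy (by omega), h.elem y hy]
  set Y hY p := by
    by_cases hXY : Y = X
    · subst hXY; rw [hS, Function.update_self]
    · rw [hs p _ hY (by omega), h.set Y hY, Function.update_of_ne hXY]
  lab a ha p := by rw [hs p _ ha (by omega), h.lab a ha]

theorem exists_sameBut (m t : ℕ) (ht : t < m) {P : Type} (l : P → ℕ) (S : P → Prop) :
    ∃ l' : P → ℕ, (∀ p, l' p < 2 ^ m ∧ SameBut m t (l p) (l' p)) ∧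
      ∀ p, (l' p).testBit t = true ↔ S p := by
  refine ⟨fun p => mask m fun j => (j ≠ t ∧ (l p).testBit j = true) ∨ (j = t ∧ S p),
    fun p => ⟨mask_lt _ _, fun j hj hjt => ?_⟩, fun p => ?_⟩
  · rw [Bool.eq_iff_iff, testBit_mask]; simp [hj, hjt]
  · rw [testBit_mask]; simp [ht]

/-- `Q` and `R` are left abstract so that the universal quantifier can use the statement for the
negated formula. -/
theorem Represents.ex_elem (h : Represents m w l v V) {x : ℕ} (hx : 3 * x < m) {Q : WordProp}
    {R : (ℕ → Option w.Pos) → Prop}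
    (hQ : ∀ l' v', Represents m w l' v' V → (Q w.Pos l' ↔ R v')) :
    WordProp.ex m (3 * x) (fun P _ l => WordProp.sing (3 * x) P l ∧ Q P l) w.Pos l ↔
      ∃ p : w.Pos, R (Function.update v x (some p)) := by
  constructor
  · rintro ⟨l', hl', ⟨q, hq, hu⟩, hQl⟩
    refine ⟨q, (hQ l' _ (h.of_sameBut_elem hx (fun p => (hl' p).2) fun p => ⟨hu p, ?_⟩)).1 hQl⟩
    rintro rfl; exact hq
  · rintro ⟨q, hR⟩
    obtain ⟨l', hl', hq⟩ := exists_sameBut m (3 * x) hx l (fun p => p = q)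
    exact ⟨l', hl', ⟨q, (hq q).2 rfl, fun p hp => (hq p).1 hp⟩,
      (hQ l' _ (h.of_sameBut_elem hx (fun p => (hl' p).2) hq)).2 hR⟩

theorem Represents.ex_set (h : Represents m w l v V) {X : ℕ} (hX : 3 * X + 1 < m) {Q : WordProp}
    {R : (ℕ → Set w.Pos) → Prop}
    (hQ : ∀ l' V', Represents m w l' v V' → (Q w.Pos l' ↔ R V')) :
    WordProp.ex m (3 * X + 1) Q w.Pos l ↔ ∃ S : Set w.Pos, R (Function.update V X S) := by
  constructor
  · rintro ⟨l', hl', hQl⟩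
    exact ⟨{p | (l' p).testBit (3 * X + 1) = true},
      (hQ l' _ (h.of_sameBut_set (fun p => (hl' p).2) fun p => Iff.rfl)).1 hQl⟩
  · rintro ⟨S, hR⟩
    obtain ⟨l', hl', hS⟩ := exists_sameBut m (3 * X + 1) hX l (fun p => p ∈ S)
    exact ⟨l', hl', (hQ l' _ (h.of_sameBut_set (fun p => (hl' p).2) hS)).2 hR⟩

end Represents

/-- Variables and letters of a formula are bounded by its Gödel number, so `hm` leaves room for all
their tracks and passes to subformulas. -/
theorem trackSat_iff {n m : ℕ} {w : CountableLabelledOrder (Fin n)} (φ : MSOFormula)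
    (hm : 3 * φ.toNat + 2 < m) : ∀ (l : w.Pos → ℕ) (v : ℕ → Option w.Pos) (V : ℕ → Set w.Pos),
      Represents m w l v V → (trackSat m φ w.Pos l ↔ w.Sat v V φ) := by
  induction φ with
  | le x y =>
    intro l v V h
    have := Nat.left_le_pair x y
    have := Nat.right_le_pair x y
    rw [MSOFormula.toNat] at hm
    simp only [trackSat, WordProp.le, CountableLabelledOrder.Sat, h.elem x (by omega),
      h.elem y (by omega)]
    exact exists_congr fun p => exists_congr fun q => by tauto
  | eq x y =>
    intro l v V h
    have := Nat.left_le_pair x y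
    have := Nat.right_le_pair x y
    rw [MSOFormula.toNat] at hm
    simp only [trackSat, WordProp.meet, CountableLabelledOrder.Sat, h.elem x (by omega),
      h.elem y (by omega)]
    exact exists_congr fun p => ⟨fun h => ⟨p, h.1, h.2, rfl⟩, by rintro ⟨q, h1, h2, rfl⟩; exact ⟨h1, h2⟩⟩
  | lab a x =>
    intro l v V h
    have := Nat.left_le_pair a x
    have := Nat.right_le_pair a x
    rw [MSOFormula.toNat] at hm
    simp only [trackSat, WordProp.meet, CountableLabelledOrder.Sat, h.elem x (by omega),
      h.lab a (by omega)]
    exact exists_congr fun p => and_comm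
  | mem x X =>
    intro l v V h
    have := Nat.left_le_pair x X
    have := Nat.right_le_pair x X
    rw [MSOFormula.toNat] at hm
    simp only [trackSat, WordProp.meet, CountableLabelledOrder.Sat, h.elem x (by omega),
      h.set X (by omega)]
  | neg φ ih =>
    intro l v V h
    rw [MSOFormula.toNat] at hm
    simp only [trackSat, CountableLabelledOrder.Sat, ih (by omega) l v V h]
  | conj φ ψ ih₁ ih₂ =>
    intro l v V h
    have := Nat.left_le_pair φ.toNat ψ.toNat
    have := Nat.right_le_pair φ.toNat ψ.toNat
    rw [MSOFormula.toNat] at hm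
    simp only [trackSat, CountableLabelledOrder.Sat, ih₁ (by omega) l v V h,
      ih₂ (by omega) l v V h]
  | disj φ ψ ih₁ ih₂ =>
    intro l v V h
    have := Nat.left_le_pair φ.toNat ψ.toNat
    have := Nat.right_le_pair φ.toNat ψ.toNat
    rw [MSOFormula.toNat] at hm
    simp only [trackSat, CountableLabelledOrder.Sat, ih₁ (by omega) l v V h,
      ih₂ (by omega) l v V h]
    tauto
  | exElem x φ ih =>
    intro l v V h
    have := Nat.left_le_pair x φ.toNat
    have := Nat.right_le_pair x φ.toNat
    rw [MSOFormula.toNat] at hm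
    exact h.ex_elem (by omega) fun l' v' h' => ih (by omega) l' v' V h'
  | allElem x φ ih =>
    intro l v V h
    have := Nat.left_le_pair x φ.toNat
    have := Nat.right_le_pair x φ.toNat
    rw [MSOFormula.toNat] at hm
    simp only [trackSat, CountableLabelledOrder.Sat]
    rw [h.ex_elem (by omega) fun l' v' h' => not_congr (ih (by omega) l' v' V h')]
    push Not
    rfl
  | exSet X φ ih =>
    intro l v V h
    have := Nat.left_le_pair X φ.toNat
    have := Nat.right_le_pair X φ.toNat
    rw [MSOFormula.toNat] at hm
    exact h.ex_set (by omega) fun l' V' h' => ih (by omega) l' v V' h'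
  | allSet X φ ih =>
    intro l v V h
    have := Nat.left_le_pair X φ.toNat
    have := Nat.right_le_pair X φ.toNat
    rw [MSOFormula.toNat] at hm
    simp only [trackSat, CountableLabelledOrder.Sat]
    rw [h.ex_set (by omega) (R := fun V' => ¬ w.Sat v V' φ)
      fun l' V' h' => not_congr (ih (by omega) l' v V' h')]
    push Not
    rfl

/-! ### Nonemptiness of the language -/

/-- The letters of words over the `n`-letter alphabet, as values of the recognizer. -/
def letterGen (R : Recognizer) (n x : ℕ) : Prop := ∃ a < n, R.2.2.1.getD (2 ^ (3 * a + 2)) 0 = x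

theorem represents_sentence {n m : ℕ} (w : CountableLabelledOrder (Fin n)) :
    Represents m w (fun p => 2 ^ (3 * (w.label p : ℕ) + 2)) (fun _ => none) fun _ => ∅ where
  elem x _ p := by
    simp only [Nat.testBit_two_pow, reduceCtorEq, iff_false]
    simp only [decide_eq_true_eq]; omega
  set X _ p := by
    simp only [Nat.testBit_two_pow, Set.mem_empty_iff_false, iff_false, decide_eq_true_eq]
    omega
  lab a _ p := by
    simp only [Nat.testBit_two_pow, decide_eq_true_eq]
    omega

theorem CircAlg.isHom_id (A : CircAlg) : A.IsHom A fun x => x where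
  mul _ _ := rfl
  om _ := rfl
  os _ := rfl
  sh m hm := by
    rw [mask_eq_of_testBit hm fun i _ => ⟨?_, fun h => ⟨i, h, rfl⟩⟩]
    rintro ⟨a, ha, rfl⟩; exact ha

/-- A nonempty model has a generated value by `cl_univ`; an accepted generated value has a realizing
word by `Cl.realized`, used with the identity homomorphism, and its letters label the model. The
empty word is separate because closures only describe nonempty words. -/
theorem exists_models_iff {n m : ℕ} (φ : MSOFormula) (hm : 3 * φ.toNat + 2 < m)
    (hn : 3 * n ≤ m) : (∃ w : CountableLabelledOrder (Fin n), w.Models φ) ↔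
      (recOf m φ).2.2.2.testBit (recOf m φ).2.1 = true ∨
      ∃ x < (recOf m φ).1.1, (recOf m φ).2.2.2.testBit x = true ∧
        Cl (recOf m φ).1.alg (letterGen (recOf m φ) n) x := by
  have hrec := recOf_recognizes m φ
  generalize recOf m φ = R at hrec
  have hlt : ∀ {w : CountableLabelledOrder (Fin n)} (p : w.Pos),
      2 ^ (3 * (w.label p : ℕ) + 2) < 2 ^ m := fun p =>
    Nat.pow_lt_pow_right (by norm_num) (by have := (CountableLabelledOrder.label _ p).2; omega)
  constructor
  · rintro ⟨w, hw⟩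
    obtain ⟨ev, h1, h2, h3, h4, h5⟩ := hrec w.Pos
    have hmod := (h5 _ fun p => hlt p).2 ((trackSat_iff φ hm _ _ _ (represents_sentence w)).2 hw)
    rcases isEmpty_or_nonempty w.Pos with he | hne
    · left
      rw [Set.eq_empty_of_isEmpty Set.univ, h4] at hmod
      exact hmod
    · right
      have hev := h2 _ fun p : w.Pos => hlt p
      refine ⟨_, hev.lt _, hmod, hev.cl_univ fun p => ⟨w.label p, (w.label p).2, ?_⟩⟩
      rw [h3 _ _ (hlt p)]
  · rintro (h | ⟨x, -, hacc, hcl⟩)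
    · let w : CountableLabelledOrder (Fin n) := ⟨Empty, fun p => p.elim⟩
      obtain ⟨ev, h1, h2, h3, h4, h5⟩ := hrec w.Pos
      refine ⟨w, (trackSat_iff φ hm _ _ _ (represents_sentence w)).1 ((h5 _ fun p => hlt p).1 ?_)⟩
      have he : IsEmpty w.Pos := inferInstanceAs (IsEmpty Empty)
      rw [Set.eq_empty_of_isEmpty Set.univ, h4]
      exact h
    · obtain ⟨W, _, _, _, g, hg, hW⟩ := hcl.realized
      choose a ha hga using hg
      let w : CountableLabelledOrder (Fin n) := ⟨W, fun p => ⟨a p, ha p⟩⟩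
      obtain ⟨ev, h1, h2, h3, h4, h5⟩ := hrec w.Pos
      refine ⟨w, (trackSat_iff φ hm _ _ _ (represents_sentence w)).1 ((h5 _ fun p => hlt p).1 ?_)⟩
      have := hW w.Pos _ _ _ (CircAlg.isHom_id _) (h2 _ fun p => hlt p) (fun p => {p})
        (fun p => Set.singleton_nonempty p) (fun p q hpq => by rintro _ rfl _ rfl; exact hpq)
        (fun p => by rw [h3 _ _ (hlt (w := w) p)]; exact hga p)
      rw [Set.iUnion_of_singleton] at this
      rw [this]
      exact hacc

/-! ### Primitive recursive functions -/

attribute [fun_prop] Primrec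

attribute [local irreducible] Primrec

namespace Primrec

variable {α β γ σ : Type} [Primcodable α] [Primcodable β] [Primcodable γ] [Primcodable σ]

@[fun_prop]
theorem id_fun : Primrec (fun a : α => a) := Primrec.id

@[fun_prop]
theorem const_fun (b : β) : Primrec (fun _ : α => b) := Primrec.const b

@[fun_prop]
theorem comp_fun {f : β → γ} {g : α → β} (hf : Primrec f) (hg : Primrec g) :
    Primrec (fun a => f (g a)) := hf.comp hg

@[fun_prop]
theorem fst_fun {f : α → β × γ} (hf : Primrec f) : Primrec (fun a => (f a).1) :=
  Primrec.fst.comp hf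

@[fun_prop]
theorem snd_fun {f : α → β × γ} (hf : Primrec f) : Primrec (fun a => (f a).2) :=
  Primrec.snd.comp hf

@[fun_prop]
theorem pair_fun {f : α → β} {g : α → γ} (hf : Primrec f) (hg : Primrec g) :
    Primrec (fun a => (f a, g a)) := Primrec.pair hf hg

@[fun_prop]
theorem add_fun {f g : α → ℕ} (hf : Primrec f) (hg : Primrec g) : Primrec (fun a => f a + g a) :=
  Primrec.nat_add.comp hf hg

@[fun_prop]
theorem mul_fun {f g : α → ℕ} (hf : Primrec f) (hg : Primrec g) : Primrec (fun a => f a * g a) :=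
  Primrec.nat_mul.comp hf hg

@[fun_prop]
theorem div_fun {f g : α → ℕ} (hf : Primrec f) (hg : Primrec g) : Primrec (fun a => f a / g a) :=
  Primrec.nat_div.comp hf hg

@[fun_prop]
theorem mod_fun {f g : α → ℕ} (hf : Primrec f) (hg : Primrec g) : Primrec (fun a => f a % g a) :=
  Primrec.nat_mod.comp hf hg

@[fun_prop]
theorem pow_fun {f g : α → ℕ} (hf : Primrec f) (hg : Primrec g) : Primrec (fun a => f a ^ g a) :=
  (Primrec₂.unpaired'.1 Nat.Primrec.pow).comp hf hg

@[fun_prop]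
theorem natPair_fun {f g : α → ℕ} (hf : Primrec f) (hg : Primrec g) :
    Primrec (fun a => Nat.pair (f a) (g a)) :=
  Primrec₂.natPair.comp hf hg

@[fun_prop]
theorem unpair_fun {f : α → ℕ} (hf : Primrec f) : Primrec (fun a => (f a).unpair) :=
  Primrec.unpair.comp hf

@[fun_prop]
theorem not_fun {f : α → Bool} (hf : Primrec f) : Primrec (fun a => !(f a)) :=
  Primrec.not.comp hf

@[fun_prop]
theorem and_fun {f g : α → Bool} (hf : Primrec f) (hg : Primrec g) :
    Primrec (fun a => f a && g a) :=
  Primrec.and.comp hf hg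

@[fun_prop]
theorem or_fun {f g : α → Bool} (hf : Primrec f) (hg : Primrec g) :
    Primrec (fun a => f a || g a) :=
  Primrec.or.comp hf hg

@[fun_prop]
theorem decide_eq_fun {f g : α → ℕ} (hf : Primrec f) (hg : Primrec g) :
    Primrec (fun a => decide (f a = g a)) :=
  Primrec.eq.decide.comp hf hg

@[fun_prop]
theorem decide_lt_fun {f g : α → ℕ} (hf : Primrec f) (hg : Primrec g) :
    Primrec (fun a => decide (f a < g a)) :=
  Primrec.nat_lt.decide.comp hf hg

@[fun_prop]
theorem decide_le_fun {f g : α → ℕ} (hf : Primrec f) (hg : Primrec g) :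
    Primrec (fun a => decide (f a ≤ g a)) :=
  Primrec.nat_le.decide.comp hf hg

@[fun_prop]
theorem cond_fun {c : α → Bool} {f g : α → σ} (hc : Primrec c) (hf : Primrec f)
    (hg : Primrec g) : Primrec (fun a => _root_.cond (c a) (f a) (g a)) :=
  Primrec.cond hc hf hg

@[fun_prop]
theorem testBit_fun {f g : α → ℕ} (hf : Primrec f) (hg : Primrec g) :
    Primrec (fun a => (f a).testBit (g a)) := by
  simp only [Nat.testBit_eq_decide_div_mod_eq]
  fun_prop

@[fun_prop]
theorem length_fun {f : α → List σ} (hf : Primrec f) : Primrec (fun a => (f a).length) :=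
  Primrec.list_length.comp hf

@[fun_prop]
theorem getD_fun {f : α → List σ} {g : α → ℕ} (d : σ) (hf : Primrec f) (hg : Primrec g) :
    Primrec (fun a => (f a).getD (g a) d) :=
  (Primrec.list_getD d).comp hf hg

@[fun_prop]
theorem tabulate_fun {f : α → ℕ} {g : α → ℕ → ℕ} (hf : Primrec f)
    (hg : Primrec (fun x : α × ℕ => g x.1 x.2)) : Primrec (fun a => tabulate (f a) (g a)) :=
  Primrec.list_map (Primrec.list_range.comp hf) hg

@[fun_prop]
theorem bitMask_fun {f : α → ℕ} {g : α → ℕ → Bool} (hf : Primrec f)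
    (hg : Primrec (fun x : α × ℕ => g x.1 x.2)) : Primrec (fun a => bitMask (f a) (g a)) := by
  have h : Primrec₂ fun (a : α) (q : ℕ × ℕ) => q.2 + _root_.cond (g a q.1) (2 ^ q.1) 0 := by
    have h1 : Primrec fun x : α × ℕ × ℕ => g x.1 x.2.1 :=
      hg.comp (Primrec.pair Primrec.fst (Primrec.fst.comp Primrec.snd))
    change Primrec fun x : α × ℕ × ℕ => x.2.2 + _root_.cond (g x.1 x.2.1) (2 ^ x.2.1) 0
    fun_prop
  refine (Primrec.nat_rec' hf (Primrec.const 0) h).of_eq fun a => ?_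
  induction f a with
  | zero => rfl
  | succ n ih =>
    rw [bitMask, ← ih]
    change _ + _ = _ + _
    cases g a n <;> rfl

end Primrec

/-- Bounded universal quantification. -/
def allLt : ℕ → (ℕ → Bool) → Bool
  | 0, _ => true
  | n + 1, p => allLt n p && p n

theorem allLt_iff {n : ℕ} {p : ℕ → Bool} : allLt n p = true ↔ ∀ i < n, p i = true := by
  induction n with
  | zero => simp [allLt]
  | succ n ih =>
    rw [allLt, Bool.and_eq_true, ih]
    constructor
    · rintro ⟨h1, h2⟩ i hi
      rcases Nat.lt_succ_iff_lt_or_eq.1 hi with hi | rfl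
      · exact h1 i hi
      · exact h2
    · intro h; exact ⟨fun i hi => h i (by omega), h n (by omega)⟩

/-- Bounded existential quantification. -/
def anyLt (n : ℕ) (p : ℕ → Bool) : Bool := !allLt n fun i => !p i

theorem anyLt_iff {n : ℕ} {p : ℕ → Bool} : anyLt n p = true ↔ ∃ i < n, p i = true := by
  rw [anyLt, Bool.not_eq_true', ← Bool.not_eq_true, allLt_iff]
  push Not
  simp

section

variable {α : Type} [Primcodable α]

@[fun_prop]
theorem Primrec.allLt_fun {f : α → ℕ} {g : α → ℕ → Bool} (hf : Primrec f)
    (hg : Primrec (fun x : α × ℕ => g x.1 x.2)) : Primrec (fun a => allLt (f a) (g a)) := by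
  have h : Primrec₂ fun (a : α) (q : ℕ × Bool) => q.2 && g a q.1 := by
    have h1 : Primrec fun x : α × ℕ × Bool => g x.1 x.2.1 :=
      hg.comp (Primrec.pair Primrec.fst (Primrec.fst.comp Primrec.snd))
    change Primrec fun x : α × ℕ × Bool => x.2.2 && g x.1 x.2.1
    fun_prop
  refine (Primrec.nat_rec' hf (Primrec.const true) h).of_eq fun a => ?_
  induction f a with
  | zero => rfl
  | succ n ih => rw [allLt, ← ih]

@[fun_prop]
theorem Primrec.anyLt_fun {f : α → ℕ} {g : α → ℕ → Bool} (hf : Primrec f)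
    (hg : Primrec (fun x : α × ℕ => g x.1 x.2)) : Primrec (fun a => anyLt (f a) (g a)) := by
  unfold anyLt; fun_prop

end

/-! ### Computing with tables -/

namespace AlgTab

/-- Product in a table. -/
def mul (T : AlgTab) (x y : ℕ) : ℕ := T.2.1.getD (x * T.1 + y) 0

/-- `ω`-power in a table. -/
def om (T : AlgTab) (x : ℕ) : ℕ := T.2.2.1.getD x 0

/-- `ω*`-power in a table. -/
def os (T : AlgTab) (x : ℕ) : ℕ := T.2.2.2.1.getD x 0

/-- Shuffle in a table. -/
def sh (T : AlgTab) (x : ℕ) : ℕ := T.2.2.2.2.getD x 0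

/-- Decides membership in a generated subsemigroup. -/
def sgen (T : AlgTab) (G x : ℕ) : Bool :=
  -- The generated set is the intersection of all closed sets, and subsets are masks `K` below `2 ^
  -- T.1`; bounded quantification thus replaces iteration to a fixed point.
  allLt (2 ^ T.1) fun K =>
    !((allLt T.1 fun g => !G.testBit g || K.testBit g) &&
      (allLt T.1 fun a => allLt T.1 fun b => !K.testBit a || (!K.testBit b ||
        (!decide (T.mul a b < T.1) || K.testBit (T.mul a b))))) || K.testBit x

/-- Decides membership in a generated subalgebra. -/
def cl (T : AlgTab) (G : ℕ → Bool) (x : ℕ) : Bool :=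
  allLt (2 ^ T.1) fun K =>
    !((allLt T.1 fun g => !G g || K.testBit g) &&
      ((allLt T.1 fun a => allLt T.1 fun b => !K.testBit a || (!K.testBit b ||
        (!decide (T.mul a b < T.1) || K.testBit (T.mul a b)))) &&
      ((allLt T.1 fun a => !K.testBit a || (!decide (T.om a < T.1) || K.testBit (T.om a))) &&
      ((allLt T.1 fun a => !K.testBit a || (!decide (T.os a < T.1) || K.testBit (T.os a))) &&
      (allLt (2 ^ T.1) fun m => !decide (0 < m) ||
        (!(allLt T.1 fun a => !m.testBit a || K.testBit a) ||
        (!decide (T.sh m < T.1) || K.testBit (T.sh m)))))))) || K.testBit x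

theorem not_or_iff_imp {a b : Bool} : (!a || b) = true ↔ (a = true → b = true) := by
  cases a <;> simp

/-- One direction tests the mask of the generated subsemigroup, itself a closed set; the other is
its minimality. -/
theorem sgen_iff {T : AlgTab} {G x : ℕ} :
    T.sgen G x = true ↔ SGen T.alg (fun i => G.testBit i = true) x := by
  simp only [sgen, allLt_iff, not_or_iff_imp, Bool.and_eq_true, decide_eq_true_eq]
  constructor
  · intro h
    refine (testBit_mask.1 (h (mask T.1 (SGen T.alg fun i => G.testBit i = true)) (mask_lt _ _)
      ⟨fun g hg hG => ?_, fun a _ b _ h1 h2 h3 => ?_⟩)).2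
    · exact testBit_mask.2 ⟨hg, SGen.gen (A := T.alg) g hg hG⟩
    · rw [testBit_mask] at h1 h2 ⊢
      exact ⟨h3, SGen.mul (A := T.alg) a b h1.2 h2.2 h3⟩
  · rintro h K - ⟨h1, h2⟩
    exact (SGen.closed (A := T.alg) (K := fun x => x < T.1 ∧ K.testBit x = true)
      (fun g hg hG => ⟨hg, h1 g hg hG⟩)
      (fun a b ha hb hlt => ⟨hlt, h2 a ha.1 b hb.1 ha.2 hb.2 hlt⟩) h).2

theorem cl_iff {T : AlgTab} {G : ℕ → Bool} {x : ℕ} :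
    T.cl G x = true ↔ Cl T.alg (fun i => G i = true) x := by
  simp only [cl, allLt_iff, not_or_iff_imp, Bool.and_eq_true, decide_eq_true_eq]
  constructor
  · intro h
    refine (testBit_mask.1 (h (mask T.1 (Cl T.alg fun i => G i = true)) (mask_lt _ _)
      ⟨fun g hg hG => ?_, fun a _ b _ h1 h2 h3 => ?_, fun a _ h1 h2 => ?_, fun a _ h1 h2 => ?_,
        fun m hm h0 h1 h2 => ?_⟩)).2
    · exact testBit_mask.2 ⟨hg, Cl.gen (A := T.alg) g hg hG⟩
    · rw [testBit_mask] at h1 h2 ⊢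
      exact ⟨h3, Cl.mul (A := T.alg) a b h1.2 h2.2 h3⟩
    · rw [testBit_mask] at h1 ⊢
      exact ⟨h2, Cl.om (A := T.alg) a h1.2 h2⟩
    · rw [testBit_mask] at h1 ⊢
      exact ⟨h2, Cl.os (A := T.alg) a h1.2 h2⟩
    · rw [testBit_mask]
      exact ⟨h2, Cl.sh (A := T.alg) m h0.ne' hm
        (fun i hi => (testBit_mask.1 (h1 i (lt_of_testBit hm hi) hi)).2) h2⟩
  · rintro h K - ⟨h1, h2, h3, h4, h5⟩
    induction h with
    | gen g hg hG => exact h1 g hg hG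
    | mul a b ha hb hlt iha ihb => exact h2 a ha.lt b hb.lt iha ihb hlt
    | om a ha hlt iha => exact h3 a ha.lt iha hlt
    | os a ha hlt iha => exact h4 a ha.lt iha hlt
    | sh m hm0 hm hi hlt ih =>
      exact h5 m hm (Nat.pos_of_ne_zero hm0) (fun a _ ha => ih a ha) hlt

/-- Tables of the product algebra. -/
def prod (T S : AlgTab) : AlgTab :=
  ((T.1 + S.1) ^ 2,
    tabulate ((T.1 + S.1) ^ 2 * (T.1 + S.1) ^ 2) fun i =>
      Nat.pair (T.mul (i / (T.1 + S.1) ^ 2).unpair.1 (i % (T.1 + S.1) ^ 2).unpair.1)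
        (S.mul (i / (T.1 + S.1) ^ 2).unpair.2 (i % (T.1 + S.1) ^ 2).unpair.2),
    tabulate ((T.1 + S.1) ^ 2) fun x => Nat.pair (T.om x.unpair.1) (S.om x.unpair.2),
    tabulate ((T.1 + S.1) ^ 2) fun x => Nat.pair (T.os x.unpair.1) (S.os x.unpair.2),
    tabulate (2 ^ (T.1 + S.1) ^ 2) fun m => Nat.pair
      (T.sh (bitMask T.1 fun a => anyLt ((T.1 + S.1) ^ 2) fun x =>
        m.testBit x && decide (x.unpair.1 = a)))
      (S.sh (bitMask S.1 fun a => anyLt ((T.1 + S.1) ^ 2) fun x =>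
        m.testBit x && decide (x.unpair.2 = a))))

/-- The unbounded quantifiers in `prodAlg` can be bounded, since the digits of a mask `m` lie below
the size of the algebra. -/
theorem prod_eq (T S : AlgTab) : T.prod S = (prodAlg T.alg S.alg).tab := by
  refine Prod.ext rfl (Prod.ext rfl (Prod.ext rfl (Prod.ext rfl (tabulate_congr fun m hm => ?_))))
  simp only [prodAlg]
  congr 2
  · refine bitMask_eq_mask fun a _ => ?_
    simp only [anyLt_iff, Bool.and_eq_true, decide_eq_true_eq]
    exact ⟨fun ⟨x, _, h⟩ => ⟨x, h⟩, fun ⟨x, h⟩ => ⟨x, lt_of_testBit hm h.1, h⟩⟩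
  · refine bitMask_eq_mask fun a _ => ?_
    simp only [anyLt_iff, Bool.and_eq_true, decide_eq_true_eq]
    exact ⟨fun ⟨x, _, h⟩ => ⟨x, h⟩, fun ⟨x, h⟩ => ⟨x, lt_of_testBit hm h.1, h⟩⟩

/-- `shufCode` as a conditional expression. -/
def shufCodeB (a b : Bool) : ℕ := 1 + cond a 1 0 + cond b 2 0

/-- Tables of the shuffle algebra. -/
def shuf (N M : ℕ) : AlgTab :=
  (5 + N,
    tabulate ((5 + N) * (5 + N)) fun i =>
      cond (decide (i / (5 + N) = 0) || decide (i % (5 + N) = 0) ||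
        (shufMax (i / (5 + N)) && shufMin (i % (5 + N)))) 0
        (shufCodeB (shufMin (i / (5 + N))) (shufMax (i % (5 + N)))),
    tabulate (5 + N) fun x => cond (decide (x = 0) || (shufMax x && shufMin x)) 0
      (shufCodeB (shufMin x) false),
    tabulate (5 + N) fun x => cond (decide (x = 0) || (shufMax x && shufMin x)) 0
      (shufCodeB false (shufMax x)),
    tabulate (2 ^ (5 + N)) fun m => cond (m.testBit 0) 0
      (cond ((anyLt 5 fun i => m.testBit i) ||
        (allLt N fun X => !M.testBit X || m.testBit (5 + X))) 1 0))

theorem shufCodeB_eq (a b : Bool) : shufCodeB a b = shufCode a b := by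
  cases a <;> cases b <;> rfl

theorem shuf_eq (N M : ℕ) : shuf N M = (shufAlg N M).tab := by
  refine Prod.ext rfl (Prod.ext ?_ (Prod.ext ?_ (Prod.ext ?_ ?_)))
  · refine tabulate_congr fun i _ => ?_
    simp [shufAlg, shufCodeB_eq, Bool.cond_eq_ite, or_assoc]
  · refine tabulate_congr fun i _ => ?_
    simp [shufAlg, shufCodeB_eq, Bool.cond_eq_ite]
  · refine tabulate_congr fun i _ => ?_
    simp [shufAlg, shufCodeB_eq, Bool.cond_eq_ite]
  · refine tabulate_congr fun m _ => ?_
    simp only [shufAlg, Bool.cond_eq_ite, Bool.or_eq_true (anyLt _ _), anyLt_iff, allLt_iff,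
      not_or_iff_imp]
    congr

end AlgTab

/-! ### Tables of the power algebra, and primitive recursiveness of the operations on tables. -/

namespace AlgTab

/-- `shufGen` for algebras with `n` elements, as a Boolean. -/
def shufGenB (n M z : ℕ) : Bool :=
  anyLt (2 ^ n) fun X => anyLt n fun x =>
    M.testBit X && (X.testBit x && decide (z = Nat.pair x (5 + X)))

theorem shufGenB_iff {n M z : ℕ} (hM : M < 2 ^ 2 ^ n) : shufGenB n M z = true ↔ shufGen M z := by
  simp only [shufGenB, anyLt_iff, Bool.and_eq_true, decide_eq_true_eq, shufGen]
  constructor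
  · rintro ⟨X, -, x, -, h⟩; exact ⟨X, x, h⟩
  · rintro ⟨X, x, h⟩
    have hX := lt_of_testBit hM h.1
    exact ⟨X, hX, x, lt_of_testBit hX h.2.1, h⟩

/-- Decides membership in a shuffle in the power algebra. -/
def powSh (T : AlgTab) (M a : ℕ) : Bool :=
  (T.prod (shuf (2 ^ T.1) M)).cl (shufGenB T.1 M) (Nat.pair a 1)

/-- Decides membership in a product in the power algebra. -/
def powMul (T : AlgTab) (X Y a : ℕ) : Bool :=
  anyLt T.1 fun x => anyLt T.1 fun y => X.testBit x && (Y.testBit y && decide (T.mul x y = a))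

/-- Decides membership in an `ω`-power in the power algebra. -/
def powOm (T : AlgTab) (X a : ℕ) : Bool :=
  anyLt T.1 fun x => anyLt T.1 fun y =>
    T.sgen X x && (T.sgen X y && decide (T.mul x (T.om y) = a))

/-- Decides membership in an `ω*`-power in the power algebra. -/
def powOs (T : AlgTab) (X a : ℕ) : Bool :=
  anyLt T.1 fun x => anyLt T.1 fun y =>
    T.sgen X x && (T.sgen X y && decide (T.mul (T.os y) x = a))

/-- Tables of the power algebra. -/
def pow (T : AlgTab) : AlgTab :=
  (2 ^ T.1,
    tabulate (2 ^ T.1 * 2 ^ T.1) fun i => bitMask T.1 fun a =>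
      T.powMul (i / 2 ^ T.1) (i % 2 ^ T.1) a,
    tabulate (2 ^ T.1) fun X => bitMask T.1 fun a => T.powOm X a,
    tabulate (2 ^ T.1) fun X => bitMask T.1 fun a => T.powOs X a,
    tabulate (2 ^ 2 ^ T.1) fun M => bitMask T.1 fun a => T.powSh M a)

/-- Bounding the quantifiers loses nothing, as generated elements and digits of masks are in range.
For shuffles, the closure is computed in the tables of the product with the shuffle algebra, and
`Cl.tab_iff` leads back to the product itself. -/
theorem pow_eq (T : AlgTab) : T.pow = (powAlg T.alg).tab := by
  refine Prod.ext rfl (Prod.ext ?_ (Prod.ext ?_ (Prod.ext ?_ ?_)))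
  · refine tabulate_congr fun i hi => bitMask_eq_mask fun a _ => ?_
    have hpos : 0 < 2 ^ T.1 := by positivity
    have h1 : i / 2 ^ T.1 < 2 ^ T.1 := Nat.div_lt_of_lt_mul hi
    have h2 : i % 2 ^ T.1 < 2 ^ T.1 := Nat.mod_lt _ hpos
    simp only [powMul, anyLt_iff, Bool.and_eq_true, decide_eq_true_eq]
    constructor
    · rintro ⟨x, -, y, -, h⟩; exact ⟨x, y, h⟩
    · rintro ⟨x, y, h⟩; exact ⟨x, lt_of_testBit h1 h.1, y, lt_of_testBit h2 h.2.1, h⟩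
  · refine tabulate_congr fun i hi => bitMask_eq_mask fun a _ => ?_
    simp only [powOm, anyLt_iff, Bool.and_eq_true, decide_eq_true_eq, sgen_iff]
    constructor
    · rintro ⟨x, -, y, -, h⟩; exact ⟨x, y, h⟩
    · rintro ⟨x, y, h⟩; exact ⟨x, h.1.lt, y, h.2.1.lt, h⟩
  · refine tabulate_congr fun i hi => bitMask_eq_mask fun a _ => ?_
    simp only [powOs, anyLt_iff, Bool.and_eq_true, decide_eq_true_eq, sgen_iff]
    constructor
    · rintro ⟨x, -, y, -, h⟩; exact ⟨x, y, h⟩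
    · rintro ⟨x, y, h⟩; exact ⟨x, h.1.lt, y, h.2.1.lt, h⟩
  · refine tabulate_congr fun M hM => bitMask_eq_mask fun a _ => ?_
    rw [powSh, cl_iff, shuf_eq, prod_eq, Cl.tab_iff]
    simp only [shufGenB_iff hM]
    rfl

section

variable {α : Type} [Primcodable α]

@[fun_prop]
theorem mul_primrec {T : α → AlgTab} {x y : α → ℕ} (hT : Primrec T) (hx : Primrec x)
    (hy : Primrec y) : Primrec fun a => (T a).mul (x a) (y a) := by
  unfold mul; fun_prop

@[fun_prop]
theorem om_primrec {T : α → AlgTab} {x : α → ℕ} (hT : Primrec T) (hx : Primrec x) :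
    Primrec fun a => (T a).om (x a) := by
  unfold om; fun_prop

@[fun_prop]
theorem os_primrec {T : α → AlgTab} {x : α → ℕ} (hT : Primrec T) (hx : Primrec x) :
    Primrec fun a => (T a).os (x a) := by
  unfold os; fun_prop

@[fun_prop]
theorem sh_primrec {T : α → AlgTab} {x : α → ℕ} (hT : Primrec T) (hx : Primrec x) :
    Primrec fun a => (T a).sh (x a) := by
  unfold sh; fun_prop

@[fun_prop]
theorem sgen_primrec {T : α → AlgTab} {x y : α → ℕ} (hT : Primrec T) (hx : Primrec x)
    (hy : Primrec y) : Primrec fun a => (T a).sgen (x a) (y a) := by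
  unfold sgen; fun_prop

@[fun_prop]
theorem cl_primrec {T : α → AlgTab} {G : α → ℕ → Bool} {x : α → ℕ} (hT : Primrec T)
    (hG : Primrec fun p : α × ℕ => G p.1 p.2) (hx : Primrec x) :
    Primrec fun a => (T a).cl (G a) (x a) := by
  have hG' : Primrec fun p : (α × ℕ) × ℕ => G p.1.1 p.2 :=
    hG.comp (f := fun p : α × ℕ => G p.1 p.2) (g := fun p : (α × ℕ) × ℕ => (p.1.1, p.2))
      (by fun_prop)
  unfold cl; fun_prop

@[fun_prop]
theorem prod_primrec {T S : α → AlgTab} (hT : Primrec T) (hS : Primrec S) :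
    Primrec fun a => (T a).prod (S a) := by
  unfold prod; fun_prop

@[fun_prop]
theorem shufMin_primrec {x : α → ℕ} (hx : Primrec x) : Primrec fun a => shufMin (x a) := by
  unfold shufMin; fun_prop

@[fun_prop]
theorem shufMax_primrec {x : α → ℕ} (hx : Primrec x) : Primrec fun a => shufMax (x a) := by
  unfold shufMax; fun_prop

@[fun_prop]
theorem shufCodeB_primrec {x y : α → Bool} (hx : Primrec x) (hy : Primrec y) :
    Primrec fun a => shufCodeB (x a) (y a) := by
  unfold shufCodeB; fun_prop

@[fun_prop]
theorem shuf_primrec {x y : α → ℕ} (hx : Primrec x) (hy : Primrec y) :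
    Primrec fun a => shuf (x a) (y a) := by
  unfold shuf; fun_prop

@[fun_prop]
theorem powMul_primrec {T : α → AlgTab} {x y z : α → ℕ} (hT : Primrec T) (hx : Primrec x) (hy : Primrec y) (hz : Primrec z) :
    Primrec fun a => (T a).powMul (x a) (y a) (z a) := by
  unfold powMul; fun_prop

@[fun_prop]
theorem powOm_primrec {T : α → AlgTab} {x y : α → ℕ} (hT : Primrec T) (hx : Primrec x) (hy : Primrec y) :
    Primrec fun a => (T a).powOm (x a) (y a) := by
  unfold powOm; fun_prop

@[fun_prop]
theorem powOs_primrec {T : α → AlgTab} {x y : α → ℕ} (hT : Primrec T) (hx : Primrec x) (hy : Primrec y) :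
    Primrec fun a => (T a).powOs (x a) (y a) := by
  unfold powOs; fun_prop

@[fun_prop]
theorem shufGenB_primrec {n x y : α → ℕ} (hn : Primrec n) (hx : Primrec x) (hy : Primrec y) :
    Primrec fun a => shufGenB (n a) (x a) (y a) := by
  unfold shufGenB; fun_prop

@[fun_prop]
theorem powSh_primrec {T : α → AlgTab} {x y : α → ℕ} (hT : Primrec T) (hx : Primrec x)
    (hy : Primrec y) : Primrec fun a => (T a).powSh (x a) (y a) := by
  unfold powSh; fun_prop

@[fun_prop]
theorem pow_primrec {T : α → AlgTab} (hT : Primrec T) : Primrec fun a => (T a).pow := by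
  unfold pow; fun_prop

end

end AlgTab

/-! ### Computing with recognizers -/

section

variable {α : Type} [Primcodable α]

-- The constructions on recognizers use classical masks; each is shown equal to a version with
-- Boolean tests and bounded search.
@[fun_prop]
theorem recNeg_primrec {R : α → Recognizer} (hR : Primrec R) : Primrec fun a => recNeg (R a) := by
  have h : Primrec fun a => ((R a).1, (R a).2.1, (R a).2.2.1,
      bitMask (R a).1.1 fun x => !(R a).2.2.2.testBit x) := by fun_prop
  refine h.of_eq fun a => ?_
  rw [recNeg, bitMask_eq_mask (p := fun x => ¬ (R a).2.2.2.testBit x = true) fun i _ => by simp]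

@[fun_prop]
theorem recAnd_primrec {m : α → ℕ} {R S : α → Recognizer} (hm : Primrec m) (hR : Primrec R)
    (hS : Primrec S) : Primrec fun a => recAnd (m a) (R a) (S a) := by
  have h : Primrec fun a => ((R a).1.prod (S a).1, Nat.pair (R a).2.1 (S a).2.1,
      tabulate (2 ^ m a) fun c => Nat.pair ((R a).2.2.1.getD c 0) ((S a).2.2.1.getD c 0),
      bitMask (((R a).1.1 + (S a).1.1) ^ 2) fun x =>
        (R a).2.2.2.testBit x.unpair.1 && (S a).2.2.2.testBit x.unpair.2) := by fun_prop
  refine h.of_eq fun a => ?_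
  rw [recAnd, AlgTab.prod_eq, bitMask_eq_mask (p := fun x =>
    (R a).2.2.2.testBit x.unpair.1 = true ∧ (S a).2.2.2.testBit x.unpair.2 = true)
    fun i _ => by simp]

/-- `SameBut` as a Boolean. -/
def sameBut (m t c d : ℕ) : Bool :=
  allLt m fun j => decide (j = t) || cond (c.testBit j) (d.testBit j) (!d.testBit j)

theorem sameBut_iff {m t c d : ℕ} : sameBut m t c d = true ↔ SameBut m t c d := by
  simp only [sameBut, allLt_iff, SameBut, Bool.or_eq_true, decide_eq_true_eq]
  refine forall₂_congr fun j _ => ?_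
  by_cases h : j = t <;> cases c.testBit j <;> cases d.testBit j <;> simp [h]

@[fun_prop]
theorem sameBut_primrec {m t c d : α → ℕ} (hm : Primrec m) (ht : Primrec t) (hc : Primrec c)
    (hd : Primrec d) : Primrec fun a => sameBut (m a) (t a) (c a) (d a) := by
  unfold sameBut; fun_prop

@[fun_prop]
theorem recEx_primrec {m t : α → ℕ} {R : α → Recognizer} (hm : Primrec m) (ht : Primrec t)
    (hR : Primrec R) : Primrec fun a => recEx (m a) (t a) (R a) := by
  have h : Primrec fun a => ((R a).1.pow, bitMask (R a).1.1 fun x => decide ((R a).2.1 = x),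
      tabulate (2 ^ m a) fun c => bitMask (R a).1.1 fun x => anyLt (2 ^ m a) fun d =>
        sameBut (m a) (t a) c d && decide ((R a).2.2.1.getD d 0 = x),
      bitMask (2 ^ (R a).1.1) fun X => anyLt (R a).1.1 fun x =>
        X.testBit x && (R a).2.2.2.testBit x) := by fun_prop
  refine h.of_eq fun a => ?_
  rw [recEx, AlgTab.pow_eq]
  refine Prod.ext rfl (Prod.ext (bitMask_eq_mask fun x _ => by simp) (Prod.ext
    (tabulate_congr fun c _ => bitMask_eq_mask fun x _ => ?_) (bitMask_eq_mask fun X _ => ?_)))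
  · simp only [anyLt_iff, Bool.and_eq_true, sameBut_iff, decide_eq_true_eq]
  · simp only [anyLt_iff, Bool.and_eq_true]

@[fun_prop]
theorem recAtom_primrec {m s t acc : α → ℕ} (hm : Primrec m) (hs : Primrec s) (ht : Primrec t)
    (hacc : Primrec acc) : Primrec fun a => recAtom (m a) (s a) (t a) (acc a) := by
  have h : Primrec fun a => (atomAlg.tab, 0, tabulate (2 ^ m a) fun c => bitMask 4 fun i =>
      (decide (i = 0) && c.testBit (s a)) || ((decide (i = 1) && c.testBit (t a)) ||
        (decide (i = 3) && (c.testBit (s a) && c.testBit (t a)))), acc a) := by fun_prop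
  refine h.of_eq fun a => Prod.ext rfl (Prod.ext rfl (Prod.ext
    (tabulate_congr fun c _ => bitMask_eq_mask fun i _ => ?_) rfl))
  simp [AtomBit]

end

/-! ### Recursion on formulas -/

/-- A function on formulas given by recursion: the step function receives the outermost
constructor, the components of the code of its arguments, and the values at the arguments. -/
structure MSOFormula.IsRec {σ : Type} (F : MSOFormula → σ) (S : ℕ → ℕ → ℕ → σ → σ → σ → σ) : Prop where
  -- Arguments irrelevant to a constructor are quantified universally: the step function receives
  -- them but cannot depend on them.
  le : ∀ x y s₀ s₁ s₂, S 0 x y s₀ s₁ s₂ = F (.le x y)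
  eq : ∀ x y s₀ s₁ s₂, S 1 x y s₀ s₁ s₂ = F (.eq x y)
  lab : ∀ x y s₀ s₁ s₂, S 2 x y s₀ s₁ s₂ = F (.lab x y)
  mem : ∀ x y s₀ s₁ s₂, S 3 x y s₀ s₁ s₂ = F (.mem x y)
  neg : ∀ φ i j s₁ s₂, S 4 i j (F φ) s₁ s₂ = F (.neg φ)
  conj : ∀ φ ψ i j s₀, S 5 i j s₀ (F φ) (F ψ) = F (.conj φ ψ)
  disj : ∀ φ ψ i j s₀, S 6 i j s₀ (F φ) (F ψ) = F (.disj φ ψ)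
  exElem : ∀ x φ j s₀ s₁, S 7 x j s₀ s₁ (F φ) = F (.exElem x φ)
  allElem : ∀ x φ j s₀ s₁, S 8 x j s₀ s₁ (F φ) = F (.allElem x φ)
  exSet : ∀ x φ j s₀ s₁, S 9 x j s₀ s₁ (F φ) = F (.exSet x φ)
  allSet : ∀ x φ j s₀ s₁, S 10 x j s₀ s₁ (F φ) = F (.allSet x φ)

/-- For `k = 0` the index `k / 11` is not below `k`, but this is an atomic formula and the values
read are ignored. For compound formulas all relevant indices are smaller than `k`. -/
theorem MSOFormula.IsRec.ofNat {σ : Type} {F : MSOFormula → σ} {S : ℕ → ℕ → ℕ → σ → σ → σ → σ}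
    (h : IsRec F S) (k : ℕ) (v : ℕ → σ) (hv : ∀ i < k, v i = F (ofNat i)) :
    S (k % 11) (k / 11).unpair.1 (k / 11).unpair.2 (v (k / 11)) (v (k / 11).unpair.1)
      (v (k / 11).unpair.2) = F (ofNat k) := by
  by_cases hk : k % 11 < 4
  · rw [MSOFormula.ofNat, dif_pos hk]
    generalize k % 11 = r at *
    interval_cases r
    exacts [h.le .., h.eq .., h.lab .., h.mem ..]
  · have h0 : k / 11 < k := by omega
    rw [hv _ h0, hv _ ((Nat.unpair_left_le _).trans_lt h0),
      hv _ ((Nat.unpair_right_le _).trans_lt h0)]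
    have hr : k % 11 < 11 := Nat.mod_lt _ (by norm_num)
    conv_rhs => rw [MSOFormula.ofNat, dif_neg hk]
    dsimp only
    generalize k % 11 = r at *
    interval_cases r
    exacts [h.neg .., h.conj .., h.disj .., h.exElem .., h.allElem .., h.exSet .., h.allSet ..]

section

variable {α σ : Type} [Primcodable α] [Primcodable σ]

theorem MSOFormula.toNat_primrec : Primrec MSOFormula.toNat := Primrec.encode

/-- Course-of-values recursion on Gödel numbers: the list of earlier values has length `k`, so the
current number is recovered from that length. -/
theorem MSOFormula.IsRec.primrec [Inhabited σ] {F : α → MSOFormula → σ}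
    {S : α → ℕ → ℕ → ℕ → σ → σ → σ → σ} (h : ∀ a, IsRec (F a) (S a))
    (hS : Primrec fun p : α × ℕ × ℕ × ℕ × σ × σ × σ =>
      S p.1 p.2.1 p.2.2.1 p.2.2.2.1 p.2.2.2.2.1 p.2.2.2.2.2.1 p.2.2.2.2.2.2) :
    Primrec fun p : α × MSOFormula => F p.1 p.2 := by
  have hg : Primrec₂ fun (a : α) (l : List σ) => some (S a (l.length % 11)
      (l.length / 11).unpair.1 (l.length / 11).unpair.2 (l.getD (l.length / 11) default)
      (l.getD (l.length / 11).unpair.1 default) (l.getD (l.length / 11).unpair.2 default)) := by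
    refine Primrec.option_some.comp (hS.comp (g := fun p : α × List σ =>
      (p.1, p.2.length % 11, (p.2.length / 11).unpair.1, (p.2.length / 11).unpair.2,
        p.2.getD (p.2.length / 11) default, p.2.getD (p.2.length / 11).unpair.1 default,
        p.2.getD (p.2.length / 11).unpair.2 default)) ?_)
    fun_prop
  have hf := Primrec.nat_strong_rec (fun a k => F a (MSOFormula.ofNat k)) hg fun a k => by
    simp only [List.length_map, List.length_range]
    refine congrArg some ((h a).ofNat k
      (fun i => ((List.range k).map fun k => F a (MSOFormula.ofNat k)).getD i default) ?_)
    intro i hi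
    simp [List.getD_eq_getElem?_getD, hi]
  refine (hf.comp Primrec.fst (MSOFormula.toNat_primrec.comp Primrec.snd)).of_eq fun p => ?_
  rw [MSOFormula.ofNat_toNat]

end

namespace MSOFormula

/-- Chooses a value according to the outermost constructor of a formula. -/
def select {σ : Type} (r : ℕ) (v₀ v₁ v₂ v₃ v₄ v₅ v₆ v₇ v₈ v₉ v₁₀ : σ) : σ :=
  cond (decide (r = 0)) v₀ (cond (decide (r = 1)) v₁ (cond (decide (r = 2)) v₂
    (cond (decide (r = 3)) v₃ (cond (decide (r = 4)) v₄ (cond (decide (r = 5)) v₅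
    (cond (decide (r = 6)) v₆ (cond (decide (r = 7)) v₇ (cond (decide (r = 8)) v₈
    (cond (decide (r = 9)) v₉ v₁₀)))))))))

@[fun_prop]
theorem select_primrec {α σ : Type} [Primcodable α] [Primcodable σ] {r : α → ℕ}
    {v₀ v₁ v₂ v₃ v₄ v₅ v₆ v₇ v₈ v₉ v₁₀ : α → σ} (hr : Primrec r) (h₀ : Primrec v₀)
    (h₁ : Primrec v₁) (h₂ : Primrec v₂) (h₃ : Primrec v₃) (h₄ : Primrec v₄) (h₅ : Primrec v₅)
    (h₆ : Primrec v₆) (h₇ : Primrec v₇) (h₈ : Primrec v₈) (h₉ : Primrec v₉)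
    (h₁₀ : Primrec v₁₀) : Primrec fun a => select (r a) (v₀ a) (v₁ a) (v₂ a) (v₃ a) (v₄ a)
      (v₅ a) (v₆ a) (v₇ a) (v₈ a) (v₉ a) (v₁₀ a) := by
  unfold select; fun_prop

theorem recOf_isRec (m : ℕ) : IsRec (recOf m) fun r i j R₀ R₁ R₂ => select r
    (recAtom m (3 * i) (3 * j) accLe)
    (recAtom m (3 * i) (3 * j) accMeet)
    (recAtom m (3 * i + 2) (3 * j) accMeet)
    (recAtom m (3 * i) (3 * j + 1) accMeet)
    (recNeg R₀)
    (recAnd m R₁ R₂)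
    (recNeg (recAnd m (recNeg R₁) (recNeg R₂)))
    (recEx m (3 * i) (recAnd m (recAtom m (3 * i) (3 * i) accSing) R₂))
    (recNeg (recEx m (3 * i) (recAnd m (recAtom m (3 * i) (3 * i) accSing) (recNeg R₂))))
    (recEx m (3 * i + 1) R₂)
    (recNeg (recEx m (3 * i + 1) (recNeg R₂))) := by
  constructor <;> intros <;> rfl

theorem recOf_primrec : Primrec fun p : ℕ × MSOFormula => recOf p.1 p.2 :=
  IsRec.primrec recOf_isRec (by fun_prop)

/-! ### Deciding whether a formula is a sentence, by Boolean recursion for each single variable or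
letter. -/

theorem freeElem_isRec (v : ℕ) : IsRec (fun φ => decide (v ∈ φ.freeElem))
    fun r i j b₀ b₁ b₂ => select r (decide (v = i) || decide (v = j))
      (decide (v = i) || decide (v = j)) (decide (v = j)) (decide (v = i)) b₀ (b₁ || b₂)
      (b₁ || b₂) (!decide (v = i) && b₂) (!decide (v = i) && b₂) b₂ b₂ := by
  constructor <;> intros <;> first | rfl | simp [select, freeElem]

theorem freeSet_isRec (v : ℕ) : IsRec (fun φ => decide (v ∈ φ.freeSet))
    fun r i j b₀ b₁ b₂ => select r false false false (decide (v = j)) b₀ (b₁ || b₂)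
      (b₁ || b₂) b₂ b₂ (!decide (v = i) && b₂) (!decide (v = i) && b₂) := by
  constructor <;> intros <;> first | rfl | simp [select, freeSet]

theorem letters_isRec (v : ℕ) : IsRec (fun φ => decide (v ∈ φ.letters))
    fun r i _ b₀ b₁ b₂ => select r false false (decide (v = i)) false b₀ (b₁ || b₂)
      (b₁ || b₂) b₂ b₂ b₂ b₂ := by
  constructor <;> intros <;> first | rfl | simp [select, letters]

theorem freeElem_primrec : Primrec fun p : ℕ × MSOFormula => decide (p.1 ∈ p.2.freeElem) :=
  IsRec.primrec freeElem_isRec (by fun_prop)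

theorem freeSet_primrec : Primrec fun p : ℕ × MSOFormula => decide (p.1 ∈ p.2.freeSet) :=
  IsRec.primrec freeSet_isRec (by fun_prop)

theorem letters_primrec : Primrec fun p : ℕ × MSOFormula => decide (p.1 ∈ p.2.letters) :=
  IsRec.primrec letters_isRec (by fun_prop)

/-- Bounds the search for offending variables and letters in `sentenceB`. -/
theorem le_toNat (φ : MSOFormula) (v : ℕ) :
    (v ∈ φ.freeElem → v ≤ φ.toNat) ∧ (v ∈ φ.freeSet → v ≤ φ.toNat) ∧
      (v ∈ φ.letters → v ≤ φ.toNat) := by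
  induction φ with
  | le x y | eq x y | lab x y | mem x y =>
    have := Nat.left_le_pair x y
    have := Nat.right_le_pair x y
    simp only [freeElem, freeSet, letters, toNat, Finset.mem_insert, Finset.mem_singleton,
      Finset.notMem_empty]
    grind
  | neg φ ih =>
    simp only [freeElem, freeSet, letters, toNat]
    grind
  | conj φ ψ ih₁ ih₂ | disj φ ψ ih₁ ih₂ =>
    have := Nat.left_le_pair φ.toNat ψ.toNat
    have := Nat.right_le_pair φ.toNat ψ.toNat
    simp only [freeElem, freeSet, letters, toNat, Finset.mem_union]
    grind
  | exElem x φ ih | allElem x φ ih | exSet x φ ih | allSet x φ ih =>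
    have := Nat.right_le_pair x φ.toNat
    simp only [freeElem, freeSet, letters, toNat, Finset.mem_erase]
    grind

/-- Decides whether a formula is a sentence over the `n`-letter alphabet. -/
def sentenceB (n : ℕ) (φ : MSOFormula) : Bool := allLt (φ.toNat + 1) fun v =>
  !decide (v ∈ φ.freeElem) && (!decide (v ∈ φ.freeSet) &&
    (!decide (v ∈ φ.letters) || decide (v < n)))

theorem sentenceB_iff {n : ℕ} {φ : MSOFormula} : sentenceB n φ = true ↔ φ.IsSentenceOver n := by
  simp only [sentenceB, allLt_iff, IsSentenceOver, Finset.eq_empty_iff_forall_notMem,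
    Bool.and_eq_true, Bool.not_eq_true', decide_eq_false_iff_not, AlgTab.not_or_iff_imp,
    decide_eq_true_eq]
  constructor
  · intro h
    exact ⟨fun v hv => (h v (Nat.lt_succ_of_le ((le_toNat φ v).1 hv))).1 hv,
      fun v hv => (h v (Nat.lt_succ_of_le ((le_toNat φ v).2.1 hv))).2.1 hv,
      fun v hv => (h v (Nat.lt_succ_of_le ((le_toNat φ v).2.2 hv))).2.2 hv⟩
  · rintro ⟨h1, h2, h3⟩ v -
    exact ⟨h1 v, h2 v, h3 v⟩

theorem sentenceB_primrec : Primrec fun p : ℕ × MSOFormula => sentenceB p.1 p.2 := by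
  have hsw : Primrec fun q : (ℕ × MSOFormula) × ℕ => (q.2, q.1.2) := by fun_prop
  have h1 : Primrec fun q : (ℕ × MSOFormula) × ℕ => decide (q.2 ∈ q.1.2.freeElem) :=
    freeElem_primrec.comp hsw
  have h2 : Primrec fun q : (ℕ × MSOFormula) × ℕ => decide (q.2 ∈ q.1.2.freeSet) :=
    freeSet_primrec.comp hsw
  have h3 : Primrec fun q : (ℕ × MSOFormula) × ℕ => decide (q.2 ∈ q.1.2.letters) :=
    letters_primrec.comp hsw
  have h4 : Primrec fun p : ℕ × MSOFormula => p.2.toNat := toNat_primrec.comp Primrec.snd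
  exact Primrec.allLt_fun (by fun_prop) (Primrec.and_fun (Primrec.not_fun h1)
    (Primrec.and_fun (Primrec.not_fun h2) (Primrec.or_fun (Primrec.not_fun h3) (by fun_prop))))

/-! ### The decision procedure -/

/-- Decides whether a recognizer accepts a word over the `n`-letter alphabet. -/
def acceptsB (n : ℕ) (R : Recognizer) : Bool :=
  R.2.2.2.testBit R.2.1 || anyLt R.1.1 fun x => R.2.2.2.testBit x &&
    R.1.cl (fun y => anyLt n fun a => decide (R.2.2.1.getD (2 ^ (3 * a + 2)) 0 = y)) x

theorem acceptsB_iff {n : ℕ} {R : Recognizer} : acceptsB n R = true ↔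
    R.2.2.2.testBit R.2.1 = true ∨ ∃ x < R.1.1, R.2.2.2.testBit x = true ∧
      Cl R.1.alg (letterGen R n) x := by
  simp only [acceptsB, Bool.or_eq_true, anyLt_iff, Bool.and_eq_true, AlgTab.cl_iff,
    decide_eq_true_eq]
  rfl

theorem acceptsB_primrec : Primrec fun p : ℕ × Recognizer => acceptsB p.1 p.2 := by
  unfold acceptsB; fun_prop

/-- The number of tracks, `3 * (φ.toNat + n) + 3`, accommodates everything in the formula and all
`n` letters, and is computable from the input. -/
theorem nonempty_language_iff {n : ℕ} {φ : MSOFormula} : (φ.language n).Nonempty ↔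
    acceptsB n (recOf (3 * (φ.toNat + n) + 3) φ) = true := by
  rw [acceptsB_iff, ← exists_models_iff φ (by omega) (by omega)]
  constructor
  · rintro ⟨w, hw⟩
    obtain ⟨u, rfl⟩ := Quotient.exists_rep w
    exact ⟨u, hw⟩
  · rintro ⟨u, hu⟩
    exact ⟨Quotient.mk _ u, hu⟩

end MSOFormula

/-- Being a sentence belongs to the decided predicate, so ill-formed inputs are rejected; the
decision procedure is even primitive recursive. -/
theorem mainTheorem7 :
    ComputablePred fun p : ℕ × MSOFormula =>
      p.2.IsSentenceOver p.1 ∧ (p.2.language p.1).Nonempty := by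
  have h1 : Primrec fun p : ℕ × MSOFormula => p.2.toNat :=
    MSOFormula.toNat_primrec.comp Primrec.snd
  have h2 : Primrec fun p : ℕ × MSOFormula => recOf (3 * (p.2.toNat + p.1) + 3) p.2 :=
    MSOFormula.recOf_primrec.comp
      (g := fun p : ℕ × MSOFormula => (3 * (p.2.toNat + p.1) + 3, p.2)) (by fun_prop)
  have h3 : Primrec fun p : ℕ × MSOFormula =>
      MSOFormula.acceptsB p.1 (recOf (3 * (p.2.toNat + p.1) + 3) p.2) :=
    MSOFormula.acceptsB_primrec.comp (Primrec.fst.pair h2)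
  refine ComputablePred.computable_iff.2
    ⟨_, (Primrec.and_fun MSOFormula.sentenceB_primrec h3).to_comp, funext fun p => ?_⟩
  simp only [Bool.and_eq_true, MSOFormula.sentenceB_iff, MSOFormula.nonempty_language_iff]
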